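/- For $|q|<1$ put $(a;q)_\infty=\prod_{j\ge 0}(1-aq^j)$ and $(a_1,\dots,a_r;q)_\infty=(a_1;q)_\infty\cdots(a_r;q)_\infty$, and let $$X(q)=\frac{(q,q^{11},q^{12};q^{12})_\infty}{(q;q)_\infty},\qquad Y(q)=\frac{(q^5,q^7,q^{12};q^{12})_\infty}{(q;q)_\infty}.$$ For integers $k\ge 1$ and $m>1$ define sequences by the power series expansions in $q$ $$\sum_{n\ge0}\xi_{1,k}(n)q^n=\frac{Y^k(q)}{X^k(q)},\qquad \sum_{n\ge0}\xi_{m,k}(n)q^n=\frac{X^k(q)\,Y^k(q^m)}{Y^k(q)\,X^k(q^m)},\qquad \sum_{n\ge0}\xi_4(n)q^n=\frac{Y(q)Y(q^2)}{X(q)X(q^2)},$$ and let $\xi'_{m,k}(n)$ (for all $m,k\ge1$) and $\xi'_4(n)$ denote the coefficients of $q^n$ in the reciprocals of the corresponding series. Then for every integer $n\ge 0$: 1. $\xi_{1,1}(2n+3)=-\xi'_{1,1}(2n+1)$; 2. $\xi_{1,1}(4n+2)=\xi'_{1,1}(4n)$; 3. $\xi_{1,1}(6n+2)=\xi'_{1,1}(6n)$;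 4. $\xi_{1,2}(12n+7)=\xi'_{1,2}(12n+3)$; 5. $\xi_{1,2}(24n+12)=\xi'_{1,2}(24n+8)$; 6. $\xi_{2,1}(2n+3)=-\xi'_{2,1}(2n+1)$; 7. $\xi_{2,1}(4n+2)=\xi'_{2,1}(4n)$; 8. $\xi_{2,1}(12n+8)=\xi'_{2,1}(12n+6)$; 9. $\xi_{2,2}(12n+7)=\xi'_{2,2}(12n+3)$; 10. $\xi_{2,2}(24n+12)=\xi'_{2,2}(24n+8)$; 11. $\xi_{3,1}(3n+5)=\xi'_{3,1}(3n+1)$; 12. $\xi_{3,1}(6n+8)=-\xi'_{3,1}(6n+4)$; 13. $\xi_{3,1}(6n+4)=-\xi'_{3,1}(6n)$; 14. $\xi_{3,1}(12n+7)=\xi'_{3,1}(12n+3)$; 15. $\xi_{3,2}(24n+14)=\xi'_{3,2}(24n+6)$; 16. $\xi_{3,2}(36n+25)=\xi'_{3,2}(36n+17)$; 17. $\xi_4(12n+15)=-\xi'_4(12n+9)$; 18. $\xi_4(12n+7)=-\xi'_4(12n+1)$; 19. $\xi_4(12n+10)=\xi'_4(12n+4)$; 20. $\xi_4(12n+11)=-\xi'_4(12n+5)$;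 21. $\xi_4(24n+13)=\xi'_4(24n+7)$; 22. $\xi_4(36n+24)=\xi'_4(36n+18)$. -/

import Mathlib

/-! All `q`-series are formal power series in one variable over `ℂ`; the variable `q` is
`PowerSeries.X`.  Infinite products converge in the usual (coefficientwise) topology. -/

noncomputable section

open PowerSeries Filter

open scoped PowerSeries.WithPiTopology

namespace Slater

/-- The `q`-shifted factorial `(a; q)_∞ = ∏_{j ≥ 0} (1 - a q ^ j)`. It converges as soon as
`q` has constant term `0`, see `multipliable_qPoch`. -/
def qPoch (a q : ℂ⟦X⟧) : ℂ⟦X⟧ := ∏' j : ℕ, (1 - a * q ^ j)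

/-- `X(q) = (q, q^11, q^12; q^12)_∞ / (q; q)_∞`. -/
def slaterX (q : ℂ⟦X⟧) : ℂ⟦X⟧ :=
  qPoch q (q ^ 12) * qPoch (q ^ 11) (q ^ 12) * qPoch (q ^ 12) (q ^ 12) * (qPoch q q)⁻¹

/-- `Y(q) = (q^5, q^7, q^12; q^12)_∞ / (q; q)_∞`. -/
def slaterY (q : ℂ⟦X⟧) : ℂ⟦X⟧ :=
  qPoch (q ^ 5) (q ^ 12) * qPoch (q ^ 7) (q ^ 12) * qPoch (q ^ 12) (q ^ 12) * (qPoch q q)⁻¹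

/-- The generating series of `ξ_{m,k}`: it is `Y(q)^k / X(q)^k` for `m = 1`, and
`X(q)^k Y(q^m)^k / (Y(q)^k X(q^m)^k)` for `m > 1`. -/
def xiSeries (m k : ℕ) : ℂ⟦X⟧ :=
  if m = 1 then
    slaterY X ^ k * (slaterX X ^ k)⁻¹
  else
    slaterX X ^ k * slaterY (X ^ m) ^ k * (slaterY X ^ k * slaterX (X ^ m) ^ k)⁻¹

/-- The generating series of `ξ_4`: `Y(q) Y(q^2) / (X(q) X(q^2))`. -/
def xi4Series : ℂ⟦X⟧ :=
  slaterY X * slaterY (X ^ 2) * (slaterX X * slaterX (X ^ 2))⁻¹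

/-- The coefficient `ξ_{m,k}(n)`. -/
def xi (m k n : ℕ) : ℂ := coeff n (xiSeries m k)

/-- The coefficient `ξ'_{m,k}(n)` of the reciprocal series. -/
def xi' (m k n : ℕ) : ℂ := coeff n (xiSeries m k)⁻¹

/-- The coefficient `ξ_4(n)`. -/
def xi4 (n : ℕ) : ℂ := coeff n xi4Series

/-- The coefficient `ξ'_4(n)` of the reciprocal series. -/
def xi4' (n : ℕ) : ℂ := coeff n xi4Series⁻¹

/-! The products above converge, and all the series that are inverted have constant term `1`,
so that `⁻¹` is a genuine inverse. -/

theorem multipliable_qPoch (a q : ℂ⟦X⟧) (hq : constantCoeff q = 0) :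
    Multipliable fun j : ℕ => 1 - a * q ^ j := by
  simp_rw [sub_eq_add_neg]
  apply WithPiTopology.multipliable_one_add_of_tendsto_order_atTop_nhds_top
  refine ENat.tendsto_nhds_top_iff_natCast_lt.mpr fun n => eventually_atTop.mpr ⟨n + 1, ?_⟩
  intro m hm
  rw [order_neg]
  refine lt_of_lt_of_le ?_ ((nat_le_order (q ^ m) m ?_).trans (le_trans ?_ (le_order_mul a _)))
  · exact_mod_cast hm
  · exact X_pow_dvd_iff.mp (pow_dvd_pow_of_dvd (X_dvd_iff.mpr hq) m)
  · exact le_add_self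

theorem constantCoeff_qPoch (a q : ℂ⟦X⟧) (ha : constantCoeff a = 0) (hq : constantCoeff q = 0) :
    constantCoeff (qPoch a q) = 1 := by
  rw [qPoch, (multipliable_qPoch a q hq).map_tprod _ (WithPiTopology.continuous_constantCoeff ℂ)]
  simp [ha]

theorem constantCoeff_slaterX (q : ℂ⟦X⟧) (hq : constantCoeff q = 0) :
    constantCoeff (slaterX q) = 1 := by
  simp [slaterX, constantCoeff_qPoch, hq]

theorem constantCoeff_slaterY (q : ℂ⟦X⟧) (hq : constantCoeff q = 0) :
    constantCoeff (slaterY q) = 1 := by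
  simp [slaterY, constantCoeff_qPoch, hq]

theorem constantCoeff_xiSeries (m k : ℕ) (hm : 1 ≤ m) : constantCoeff (xiSeries m k) = 1 := by
  have h : m ≠ 0 := by omega
  unfold xiSeries
  split_ifs <;> simp [constantCoeff_slaterX, constantCoeff_slaterY, h]

theorem constantCoeff_xi4Series : constantCoeff xi4Series = 1 := by
  simp [xi4Series, constantCoeff_slaterX, constantCoeff_slaterY]

end Slater

end

noncomputable section

open PowerSeries Filter

open scoped PowerSeries.WithPiTopology

namespace Slater

/-! ### The finite form of the Jacobi triple product -/

section FiniteTripleProduct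

variable {R : Type*} [CommRing R]

/-! Put h(q) = q X(q)/Y(q) and r(q) = φ(q)/φ(q³), where φ(q) = ∑ q^(n²). Each series in the theorem
is q^d G with G = h^(-k), (h(q)/h(q^m))^k or 1/(h(q)h(q²)). Then ξ(j + 2d) and ξ'(j) are the
coefficients of G and 1/G at the same exponent j + d, so each claim says that G - 1/G, or G + 1/G up
to a constant term, vanishes on a residue class (`coeff_eq_coeff_inv`, `coeff_eq_neg_coeff_inv`).

Jacobi's triple product gives h = (r - 1)/(r + 1) (`thetaOne_mul_thetaPhi_add`), so everything is
rational in values of r. The product formulas for h(q)h(-q) and for h over the cube roots of unity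
become modular equations. With y = r(q²) one gets a quadratic relation (`thetaRatio_quadratic`);
with x = r(q³) and w = φ(q)/φ(q⁹) - 1 one gets r x = 1 + w and w³ = x⁴ - 1 (`thetaCubic_pow_three`).

Let E = 1/h - h - y (`thetaOdd`). Then E and y are the two roots of (r² - 1)T² - 4rT + r² + 3,
whence 1/h = (1 + E)(1 + y)/2 and h = (1 - E)(1 - y)/2. For h, h(q)/h(q²) and h(q)h(q²), the
combinations needed are polynomials in E and y.

Residues modulo powers of 2 come from y being a series in q² and E having only exponents 3 mod 4
(`graded_thetaOdd`), which follows from E(q)² = (E y)(q²). Residues modulo 3 come from w having only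
exponents 1 mod 3, so that 1, w, w² over series in q³ give 3-dissections; in particular E and E + y
have no exponent 1 mod 3. The finer moduli 24 and 36 come from descent: y E² and y(1 + E²) are
explicit series in q², E³ and E(q³) agree on exponents divisible by 3, and `level_six` turns a
component of the level-three function into a series in q² whose coefficients are already controlled.
-/

/-- The triangular number `k (k - 1) / 2`, for `k` an integer. -/
def triangle (k : ℤ) : ℕ := (k * (k - 1) / 2).toNat

theorem two_mul_triangle (k : ℤ) : 2 * (triangle k : ℤ) = k * (k - 1) := by
  have h : 0 ≤ k * (k - 1) := by
    rcases le_or_gt k 0 with h | h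
    · exact mul_nonneg_of_nonpos_of_nonpos h (by omega)
    · exact mul_nonneg h.le (by omega)
  have h2 : (2 : ℤ) ∣ k * (k - 1) := (Int.even_mul_pred_self k).two_dvd
  rw [triangle, Int.toNat_of_nonneg (Int.ediv_nonneg h (by norm_num)), Int.mul_ediv_cancel' h2]

theorem triangle_add_one (k : ℤ) : (triangle (k + 1) : ℤ) = triangle k + k := by
  have h1 := two_mul_triangle k
  have h2 := two_mul_triangle (k + 1)
  linarith

/-- Used twice: it turns the theta series with A = B = q into ∑ q^(k²), and it shows that the k-th
theta term has order at least k² when A and B have no constant term. -/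
theorem triangle_add_triangle (k : ℤ) : triangle (k + 1) + triangle k = k.natAbs ^ 2 := by
  zify
  have h1 := two_mul_triangle k
  have h2 := two_mul_triangle (k + 1)
  rw [sq_abs]
  linarith

/-- The general term `A ^ (k (k + 1) / 2) * B ^ (k (k - 1) / 2)` of Ramanujan's theta function. -/
def thetaTerm (A B : R) (k : ℤ) : R := A ^ triangle (k + 1) * B ^ triangle k

/-- The Gaussian binomial coefficient `[2n, n + k]`, defined by a three-term recursion in `n`. -/
def centralGauss (Q : R) : ℕ → ℤ → R
  | 0, k => if k = 0 then 1 else 0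
  | n + 1, k => (1 + Q ^ (2 * n + 1)) * centralGauss Q n k
      + Q ^ (n + 1 - k).toNat * centralGauss Q n (k - 1)
      + Q ^ (n + 1 + k).toNat * centralGauss Q n (k + 1)

theorem centralGauss_eq_zero (Q : R) (n : ℕ) (k : ℤ) (h : n < k.natAbs) :
    centralGauss Q n k = 0 := by
  induction n generalizing k with
  | zero => simp [centralGauss]; omega
  | succ n ih =>
    rw [centralGauss, ih k (by omega), ih (k - 1) (by omega), ih (k + 1) (by omega)]
    ring

/-- A factor A Q^n, with Q = AB, is absorbed by shifting the index by one. The bound on k makes the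
truncated exponent exact; beyond it the Gauss coefficient multiplying the term is zero. -/
theorem thetaTerm_mul_left (A B : R) (n : ℕ) (k : ℤ) (h : k ≤ n + 1) :
    A * (A * B) ^ n * thetaTerm A B (k - 1) = (A * B) ^ (n + 1 - k).toNat * thetaTerm A B k := by
  have h1 := triangle_add_one k
  have h2 := triangle_add_one (k - 1)
  rw [sub_add_cancel] at h2
  have e : ((n + 1 - k).toNat : ℤ) = n + 1 - k := Int.toNat_of_nonneg (by omega)
  simp only [thetaTerm, sub_add_cancel, mul_pow]
  have e1 : 1 + n + triangle k = (n + 1 - k).toNat + triangle (k + 1) := by zify; linarith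
  have e2 : n + triangle (k - 1) = (n + 1 - k).toNat + triangle k := by zify; linarith
  calc A * (A ^ n * B ^ n) * (A ^ triangle k * B ^ triangle (k - 1))
      = A ^ (1 + n + triangle k) * B ^ (n + triangle (k - 1)) := by ring
    _ = _ := by rw [e1, e2]; ring

theorem thetaTerm_mul_right (A B : R) (n : ℕ) (k : ℤ) (h : -(n + 1) ≤ k) :
    B * (A * B) ^ n * thetaTerm A B (k + 1) = (A * B) ^ (n + 1 + k).toNat * thetaTerm A B k := by
  have h1 := triangle_add_one k
  have h2 := triangle_add_one (k + 1)
  have e : ((n + 1 + k).toNat : ℤ) = n + 1 + k := Int.toNat_of_nonneg (by omega)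
  simp only [thetaTerm, mul_pow]
  have e1 : n + triangle (k + 1 + 1) = (n + 1 + k).toNat + triangle (k + 1) := by zify; linarith
  have e2 : 1 + n + triangle (k + 1) = (n + 1 + k).toNat + triangle k := by zify; linarith
  calc B * (A ^ n * B ^ n) * (A ^ triangle (k + 1 + 1) * B ^ triangle (k + 1))
      = A ^ (n + triangle (k + 1 + 1)) * B ^ (1 + n + triangle (k + 1)) := by ring
    _ = _ := by rw [e1, e2]; ring

theorem support_centralGauss_finite (Q : R) (n : ℕ) (f : ℤ → R) (c : ℤ) :
    (Function.support fun k => centralGauss Q n (k + c) * f k).Finite := by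
  refine (Set.finite_Icc (-(n : ℤ) - c) (n - c)).subset fun k hk => ?_
  by_contra hk'
  refine hk ?_
  simp only [Set.mem_Icc, not_and_or, not_le] at hk'
  simp only
  rw [centralGauss_eq_zero Q n _ (by omega), zero_mul]

/-- The new factor is (1 + A Q^n)(1 + B Q^n) = (1 + Q^(2n+1)) + A Q^n + B Q^n. The last two summands
shift k by one in opposite directions, and the recursion for `centralGauss` records exactly this. -/
theorem finite_triple_product (A B : R) (n : ℕ) :
    ∏ j ∈ Finset.range n, ((1 + A * (A * B) ^ j) * (1 + B * (A * B) ^ j)) =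
      ∑ᶠ k : ℤ, centralGauss (A * B) n k * thetaTerm A B k := by
  induction n with
  | zero =>
    rw [finsum_eq_single _ 0]
    · simp [centralGauss, thetaTerm, triangle]
    · intro k hk
      simp [centralGauss, hk]
  | succ n ih =>
    set Q := A * B with hQ
    have key (k : ℤ) : centralGauss Q (n + 1) k * thetaTerm A B k =
        (1 + Q ^ (2 * n + 1)) * (centralGauss Q n (k + 0) * thetaTerm A B k) +
        (A * Q ^ n) * (centralGauss Q n (k + -1) * thetaTerm A B (k - 1)) +
        (B * Q ^ n) * (centralGauss Q n (k + 1) * thetaTerm A B (k + 1)) := by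
      have hl : A * Q ^ n * (centralGauss Q n (k + -1) * thetaTerm A B (k - 1)) =
          Q ^ (n + 1 - k).toNat * centralGauss Q n (k - 1) * thetaTerm A B k := by
        rcases le_or_gt k (n + 1) with h | h
        · rw [← sub_eq_add_neg]
          linear_combination centralGauss Q n (k - 1) * thetaTerm_mul_left A B n k h
        · rw [← sub_eq_add_neg, centralGauss_eq_zero Q n (k - 1) (by omega)]; ring
      have hr : B * Q ^ n * (centralGauss Q n (k + 1) * thetaTerm A B (k + 1)) =
          Q ^ (n + 1 + k).toNat * centralGauss Q n (k + 1) * thetaTerm A B k := by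
        rcases le_or_gt (-(n + 1) : ℤ) k with h | h
        · linear_combination centralGauss Q n (k + 1) * thetaTerm_mul_right A B n k h
        · rw [centralGauss_eq_zero Q n (k + 1) (by omega)]; ring
      rw [hl, hr, centralGauss, add_zero]
      ring
    have f0 := support_centralGauss_finite Q n (thetaTerm A B) 0
    have f1 := support_centralGauss_finite Q n (fun k => thetaTerm A B (k - 1)) (-1)
    have f2 := support_centralGauss_finite Q n (fun k => thetaTerm A B (k + 1)) 1
    have hs {g : ℤ → R} (c : R) (hg : g.support.Finite) :
        (Function.support fun k => c * g k).Finite :=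
      hg.subset fun k hk hk' => hk (by simp [hk'])
    have g0 := hs (1 + Q ^ (2 * n + 1)) f0
    have g1 := hs (A * Q ^ n) f1
    have g2 := hs (B * Q ^ n) f2
    rw [finsum_congr key, finsum_add_distrib ((g0.union g1).subset (Function.support_add _ _)) g2,
      finsum_add_distrib g0 g1, ← mul_finsum' _ _ f0, ← mul_finsum' _ _ f1, ← mul_finsum' _ _ f2,
      Finset.prod_range_succ, ih]
    have s1 : ∑ᶠ k : ℤ, centralGauss Q n (k + -1) * thetaTerm A B (k - 1) =
        ∑ᶠ k : ℤ, centralGauss Q n k * thetaTerm A B k :=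
      finsum_comp_equiv (Equiv.subRight (1 : ℤ)) (f := fun k => centralGauss Q n k * thetaTerm A B k)
    have s2 : ∑ᶠ k : ℤ, centralGauss Q n (k + 1) * thetaTerm A B (k + 1) =
        ∑ᶠ k : ℤ, centralGauss Q n k * thetaTerm A B k :=
      finsum_comp_equiv (Equiv.addRight (1 : ℤ)) (f := fun k => centralGauss Q n k * thetaTerm A B k)
    simp only [add_zero]
    rw [s1, s2]
    have : Q ^ (2 * n + 1) = A * B * Q ^ n * Q ^ n := by rw [hQ]; ring
    rw [this]
    ring

/-- The finite product `(Q; Q)_n`. -/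
def qFac (Q : R) (n : ℕ) : R := ∏ j ∈ Finset.range n, (1 - Q * Q ^ j)

theorem qFac_succ (Q : R) (n : ℕ) : qFac Q (n + 1) = qFac Q n * (1 - Q * Q ^ n) :=
  Finset.prod_range_succ _ _

theorem centralGauss_natCast_self (Q : R) (n : ℕ) :
    centralGauss Q n n = 1 ∧ centralGauss Q n (-n) = 1 := by
  induction n with
  | zero => simp [centralGauss]
  | succ n ih =>
    constructor
    · rw [centralGauss, centralGauss_eq_zero Q n _ (by omega),
        centralGauss_eq_zero Q n (_ + 1) (by omega)]
      simp [ih.1]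
    · rw [centralGauss, centralGauss_eq_zero Q n _ (by omega),
        centralGauss_eq_zero Q n (_ - 1) (by omega)]
      have : -((n + 1 : ℕ) : ℤ) + 1 = -n := by push_cast; ring
      rw [this, ih.2]
      simp

/-- The quotient formula for Gaussian binomials, stated without division. It is what makes each
coefficient of the finite identity tend to 1/(Q; Q)_∞. The extreme indices k = ±n are separate
because a factor of the denominator is then empty. -/
theorem centralGauss_mul_qFac (Q : R) (n a b : ℕ) (k : ℤ) (ha : (a : ℤ) = n + k)
    (hb : (b : ℤ) = n - k) : centralGauss Q n k * (qFac Q a * qFac Q b) = qFac Q (2 * n) := by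
  induction n generalizing a b k with
  | zero =>
    obtain rfl : k = 0 := by omega
    obtain rfl : a = 0 := by omega
    obtain rfl : b = 0 := by omega
    simp [centralGauss, qFac]
  | succ n ih =>
    rcases Nat.eq_zero_or_pos a with rfl | ha'
    · obtain rfl : k = -(n + 1 : ℕ) := by omega
      obtain rfl : b = 2 * (n + 1) := by omega
      rw [(centralGauss_natCast_self Q (n + 1)).2]
      simp [qFac]
    rcases Nat.eq_zero_or_pos b with rfl | hb'
    · obtain rfl : k = (n + 1 : ℕ) := by omega
      obtain rfl : a = 2 * (n + 1) := by omega
      rw [(centralGauss_natCast_self Q (n + 1)).1]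
      simp [qFac]
    obtain ⟨a, rfl⟩ : ∃ c, a = c + 1 := ⟨a - 1, by omega⟩
    obtain ⟨b, rfl⟩ : ∃ c, b = c + 1 := ⟨b - 1, by omega⟩
    have h0 := ih a b k (by omega) (by omega)
    have h1 : centralGauss Q n (k - 1) * (qFac Q (a + 1) * qFac Q (b + 1)) =
        (1 - Q * Q ^ a) * (1 - Q ^ a) * qFac Q (2 * n) := by
      rcases Nat.eq_zero_or_pos a with rfl | ha
      · rw [centralGauss_eq_zero Q n _ (by omega)]; simp
      · obtain ⟨a, rfl⟩ : ∃ c, a = c + 1 := ⟨a - 1, by omega⟩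
        rw [← ih a (b + 1) (k - 1) (by omega) (by omega), qFac_succ Q (a + 1), qFac_succ Q a]
        ring
    have h2 : centralGauss Q n (k + 1) * (qFac Q (a + 1) * qFac Q (b + 1)) =
        (1 - Q * Q ^ b) * (1 - Q ^ b) * qFac Q (2 * n) := by
      rcases Nat.eq_zero_or_pos b with rfl | hb
      · rw [centralGauss_eq_zero Q n _ (by omega)]; simp
      · obtain ⟨b, rfl⟩ : ∃ c, b = c + 1 := ⟨b - 1, by omega⟩
        rw [← ih (a + 1) b (k + 1) (by omega) (by omega), qFac_succ Q (b + 1), qFac_succ Q b]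
        ring
    have e1 : (n + 1 - k).toNat = b + 1 := by omega
    have e2 : (n + 1 + k).toNat = a + 1 := by omega
    have e3 : 2 * (n + 1) = 2 * n + 1 + 1 := by ring
    have e4 : 2 * n = a + b := by omega
    have h0' : centralGauss Q n k * (qFac Q (a + 1) * qFac Q (b + 1)) =
        (1 - Q * Q ^ a) * (1 - Q * Q ^ b) * qFac Q (2 * n) := by
      rw [← h0, qFac_succ, qFac_succ]
      ring
    have e5 : Q ^ (2 * n) = Q ^ a * Q ^ b := by rw [e4, pow_add]
    rw [centralGauss, e1, e2, e3, qFac_succ Q (2 * n + 1), qFac_succ Q (2 * n), pow_succ Q (2 * n),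
      e5]
    linear_combination (1 + Q ^ a * Q ^ b * Q) * h0' + Q ^ (b + 1) * h1 + Q ^ (a + 1) * h2

end FiniteTripleProduct

/-! ### Infinite products -/

theorem hasProd_qPoch (a q : ℂ⟦X⟧) (hq : constantCoeff q = 0) :
    HasProd (fun j : ℕ => 1 - a * q ^ j) (qPoch a q) :=
  (multipliable_qPoch a q hq).hasProd

theorem qPoch_ne_zero {a q : ℂ⟦X⟧} (ha : constantCoeff a = 0) (hq : constantCoeff q = 0) :
    qPoch a q ≠ 0 := by
  intro h
  have := constantCoeff_qPoch a q ha hq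
  simp [h] at this

/-- If `X ^ n ∣ a q ^ j` for all `j ≥ m`, then `(a; q)_∞` agrees with its `m`-th partial product
modulo `X ^ n`. -/
theorem X_pow_dvd_qPoch_sub {a q : ℂ⟦X⟧} (hq : constantCoeff q = 0) {n m : ℕ}
    (h : ∀ j, m ≤ j → X ^ n ∣ a * q ^ j) :
    X ^ n ∣ qPoch a q - ∏ j ∈ Finset.range m, (1 - a * q ^ j) := by
  have hfin (N : ℕ) (hN : m ≤ N) : X ^ n ∣ ∏ j ∈ Finset.range N, (1 - a * q ^ j) -
      ∏ j ∈ Finset.range m, (1 - a * q ^ j) := by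
    induction N, hN using Nat.le_induction with
    | base => simp
    | succ N hN ih =>
      rw [Finset.prod_range_succ, mul_sub, mul_one, sub_right_comm]
      exact dvd_sub ih (Dvd.dvd.mul_left (h N hN) _)
  rw [X_pow_dvd_iff]
  intro d hd
  have ht := ((WithPiTopology.continuous_coeff ℂ d).tendsto _).comp
    (hasProd_qPoch a q hq).tendsto_prod_nat
  have hc : Tendsto ((fun x => coeff d x) ∘ fun N => ∏ j ∈ Finset.range N, (1 - a * q ^ j)) atTop
      (nhds (coeff d (∏ j ∈ Finset.range m, (1 - a * q ^ j)))) := by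
    refine tendsto_const_nhds.congr' (eventually_atTop.mpr ⟨m, fun N hN => ?_⟩)
    have := X_pow_dvd_iff.mp (hfin N hN) d hd
    rw [map_sub, sub_eq_zero] at this
    exact this.symm
  rw [map_sub, sub_eq_zero]
  exact tendsto_nhds_unique ht hc

/-- **Jacobi's triple product identity**, for Ramanujan's theta function in two variables. -/
theorem hasSum_thetaTerm {A B : ℂ⟦X⟧} (hA : constantCoeff A = 0) (hB : constantCoeff B = 0) :
    HasSum (thetaTerm A B)
      (qPoch (-A) (A * B) * qPoch (-B) (A * B) * qPoch (A * B) (A * B)) := by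
  have hXA := X_dvd_iff.mpr hA
  have hXB := X_dvd_iff.mpr hB
  have hQ : constantCoeff (A * B) = 0 := by simp [hA]
  have hXQ := X_dvd_iff.mpr hQ
  have hT (d : ℕ) (k : ℤ) (hk : d < k.natAbs) : coeff d (thetaTerm A B k) = 0 := by
    have : X ^ (k.natAbs ^ 2) ∣ thetaTerm A B k := by
      rw [← triangle_add_triangle, pow_add]
      exact mul_dvd_mul (pow_dvd_pow_of_dvd hXA _) (pow_dvd_pow_of_dvd hXB _)
    exact X_pow_dvd_iff.mp this d (by nlinarith)
  rw [WithPiTopology.hasSum_iff_hasSum_coeff]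
  intro d
  have hfin : ∀ k ∉ Finset.Icc (-(d : ℤ)) d, coeff d (thetaTerm A B k) = 0 := by
    intro k hk
    rw [Finset.mem_Icc] at hk
    exact hT d k (by omega)
  suffices hsum : coeff d (qPoch (-A) (A * B) * qPoch (-B) (A * B) * qPoch (A * B) (A * B)) =
      ∑ k ∈ Finset.Icc (-(d : ℤ)) d, coeff d (thetaTerm A B k) by
    rw [hsum]
    exact hasSum_sum_of_ne_finset_zero hfin
  -- Modulo X^(d+1) every infinite product equals a finite one, so the finite identity at one fixed
  -- level replaces a limit.
  set π := Ideal.Quotient.mk (Ideal.span {(X : ℂ⟦X⟧) ^ (d + 1)}) with hπ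
  have hπeq {f g : ℂ⟦X⟧} : π f = π g ↔ X ^ (d + 1) ∣ f - g := by
    rw [hπ, Ideal.Quotient.eq, Ideal.mem_span_singleton]
  set E := qPoch (A * B) (A * B) with hE
  have hE1 : constantCoeff E = 1 := constantCoeff_qPoch _ _ hQ hQ
  have hpow {m j : ℕ} (h : m ≤ j) : (X : ℂ⟦X⟧) ^ m ∣ (A * B) ^ j :=
    (pow_dvd_pow _ h).trans (pow_dvd_pow_of_dvd hXQ _)
  have hfac (m : ℕ) (hm : d ≤ m) : π (qFac (A * B) m) = π E := by
    refine (hπeq.mpr (X_pow_dvd_qPoch_sub hQ fun j hj => ?_)).symm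
    rw [← pow_succ']
    exact hpow (by omega)
  have hpart (C : ℂ⟦X⟧) : π (qPoch (-C) (A * B)) =
      π (∏ j ∈ Finset.range (2 * d + 1), (1 + C * (A * B) ^ j)) := by
    rw [hπeq]
    have := X_pow_dvd_qPoch_sub (a := -C) hQ (n := d + 1) (m := 2 * d + 1) fun j hj =>
      Dvd.dvd.mul_left (hpow (by omega)) _
    simpa [sub_eq_add_neg] using this
  -- At level n = 2d + 1 both n + k and n - k exceed d when |k| ≤ d, so all three q-factorials
  -- reduce to the same unit π E and one power of it survives.
  have hgauss (k : ℤ) (hk : k.natAbs ≤ d) :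
      π (centralGauss (A * B) (2 * d + 1) k) * π E = 1 := by
    have h := centralGauss_mul_qFac (A * B) (2 * d + 1) (2 * d + 1 + k).toNat
      (2 * d + 1 - k).toNat k (by omega) (by omega)
    replace h := congrArg π h
    rw [map_mul, map_mul, hfac _ (by omega), hfac _ (by omega), hfac _ (by omega)] at h
    have hu : π E * π E⁻¹ = 1 := by
      rw [← map_mul, PowerSeries.mul_inv_cancel _ (by rw [hE1]; exact one_ne_zero), map_one]
    linear_combination π E⁻¹ * h + (1 - π (centralGauss (A * B) (2 * d + 1) k) * π E) * hu
  have hmain : π (qPoch (-A) (A * B) * qPoch (-B) (A * B) * E) =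
      π (∑ k ∈ Finset.Icc (-(2 * d + 1 : ℕ) : ℤ) (2 * d + 1 : ℕ),
        centralGauss (A * B) (2 * d + 1) k * thetaTerm A B k * E) := by
    rw [map_mul, map_mul, hpart, hpart, ← map_mul, ← Finset.prod_mul_distrib, finite_triple_product,
      ← map_mul, ← Finset.sum_mul]
    congr 2
    refine finsum_eq_sum_of_support_subset _ fun k hk => ?_
    by_contra hk'
    refine hk ?_
    simp only [Finset.coe_Icc, Set.mem_Icc, not_and_or, not_le] at hk'
    simp only
    rw [centralGauss_eq_zero (A * B) _ k (by omega), zero_mul]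
  have hcoeff {f g : ℂ⟦X⟧} (h : π f = π g) : coeff d f = coeff d g := by
    have := X_pow_dvd_iff.mp (hπeq.mp h) d (by omega)
    rwa [map_sub, sub_eq_zero] at this
  rw [hcoeff hmain, map_sum]
  symm
  refine Finset.sum_subset_zero_on_sdiff ?_ ?_ ?_
  · intro k hk
    simp only [Finset.mem_Icc] at hk ⊢
    omega
  · intro k hk
    simp only [Finset.mem_sdiff, Finset.mem_Icc] at hk
    have : X ^ (k.natAbs ^ 2) ∣ thetaTerm A B k := by
      rw [← triangle_add_triangle, pow_add]
      exact mul_dvd_mul (pow_dvd_pow_of_dvd hXA _) (pow_dvd_pow_of_dvd hXB _)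
    refine X_pow_dvd_iff.mp ((this.mul_left _).mul_right _) d ?_
    have : d < k.natAbs := by omega
    nlinarith
  · intro k hk
    rw [Finset.mem_Icc] at hk
    refine hcoeff ?_
    rw [map_mul, map_mul]
    linear_combination (-π (thetaTerm A B k)) * hgauss k (by omega)

/-! ### Splitting and multiplying infinite products -/

/-- Two infinite products agree if they do along a common subsequence of partial products. -/
theorem tendsto_prod_qPoch (a : ℂ⟦X⟧) {q : ℂ⟦X⟧} (hq : constantCoeff q = 0) {m : ℕ} (hm : 0 < m) :
    Tendsto (fun n => ∏ j ∈ Finset.range (m * n), (1 - a * q ^ j)) atTop (nhds (qPoch a q)) :=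
  (hasProd_qPoch a q hq).tendsto_prod_nat.comp (tendsto_id.const_mul_atTop' hm)

theorem qPoch_split_two (a : ℂ⟦X⟧) {q : ℂ⟦X⟧} (hq : constantCoeff q = 0) :
    qPoch a q = qPoch a (q ^ 2) * qPoch (a * q) (q ^ 2) := by
  refine tendsto_nhds_unique (tendsto_prod_qPoch a hq two_pos) ?_
  have h (b : ℂ⟦X⟧) := (hasProd_qPoch b (q ^ 2) (by simp [hq])).tendsto_prod_nat
  refine ((h a).mul (h (a * q))).congr fun n => ?_
  induction n with
  | zero => simp
  | succ n ih =>
    rw [show 2 * (n + 1) = 2 * n + 1 + 1 by ring, Finset.prod_range_succ, Finset.prod_range_succ,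
      Finset.prod_range_succ, Finset.prod_range_succ, ← ih]
    ring

theorem qPoch_split_three (a : ℂ⟦X⟧) {q : ℂ⟦X⟧} (hq : constantCoeff q = 0) :
    qPoch a q = qPoch a (q ^ 3) * qPoch (a * q) (q ^ 3) * qPoch (a * q ^ 2) (q ^ 3) := by
  refine tendsto_nhds_unique (tendsto_prod_qPoch a hq three_pos) ?_
  have h (b : ℂ⟦X⟧) := (hasProd_qPoch b (q ^ 3) (by simp [hq])).tendsto_prod_nat
  refine (((h a).mul (h (a * q))).mul (h (a * q ^ 2))).congr fun n => ?_
  induction n with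
  | zero => simp
  | succ n ih =>
    rw [show 3 * (n + 1) = 3 * n + 1 + 1 + 1 by ring, Finset.prod_range_succ,
      Finset.prod_range_succ, Finset.prod_range_succ, Finset.prod_range_succ,
      Finset.prod_range_succ, Finset.prod_range_succ, ← ih]
    ring

theorem qPoch_mul_neg (a : ℂ⟦X⟧) {q : ℂ⟦X⟧} (hq : constantCoeff q = 0) :
    qPoch a q * qPoch (-a) q = qPoch (a ^ 2) (q ^ 2) := by
  have h (b : ℂ⟦X⟧) := (hasProd_qPoch b q hq).tendsto_prod_nat
  refine tendsto_nhds_unique ((h a).mul (h (-a))) ?_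
  refine (hasProd_qPoch (a ^ 2) (q ^ 2) (by simp [hq])).tendsto_prod_nat.congr fun n => ?_
  rw [← Finset.prod_mul_distrib]
  exact Finset.prod_congr rfl fun j _ => by ring

theorem qPoch_mul_cube_roots (a : ℂ⟦X⟧) {q c : ℂ⟦X⟧} (hq : constantCoeff q = 0)
    (hc : 1 + c + c ^ 2 = 0) :
    qPoch a q * qPoch (c * a) q * qPoch (c ^ 2 * a) q = qPoch (a ^ 3) (q ^ 3) := by
  have h (b : ℂ⟦X⟧) := (hasProd_qPoch b q hq).tendsto_prod_nat
  refine tendsto_nhds_unique (((h a).mul (h (c * a))).mul (h (c ^ 2 * a))) ?_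
  refine (hasProd_qPoch (a ^ 3) (q ^ 3) (by simp [hq])).tendsto_prod_nat.congr fun n => ?_
  rw [← Finset.prod_mul_distrib, ← Finset.prod_mul_distrib]
  refine Finset.prod_congr rfl fun j _ => ?_
  linear_combination (a * q ^ j - c * (a * q ^ j) ^ 2 + (c - 1) * (a * q ^ j) ^ 3) * hc

/-! ### Theta functions -/

/-- The theta function `φ(q) = ∑ q ^ (n ^ 2)`, as a product. -/
def thetaPhi (q : ℂ⟦X⟧) : ℂ⟦X⟧ := qPoch (-q) (q ^ 2) ^ 2 * qPoch (q ^ 2) (q ^ 2)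

theorem constantCoeff_thetaPhi {q : ℂ⟦X⟧} (hq : constantCoeff q = 0) :
    constantCoeff (thetaPhi q) = 1 := by
  simp [thetaPhi, constantCoeff_qPoch, hq]

theorem hasSum_thetaPhi {q : ℂ⟦X⟧} (hq : constantCoeff q = 0) :
    HasSum (fun n : ℤ => q ^ (n.natAbs ^ 2)) (thetaPhi q) := by
  convert hasSum_thetaTerm hq hq using 1
  · ext1 k
    rw [thetaTerm, ← pow_add, triangle_add_triangle]
  · rw [thetaPhi]
    ring_nf

/-- The product (q; q²)(-q; q²) is (q²; q⁴), and (q²; q²) = (q²; q⁴)(q⁴; q⁴); both sides are then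
(q²; q⁴)⁴ (q⁴; q⁴)². -/
theorem thetaPhi_mul_thetaPhi_neg {q : ℂ⟦X⟧} (hq : constantCoeff q = 0) :
    thetaPhi q * thetaPhi (-q) = thetaPhi (-q ^ 2) ^ 2 := by
  have h2 : constantCoeff (q ^ 2) = 0 := by simp [hq]
  have h1 := qPoch_mul_neg q h2
  have h3 := qPoch_split_two (q ^ 2) h2
  have e : q ^ 2 * q ^ 2 = (q ^ 2) ^ 2 := by ring
  simp only [thetaPhi, neg_neg, neg_sq]
  rw [e] at h3
  rw [← h1] at h3 ⊢
  calc _ = (qPoch q (q ^ 2) * qPoch (-q) (q ^ 2)) ^ 2 * qPoch (q ^ 2) (q ^ 2) ^ 2 := by ring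
    _ = _ := by rw [h3]; ring

/-! ### The numerators of X and Y, and the basic parametrization -/

/-- The numerator of `slaterX`. -/
def thetaOne (q : ℂ⟦X⟧) : ℂ⟦X⟧ :=
  qPoch q (q ^ 12) * qPoch (q ^ 11) (q ^ 12) * qPoch (q ^ 12) (q ^ 12)

/-- The numerator of `slaterY`. -/
def thetaFive (q : ℂ⟦X⟧) : ℂ⟦X⟧ :=
  qPoch (q ^ 5) (q ^ 12) * qPoch (q ^ 7) (q ^ 12) * qPoch (q ^ 12) (q ^ 12)

theorem constantCoeff_thetaOne {q : ℂ⟦X⟧} (hq : constantCoeff q = 0) :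
    constantCoeff (thetaOne q) = 1 := by
  simp [thetaOne, constantCoeff_qPoch, hq]

theorem constantCoeff_thetaFive {q : ℂ⟦X⟧} (hq : constantCoeff q = 0) :
    constantCoeff (thetaFive q) = 1 := by
  simp [thetaFive, constantCoeff_qPoch, hq]

theorem hasSum_thetaOne {q : ℂ⟦X⟧} (hq : constantCoeff q = 0) :
    HasSum (thetaTerm (-q ^ 11) (-q)) (thetaOne q) := by
  convert hasSum_thetaTerm (A := -q ^ 11) (B := -q) (by simp [hq]) (by simp [hq]) using 1
  rw [thetaOne, neg_neg, neg_neg, show -q ^ 11 * -q = q ^ 12 by ring]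
  ring

theorem hasSum_thetaFive {q : ℂ⟦X⟧} (hq : constantCoeff q = 0) :
    HasSum (thetaTerm (-q ^ 5) (-q ^ 7)) (thetaFive q) := by
  convert hasSum_thetaTerm (A := -q ^ 5) (B := -q ^ 7) (by simp [hq]) (by simp [hq]) using 1
  rw [thetaFive, neg_neg, neg_neg, show -q ^ 5 * -q ^ 7 = q ^ 12 by ring]

theorem hasSum_int_even_add_odd {M : Type*} [AddCommMonoid M] [TopologicalSpace M]
    [ContinuousAdd M] {f : ℤ → M} {a b : M} (ha : HasSum (fun k => f (2 * k)) a)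
    (hb : HasSum (fun k => f (2 * k + 1)) b) : HasSum f (a + b) := by
  have h2 : Function.Injective fun k : ℤ => 2 * k := mul_right_injective₀ two_ne_zero
  have h21 : Function.Injective fun k : ℤ => 2 * k + 1 := (add_left_injective 1).comp h2
  have ha' := h2.hasSum_range_iff.mpr ha
  have hb' := h21.hasSum_range_iff.mpr hb
  have e2 : (Set.range fun k : ℤ => 2 * k) = {n | Even n} :=
    Set.ext fun n => ⟨fun ⟨k, hk⟩ => ⟨k, by rw [← hk]; ring⟩, fun ⟨k, hk⟩ => ⟨k, by rw [hk]; ring⟩⟩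
  have e21 : (Set.range fun k : ℤ => 2 * k + 1) = {n | Odd n} :=
    Set.ext fun n => ⟨fun ⟨k, hk⟩ => ⟨k, hk.symm⟩, fun ⟨k, hk⟩ => ⟨k, hk.symm⟩⟩
  refine ha'.add_isCompl ?_ hb'
  rw [e2, e21]
  exact Int.isCompl_even_odd

theorem triangle_two_mul (j : ℤ) : triangle (2 * j) = triangle (j + 1) + 3 * triangle j := by
  have h1 := two_mul_triangle j
  have h2 := two_mul_triangle (j + 1)
  have h3 := two_mul_triangle (2 * j)
  zify
  linarith

theorem triangle_two_mul_add_one (j : ℤ) :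
    triangle (2 * j + 1) = 3 * triangle (j + 1) + triangle j := by
  have h1 := two_mul_triangle j
  have h2 := two_mul_triangle (j + 1)
  have h3 := two_mul_triangle (2 * j + 1)
  zify
  linarith

theorem triangle_two_mul_add_two (j : ℤ) :
    triangle (2 * j + 1 + 1) + triangle j = 5 * triangle (j + 1) + 1 := by
  have h1 := two_mul_triangle j
  have h2 := two_mul_triangle (j + 1)
  have h3 := two_mul_triangle (2 * j + 1 + 1)
  zify
  linarith

theorem neg_one_pow_three_mul {R : Type*} [CommRing R] (n : ℕ) :
    (-1 : R) ^ (3 * n) = (-1) ^ n := by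
  rw [pow_mul]
  norm_num

/-- Bisect the theta series with A = q, B = -q²: even indices sum to `thetaFive q`, odd ones to `q *
thetaOne q`. Taking A = -q, B = q² only changes the sign of the odd part, which gives the
difference. -/
theorem thetaFive_add {q : ℂ⟦X⟧} (hq : constantCoeff q = 0) :
    thetaFive q + q * thetaOne q =
      qPoch (-q) (-q ^ 3) * qPoch (q ^ 2) (-q ^ 3) * qPoch (-q ^ 3) (-q ^ 3) := by
  have h := hasSum_thetaTerm (A := q) (B := -q ^ 2) hq (by simp [hq])
  rw [neg_neg, show q * -q ^ 2 = -q ^ 3 by ring] at h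
  have e0 (j : ℤ) : thetaTerm q (-q ^ 2) (2 * j) = thetaTerm (-q ^ 5) (-q ^ 7) j := by
    simp only [thetaTerm, triangle_two_mul, triangle_two_mul_add_one]
    generalize triangle (j + 1) = S
    generalize triangle j = T
    rw [neg_pow, neg_pow (q ^ 5), neg_pow (q ^ 7), pow_add (-1 : ℂ⟦X⟧), neg_one_pow_three_mul]
    ring
  have e1 (j : ℤ) : thetaTerm q (-q ^ 2) (2 * j + 1) = q * thetaTerm (-q ^ 11) (-q) j := by
    have h3 := triangle_two_mul_add_two j
    simp only [thetaTerm, triangle_two_mul_add_one]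
    generalize triangle (j + 1) = S at *
    generalize triangle j = T at *
    generalize triangle (2 * j + 1 + 1) = U at *
    rw [neg_pow (q ^ 2), neg_pow (q ^ 11), neg_pow q T, pow_add (-1 : ℂ⟦X⟧), neg_one_pow_three_mul]
    have e : q ^ U * q ^ T = q ^ (5 * S + 1) := by rw [← pow_add, h3]
    linear_combination (-1) ^ S * (-1) ^ T * q ^ (6 * S + T) * e
  refine (hasSum_int_even_add_odd (f := thetaTerm q (-q ^ 2)) ?_ ?_).unique h
  · simp only [e0]
    exact hasSum_thetaFive hq
  · simp only [e1]
    exact (hasSum_thetaOne hq).mul_left q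

theorem thetaFive_sub {q : ℂ⟦X⟧} (hq : constantCoeff q = 0) :
    thetaFive q - q * thetaOne q =
      qPoch q (-q ^ 3) * qPoch (-q ^ 2) (-q ^ 3) * qPoch (-q ^ 3) (-q ^ 3) := by
  have h := hasSum_thetaTerm (A := -q) (B := q ^ 2) (by simp [hq]) (by simp [hq])
  rw [neg_neg, show -q * q ^ 2 = -q ^ 3 by ring] at h
  rw [sub_eq_add_neg]
  have e0 (j : ℤ) : thetaTerm (-q) (q ^ 2) (2 * j) = thetaTerm (-q ^ 5) (-q ^ 7) j := by
    simp only [thetaTerm, triangle_two_mul, triangle_two_mul_add_one]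
    generalize triangle (j + 1) = S
    generalize triangle j = T
    rw [neg_pow, neg_pow (q ^ 5), neg_pow (q ^ 7), pow_add (-1 : ℂ⟦X⟧), neg_one_pow_three_mul]
    ring
  have e1 (j : ℤ) : thetaTerm (-q) (q ^ 2) (2 * j + 1) = -(q * thetaTerm (-q ^ 11) (-q) j) := by
    have h3 := triangle_two_mul_add_two j
    simp only [thetaTerm, triangle_two_mul_add_one]
    generalize triangle (j + 1) = S at *
    generalize triangle j = T at *
    generalize triangle (2 * j + 1 + 1) = U at *
    have e : (-q) ^ U * (-q) ^ T = (-q) ^ (5 * S + 1) := by rw [← pow_add, h3]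
    have e5 : (-1 : ℂ⟦X⟧) ^ (5 * S) = (-1) ^ S := by rw [pow_mul]; norm_num
    have e2 : (-1 : ℂ⟦X⟧) ^ (T * 2) = 1 := by rw [mul_comm, pow_mul]; norm_num
    rw [pow_succ, neg_pow q U, neg_pow q T, neg_pow q (5 * S), e5] at e
    rw [neg_pow (q ^ 11), neg_pow q T, neg_pow q U]
    linear_combination (-1) ^ T * q ^ (6 * S + T) * e +
      (-(-1) ^ U * q ^ (U + 6 * S + 2 * T)) * e2
  refine (hasSum_int_even_add_odd (f := thetaTerm (-q) (q ^ 2)) ?_ ?_).unique h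
  · simp only [e0]
    exact hasSum_thetaFive hq
  · simp only [e1]
    exact ((hasSum_thetaOne hq).mul_left q).neg

/-- The basic parametrization `q X(q) / Y(q) = (φ(q) - φ(q³)) / (φ(q) + φ(q³))`. -/
theorem thetaOne_mul_thetaPhi_add {q : ℂ⟦X⟧} (hq : constantCoeff q = 0) :
    q * thetaOne q * (thetaPhi q + thetaPhi (q ^ 3)) =
      thetaFive q * (thetaPhi q - thetaPhi (q ^ 3)) := by
  -- In this arrangement both sides are pure infinite products, by the two bisection lemmas, and can
  -- be compared after splitting to base q⁶.
  suffices h : (thetaFive q + q * thetaOne q) * thetaPhi (q ^ 3) =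
      (thetaFive q - q * thetaOne q) * thetaPhi q by linear_combination h
  have hn {n : ℕ} (h : n ≠ 0) : constantCoeff (q ^ n) = 0 := by simp [hq, h]
  have h3 : constantCoeff (-q ^ 3) = 0 := by simp [hq]
  have s (a : ℂ⟦X⟧) := qPoch_split_two a h3
  have t (a : ℂ⟦X⟧) := qPoch_split_three a (hn two_ne_zero)
  have e6 : (-q ^ 3) ^ 2 = q ^ 6 := by ring
  have e6' : (q ^ 2) ^ 3 = q ^ 6 := by ring
  have e6'' : (q ^ 3) ^ 2 = q ^ 6 := by ring
  simp only [e6] at s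
  simp only [e6'] at t
  rw [thetaFive_add hq, thetaFive_sub hq, s (-q), s (q ^ 2), s q, s (-q ^ 2)]
  simp only [thetaPhi, e6'']
  rw [t (-q), t (q ^ 2),
    show -q * -q ^ 3 = q ^ 4 by ring, show q ^ 2 * -q ^ 3 = -q ^ 5 by ring,
    show q * -q ^ 3 = -q ^ 4 by ring, show -q ^ 2 * -q ^ 3 = q ^ 5 by ring,
    show -q * q ^ 2 = -q ^ 3 by ring, show -q * (q ^ 2) ^ 2 = -q ^ 5 by ring,
    show q ^ 2 * q ^ 2 = q ^ 4 by ring, show q ^ 2 * (q ^ 2) ^ 2 = q ^ 6 by ring]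
  have e12 : (q ^ 6) ^ 2 = q ^ 12 := by ring
  have m (a : ℂ⟦X⟧) := qPoch_mul_neg a (hn (n := 6) (by norm_num))
  have d (a : ℂ⟦X⟧) := qPoch_split_two a (hn (n := 6) (by norm_num))
  simp only [e12] at m d
  have m1 := m q
  have m5 := m (q ^ 5)
  have m2 := m (q ^ 2)
  have m4 := m (q ^ 4)
  have d2 := d (q ^ 2)
  have d4 := d (q ^ 4)
  rw [show (q ^ 5) ^ 2 = q ^ 10 by ring] at m5
  rw [show (q ^ 2) ^ 2 = q ^ 4 by ring] at m2
  rw [show (q ^ 4) ^ 2 = q ^ 8 by ring] at m4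
  rw [show q ^ 2 * q ^ 6 = q ^ 8 by ring] at d2
  rw [show q ^ 4 * q ^ 6 = q ^ 10 by ring] at d4
  have hne {n : ℕ} (h : n ≠ 0) : qPoch (q ^ n) (q ^ 6) ≠ 0 := qPoch_ne_zero (hn h) (hn (by norm_num))
  -- The two sides differ by this product alone. It is (q², q¹⁰; q¹²)(-q², -q⁴; q⁶), which becomes
  -- (q², q⁴; q⁶) when multiplied by (q², q⁴; q⁶).
  have key : qPoch q (q ^ 6) * qPoch (-q) (q ^ 6) * (qPoch (q ^ 5) (q ^ 6) * qPoch (-q ^ 5) (q ^ 6)) *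
      (qPoch (-q ^ 2) (q ^ 6) * qPoch (-q ^ 4) (q ^ 6)) = 1 := by
    refine mul_right_cancel₀ (mul_ne_zero (hne two_ne_zero) (hne four_ne_zero)) ?_
    calc _ = qPoch q (q ^ 6) * qPoch (-q) (q ^ 6) * (qPoch (q ^ 5) (q ^ 6) * qPoch (-q ^ 5) (q ^ 6)) *
        ((qPoch (q ^ 2) (q ^ 6) * qPoch (-q ^ 2) (q ^ 6)) *
          (qPoch (q ^ 4) (q ^ 6) * qPoch (-q ^ 4) (q ^ 6))) := by ring
      _ = _ := by rw [m1, m5, m2, m4, d2, d4]; ring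
  linear_combination (-qPoch (-q) (q ^ 6) * qPoch (q ^ 4) (q ^ 6) * qPoch (q ^ 2) (q ^ 6) *
    qPoch (-q ^ 5) (q ^ 6) * qPoch (-q ^ 3) (-q ^ 3) * qPoch (-q ^ 3) (q ^ 6) ^ 2 *
    qPoch (q ^ 6) (q ^ 6)) * key

/-- `-h(q²) = h(q) h(-q)` for `h(q) = q X(q) / Y(q)`, with denominators cleared. -/
theorem thetaOne_mul_neg {q : ℂ⟦X⟧} (hq : constantCoeff q = 0) :
    thetaOne q * thetaOne (-q) * thetaFive (q ^ 2) =
      thetaFive q * thetaFive (-q) * thetaOne (q ^ 2) := by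
  have h12 : constantCoeff (q ^ 12) = 0 := by simp [hq]
  have m (a : ℂ⟦X⟧) := qPoch_mul_neg a h12
  have e (n : ℕ) : (q ^ 2) ^ n = (q ^ n) ^ 2 := by ring
  simp only [thetaOne, thetaFive, e, ← m, Even.neg_pow (show Even 12 by decide),
    Odd.neg_pow (show Odd 11 by decide), Odd.neg_pow (show Odd 5 by decide),
    Odd.neg_pow (show Odd 7 by decide)]
  ring

/-- `h(q³) = h(q) h(c q) h(c² q)` for `h(q) = q X(q) / Y(q)` and `c` a primitive cube root of
unity, with denominators cleared. -/
theorem thetaOne_mul_cube_roots {q c : ℂ⟦X⟧} (hq : constantCoeff q = 0) (hc : 1 + c + c ^ 2 = 0) :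
    thetaOne q * thetaOne (c * q) * thetaOne (c ^ 2 * q) * thetaFive (q ^ 3) =
      thetaFive q * thetaFive (c * q) * thetaFive (c ^ 2 * q) * thetaOne (q ^ 3) := by
  have h12 : constantCoeff (q ^ 12) = 0 := by simp [hq]
  have hc3 : c ^ 3 = 1 := by linear_combination (c - 1) * hc
  have m (a : ℂ⟦X⟧) := qPoch_mul_cube_roots a h12 hc
  have e (n : ℕ) : (q ^ 3) ^ n = (q ^ n) ^ 3 := by ring
  have c12 : (c * q) ^ 12 = q ^ 12 := by linear_combination (c ^ 9 + c ^ 6 + c ^ 3 + 1) * q ^ 12 * hc3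
  have d12 : (c ^ 2 * q) ^ 12 = q ^ 12 := by
    rw [mul_pow, ← pow_mul, show c ^ (2 * 12) = (c ^ 3) ^ 8 by ring, hc3]; ring
  have c11 : (c * q) ^ 11 = c ^ 2 * q ^ 11 := by
    rw [mul_pow, show c ^ 11 = (c ^ 3) ^ 3 * c ^ 2 by ring, hc3]; ring
  have d11 : (c ^ 2 * q) ^ 11 = c * q ^ 11 := by
    rw [mul_pow, ← pow_mul, show c ^ (2 * 11) = (c ^ 3) ^ 7 * c by ring, hc3]; ring
  have c5 : (c * q) ^ 5 = c ^ 2 * q ^ 5 := by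
    rw [mul_pow, show c ^ 5 = c ^ 3 * c ^ 2 by ring, hc3]; ring
  have d5 : (c ^ 2 * q) ^ 5 = c * q ^ 5 := by
    rw [mul_pow, ← pow_mul, show c ^ (2 * 5) = (c ^ 3) ^ 3 * c by ring, hc3]; ring
  have c7 : (c * q) ^ 7 = c * q ^ 7 := by
    rw [mul_pow, show c ^ 7 = (c ^ 3) ^ 2 * c by ring, hc3]; ring
  have d7 : (c ^ 2 * q) ^ 7 = c ^ 2 * q ^ 7 := by
    rw [mul_pow, ← pow_mul, show c ^ (2 * 7) = (c ^ 3) ^ 4 * c ^ 2 by ring, hc3]; ring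
  simp only [thetaOne, thetaFive, e, ← m, c12, d12, c11, d11, c5, d5, c7, d7]
  ring

/-! ### Substitutions in Laurent series -/

/-- The substitution `q ↦ c q` on Laurent series. -/
def twist (c : ℂˣ) : LaurentSeries ℂ →+* LaurentSeries ℂ where
  toFun f := ⟨fun n => (c ^ n : ℂˣ) * f.coeff n,
    f.isPWO_support.mono fun n hn hn' => hn (by simp [hn'])⟩
  map_one' := by
    ext n
    by_cases hn : n = 0 <;> simp [HahnSeries.coeff_one, hn]
  map_zero' := by
    ext n
    simp
  map_add' f g := by
    ext n
    simp [mul_add]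
  map_mul' f g := by
    ext n
    simp only [HahnSeries.coeff_mul, Finset.mul_sum]
    have hs (f : LaurentSeries ℂ) (n : ℤ) : (c ^ n : ℂˣ) * f.coeff n ≠ 0 ↔ f.coeff n ≠ 0 :=
      mul_ne_zero_iff_left (c ^ n).ne_zero
    refine Finset.sum_congr ?_ ?_
    · ext ij
      simp only [Finset.mem_antidiagonal, HahnSeries.mem_support, hs]
    · intro ij hij
      rw [← (Finset.mem_antidiagonal.mp hij).2.2, zpow_add]
      push_cast
      ring

@[simp]
theorem coeff_twist (c : ℂˣ) (f : LaurentSeries ℂ) (n : ℤ) :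
    (twist c f).coeff n = (c ^ n : ℂˣ) * f.coeff n := rfl

theorem twist_one (f : LaurentSeries ℂ) : twist 1 f = f := by
  ext n
  simp

theorem twist_twist (c d : ℂˣ) (f : LaurentSeries ℂ) : twist c (twist d f) = twist (c * d) f := by
  ext n
  simp [mul_zpow, mul_assoc]

/-- The substitution `q ↦ q ^ k` on Laurent series. -/
def expand (k : ℕ) [NeZero k] : LaurentSeries ℂ →+* LaurentSeries ℂ :=
  HahnSeries.embDomainRingHom (AddMonoidHom.mulLeft (k : ℤ))
    (mul_right_injective₀ (by exact_mod_cast NeZero.ne k))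
    fun _ _ => mul_le_mul_iff_right₀ (by exact_mod_cast Nat.pos_of_ne_zero (NeZero.ne k))

theorem coeff_expand_mul (k : ℕ) [NeZero k] (f : LaurentSeries ℂ) (n : ℤ) :
    (expand k f).coeff (k * n) = f.coeff n :=
  HahnSeries.embDomain_mk_coeff (f := fun n : ℤ => (k : ℤ) * n) _ _

theorem coeff_expand_of_not_dvd (k : ℕ) [NeZero k] (f : LaurentSeries ℂ) {n : ℤ}
    (h : ¬ (k : ℤ) ∣ n) : (expand k f).coeff n = 0 :=
  HahnSeries.embDomain_of_notMem_range fun ⟨m, hm⟩ => h ⟨m, hm.symm⟩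

theorem coeff_expand (k : ℕ) [NeZero k] (f : LaurentSeries ℂ) (n : ℤ) :
    (expand k f).coeff n = if (k : ℤ) ∣ n then f.coeff (n / k) else 0 := by
  split_ifs with h
  · obtain ⟨m, rfl⟩ := h
    rw [coeff_expand_mul, Int.mul_ediv_cancel_left _ (by exact_mod_cast NeZero.ne k)]
  · exact coeff_expand_of_not_dvd k f h

theorem twist_expand (c : ℂˣ) (k : ℕ) [NeZero k] (f : LaurentSeries ℂ) :
    twist c (expand k f) = expand k (twist (c ^ k) f) := by
  ext n
  by_cases h : (k : ℤ) ∣ n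
  · obtain ⟨m, rfl⟩ := h
    rw [coeff_twist, coeff_expand_mul, coeff_expand_mul, coeff_twist, zpow_mul, zpow_natCast]
  · rw [coeff_twist, coeff_expand_of_not_dvd k _ h, coeff_expand_of_not_dvd k _ h, mul_zero]

theorem expand_expand (k l m : ℕ) [NeZero k] [NeZero l] [NeZero m] (h : m = k * l)
    (f : LaurentSeries ℂ) : expand k (expand l f) = expand m f := by
  subst h
  have hk : (k : ℤ) ≠ 0 := by exact_mod_cast NeZero.ne k
  ext n
  by_cases h : (k : ℤ) ∣ n
  · obtain ⟨n, rfl⟩ := h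
    rw [coeff_expand_mul]
    by_cases h : (l : ℤ) ∣ n
    · obtain ⟨n, rfl⟩ := h
      rw [coeff_expand_mul, ← mul_assoc, ← Nat.cast_mul, coeff_expand_mul]
    · rw [coeff_expand_of_not_dvd l _ h, coeff_expand_of_not_dvd]
      rwa [Nat.cast_mul, Int.mul_dvd_mul_iff_left hk]
  · rw [coeff_expand_of_not_dvd k _ h, coeff_expand_of_not_dvd]
    exact fun h' => h ((Dvd.intro _ (Nat.cast_mul k l).symm).trans h')

theorem expand_comm (k l : ℕ) [NeZero k] [NeZero l] (f : LaurentSeries ℂ) :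
    expand k (expand l f) = expand l (expand k f) := by
  rw [expand_expand k l _ rfl, expand_expand l k _ (mul_comm k l)]

/-! ### Laurent series without pole -/

/-- `f` has no pole, and its constant term is `c`. -/
def HasValue (f : LaurentSeries ℂ) (c : ℂ) : Prop :=
  (∀ n < 0, f.coeff n = 0) ∧ f.coeff 0 = c

theorem hasValue_coe (g : ℂ⟦X⟧) : HasValue g (constantCoeff g) := by
  refine ⟨fun n hn => ?_, ?_⟩
  · rw [PowerSeries.coeff_coe, if_pos hn]
  · rw [PowerSeries.coeff_coe]
    simp

theorem HasValue.exists_coe {f : LaurentSeries ℂ} {c : ℂ} (h : HasValue f c) :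
    ∃ g : ℂ⟦X⟧, f = g ∧ constantCoeff g = c := by
  refine ⟨PowerSeries.mk fun n => f.coeff n, ?_, by simpa using h.2⟩
  ext n
  rw [PowerSeries.coeff_coe]
  split_ifs with hn
  · exact h.1 n hn
  · simp [abs_of_nonneg (not_lt.mp hn)]

theorem HasValue.add {f g : LaurentSeries ℂ} {c d : ℂ} (hf : HasValue f c) (hg : HasValue g d) :
    HasValue (f + g) (c + d) :=
  ⟨fun n hn => by simp [hf.1 n hn, hg.1 n hn], by simp [hf.2, hg.2]⟩

theorem HasValue.sub {f g : LaurentSeries ℂ} {c d : ℂ} (hf : HasValue f c) (hg : HasValue g d) :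
    HasValue (f - g) (c - d) :=
  ⟨fun n hn => by simp [hf.1 n hn, hg.1 n hn], by simp [hf.2, hg.2]⟩

theorem HasValue.mul {f g : LaurentSeries ℂ} {c d : ℂ} (hf : HasValue f c) (hg : HasValue g d) :
    HasValue (f * g) (c * d) := by
  obtain ⟨f, rfl, rfl⟩ := hf.exists_coe
  obtain ⟨g, rfl, rfl⟩ := hg.exists_coe
  rw [← map_mul, ← map_mul]
  exact hasValue_coe _

theorem hasValue_one : HasValue 1 1 := by
  simpa using hasValue_coe 1

theorem HasValue.pow {f : LaurentSeries ℂ} {c : ℂ} (hf : HasValue f c) (n : ℕ) :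
    HasValue (f ^ n) (c ^ n) := by
  induction n with
  | zero => simpa using hasValue_one
  | succ n ih =>
    rw [pow_succ, pow_succ]
    exact ih.mul hf

theorem hasValue_ofNat (n : ℕ) [n.AtLeastTwo] :
    HasValue (OfNat.ofNat n : LaurentSeries ℂ) (OfNat.ofNat n : ℂ) := by
  have := hasValue_coe (OfNat.ofNat n : ℂ⟦X⟧)
  rwa [map_ofNat, map_ofNat] at this

theorem HasValue.ne_zero {f : LaurentSeries ℂ} {c : ℂ} (hf : HasValue f c) (hc : c ≠ 0) :
    f ≠ 0 := by
  rintro rfl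
  exact hc (by simpa using hf.2.symm)

theorem HasValue.inv {f : LaurentSeries ℂ} {c : ℂ} (hf : HasValue f c) (hc : c ≠ 0) :
    HasValue f⁻¹ c⁻¹ := by
  obtain ⟨f, rfl, rfl⟩ := hf.exists_coe
  have : (f : LaurentSeries ℂ)⁻¹ = (f⁻¹ : ℂ⟦X⟧) := by
    refine inv_eq_of_mul_eq_one_right ?_
    rw [← map_mul, PowerSeries.mul_inv_cancel _ hc, map_one]
  rw [this, ← PowerSeries.constantCoeff_inv]
  exact hasValue_coe _

theorem HasValue.twist {f : LaurentSeries ℂ} {c : ℂ} (hf : HasValue f c) (d : ℂˣ) :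
    HasValue (twist d f) c :=
  ⟨fun n hn => by simp [hf.1 n hn], by simp [hf.2]⟩

theorem HasValue.expand {f : LaurentSeries ℂ} {c : ℂ} (hf : HasValue f c) (k : ℕ) [NeZero k] :
    HasValue (expand k f) c := by
  have hk : (0 : ℤ) < k := by exact_mod_cast Nat.pos_of_ne_zero (NeZero.ne k)
  refine ⟨fun n hn => ?_, by simpa [hf.2] using coeff_expand_mul k f 0⟩
  rw [coeff_expand]
  split_ifs
  · exact hf.1 _ (Int.ediv_neg_of_neg_of_pos hn hk)
  · rfl

/-- A Laurent series without pole and constant term which is a unit multiple of its own image under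
`q ↦ q²` vanishes. -/
theorem eq_zero_of_eq_mul_expand {f u : LaurentSeries ℂ} {c : ℂ} (hf : HasValue f 0)
    (hu : HasValue u c) (hc : c ≠ 0) (h : f = u * expand 2 f) : f = 0 := by
  by_contra hf0
  have hpos : 0 < f.order := by
    by_contra! hle
    refine HahnSeries.coeff_order_eq_zero.not.mpr hf0 ?_
    rcases hle.lt_or_eq with h | h
    · exact hf.1 _ h
    · rw [h, hf.2]
  have hu0 : u.order = 0 := by
    refine le_antisymm (HahnSeries.order_le_of_coeff_ne_zero (by rwa [hu.2])) ?_
    by_contra! hlt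
    exact HahnSeries.coeff_order_eq_zero.not.mpr (hu.ne_zero hc) (hu.1 _ hlt)
  have he : expand 2 f ≠ 0 := by simpa using hf0
  have ho := congrArg HahnSeries.order h
  rw [HahnSeries.order_mul (hu.ne_zero hc) he, hu0, zero_add] at ho
  -- Both orders agree, say n > 0; but the coefficient of f(q²) at n is 0 or the coefficient of f at
  -- n/2 < n, which vanishes as well.
  refine HahnSeries.coeff_order_eq_zero.not.mpr he ?_
  rw [← ho, coeff_expand]
  split_ifs
  · exact HahnSeries.coeff_eq_zero_of_lt_order (by omega)
  · rfl

/-! ### The theta quotient `φ(q) / φ(q³)` -/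

/-- The theta function `φ(q)` as a Laurent series. -/
def phi : LaurentSeries ℂ := (thetaPhi X : ℂ⟦X⟧)

theorem hasSum_coeff_thetaPhi (n : ℕ) :
    HasSum (fun j : ℤ => if n = j.natAbs ^ 2 then (1 : ℂ) else 0) (coeff n (thetaPhi X)) := by
  have := (WithPiTopology.hasSum_iff_hasSum_coeff ℂ).mp (hasSum_thetaPhi constantCoeff_X) n
  simpa [coeff_X_pow] using this

theorem coeff_thetaPhi_C_mul_X_pow (c : ℂ) (k : ℕ) [NeZero k] (n : ℕ) :
    coeff n (thetaPhi (C c * X ^ k)) =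
      if k ∣ n then c ^ (n / k) * coeff (n / k) (thetaPhi X) else 0 := by
  have hk := NeZero.ne k
  have h := (WithPiTopology.hasSum_iff_hasSum_coeff ℂ).mp
    (hasSum_thetaPhi (q := C c * X ^ k) (by simp [hk])) n
  have e (j : ℤ) : coeff n ((C c * X ^ k) ^ (j.natAbs ^ 2)) =
      if n = k * j.natAbs ^ 2 then c ^ (j.natAbs ^ 2) else 0 := by
    rw [mul_pow, ← pow_mul, ← map_pow, coeff_C_mul, coeff_X_pow]
    split_ifs <;> simp
  simp only [e] at h
  split_ifs with hd
  · obtain ⟨m, rfl⟩ := hd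
    rw [Nat.mul_div_cancel_left _ (Nat.pos_of_ne_zero hk)]
    refine h.unique ?_
    have e' (j : ℤ) : (if k * m = k * j.natAbs ^ 2 then c ^ (j.natAbs ^ 2) else 0) =
        c ^ m * if m = j.natAbs ^ 2 then (1 : ℂ) else 0 := by
      simp only [mul_eq_mul_left_iff, hk, or_false, mul_ite, mul_one, mul_zero]
      split_ifs with h1
      · rw [h1]
      · rfl
    simp only [e']
    exact (hasSum_coeff_thetaPhi m).mul_left (c ^ m)
  · refine h.unique ?_
    convert hasSum_zero using 2 with j
    rw [if_neg]
    rintro rfl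
    exact hd (dvd_mul_right _ _)

/-- Bridge between substitution inside products and the operators `twist` and `expand`. It is
checked on coefficients of φ, and passes to h through the parametrization by φ. -/
theorem coe_thetaPhi (c : ℂˣ) (k : ℕ) [NeZero k] :
    ((thetaPhi (C (c : ℂ) * X ^ k) : ℂ⟦X⟧) : LaurentSeries ℂ) = expand k (twist c phi) := by
  ext n
  rcases lt_or_ge n 0 with hn | hn
  · rw [phi, (((hasValue_coe _).twist c).expand k).1 n hn, (hasValue_coe _).1 n hn]
  · lift n to ℕ using hn
    rw [coeff_expand, LaurentSeries.coeff_coe_powerSeries, coeff_thetaPhi_C_mul_X_pow]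
    simp only [Int.natCast_dvd_natCast]
    split_ifs
    · rw [coeff_twist, phi, ← Int.natCast_div, LaurentSeries.coeff_coe_powerSeries, zpow_natCast,
        Units.val_pow_eq_pow_val]
    · rfl

/-- The quotient `φ(q) / φ(q³)`. -/
def thetaRatio : LaurentSeries ℂ := phi / expand 3 phi

theorem hasValue_phi : HasValue phi 1 := by
  have := hasValue_coe (thetaPhi X)
  rwa [constantCoeff_thetaPhi constantCoeff_X] at this

theorem expand_phi_ne_zero (k : ℕ) [NeZero k] : expand k phi ≠ 0 :=
  (hasValue_phi.expand k).ne_zero one_ne_zero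

theorem hasValue_thetaRatio : HasValue thetaRatio 1 := by
  simpa [thetaRatio, div_eq_mul_inv] using
    hasValue_phi.mul ((hasValue_phi.expand 3).inv one_ne_zero)

/-- The function `h(q) = q X(q) / Y(q)`, in terms of `φ(q) / φ(q³)`. -/
def slaterRatio : LaurentSeries ℂ := (thetaRatio - 1) / (thetaRatio + 1)

theorem coe_thetaFive_ne_zero {q : ℂ⟦X⟧} (hq : constantCoeff q = 0) :
    (thetaFive q : LaurentSeries ℂ) ≠ 0 :=
  (hasValue_coe _).ne_zero (by simp [constantCoeff_thetaFive hq])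

theorem coe_thetaOne_ne_zero {q : ℂ⟦X⟧} (hq : constantCoeff q = 0) :
    (thetaOne q : LaurentSeries ℂ) ≠ 0 :=
  (hasValue_coe _).ne_zero (by simp [constantCoeff_thetaOne hq])

theorem thetaRatio_add_one_ne_zero : thetaRatio + 1 ≠ 0 :=
  (hasValue_thetaRatio.add hasValue_one).ne_zero (by norm_num)

/-- `h(c q ^ k)` is the quotient of the corresponding theta series. -/
theorem expand_twist_slaterRatio (c : ℂˣ) (k : ℕ) [NeZero k] {q : ℂ⟦X⟧}
    (hq : q = C (c : ℂ) * X ^ k) :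
    expand k (twist c slaterRatio) = (q : LaurentSeries ℂ) * thetaOne q / thetaFive q := by
  have hq0 : constantCoeff q = 0 := by simp [hq, NeZero.ne k]
  have h := congrArg (fun f : ℂ⟦X⟧ => (f : LaurentSeries ℂ)) (thetaOne_mul_thetaPhi_add hq0)
  have h1 : (thetaPhi q : LaurentSeries ℂ) = expand k (twist c phi) := by
    rw [hq, coe_thetaPhi]
  have h3 : (thetaPhi (q ^ 3) : LaurentSeries ℂ) = expand k (twist c (expand 3 phi)) := by
    have : q ^ 3 = C ((c ^ 3 : ℂˣ) : ℂ) * X ^ (k * 3) := by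
      rw [hq, mul_pow, ← pow_mul, ← map_pow, Units.val_pow_eq_pow_val]
    rw [this, coe_thetaPhi, twist_expand, expand_expand k 3 _ rfl]
  simp only [map_mul, map_add, map_sub, h1, h3] at h
  have hne : expand k (twist c thetaRatio) + 1 ≠ 0 :=
    (((hasValue_thetaRatio.twist c).expand k).add hasValue_one).ne_zero (by norm_num)
  have hne3 : expand k (twist c (expand 3 phi)) ≠ 0 := by
    simpa using expand_phi_ne_zero 3
  rw [slaterRatio, map_div₀, map_div₀, map_sub, map_sub, map_add, map_add, map_one, map_one,
    div_eq_div_iff hne (coe_thetaFive_ne_zero hq0)]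
  have hr : expand k (twist c thetaRatio) * expand k (twist c (expand 3 phi)) =
      expand k (twist c phi) := by
    rw [← map_mul, ← map_mul, thetaRatio, div_mul_cancel₀ _ (expand_phi_ne_zero 3)]
  refine mul_right_cancel₀ hne3 ?_
  rw [← hr] at h
  linear_combination -h

theorem slaterRatio_eq : slaterRatio = (X : ℂ⟦X⟧) * (thetaOne X : LaurentSeries ℂ) / thetaFive X := by
  have := expand_twist_slaterRatio 1 1 (q := X) (by simp)
  rw [← this, twist_one]
  ext n
  simpa using (coeff_expand_mul 1 slaterRatio n).symm

theorem slaterRatio_ne_zero : slaterRatio ≠ 0 := by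
  rw [slaterRatio_eq]
  refine div_ne_zero (mul_ne_zero ?_ (coe_thetaOne_ne_zero constantCoeff_X))
    (coe_thetaFive_ne_zero constantCoeff_X)
  rw [PowerSeries.coe_X]
  simp

theorem thetaRatio_sub_one_ne_zero : thetaRatio - 1 ≠ 0 := fun h =>
  slaterRatio_ne_zero (by rw [slaterRatio, h, zero_div])

/-- `h(q) h(-q) = -h(q²)`. -/
theorem slaterRatio_mul_twist_neg :
    slaterRatio * twist (-1) slaterRatio = -expand 2 slaterRatio := by
  have h := congrArg (fun f : ℂ⟦X⟧ => (f : LaurentSeries ℂ)) (thetaOne_mul_neg constantCoeff_X)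
  simp only [map_mul] at h
  have h1 : twist (-1) slaterRatio =
      ((-X : ℂ⟦X⟧) : LaurentSeries ℂ) * thetaOne (-X) / thetaFive (-X) := by
    rw [← expand_twist_slaterRatio (-1) 1 (q := -X) (by simp)]
    ext n
    simpa using (coeff_expand_mul 1 (twist (-1) slaterRatio) n).symm
  have h2 := expand_twist_slaterRatio 1 2 (q := X ^ 2) (by simp)
  rw [twist_one] at h2
  rw [h1, h2, slaterRatio_eq]
  have n1 := coe_thetaFive_ne_zero (q := X) (by simp)
  have n2 := coe_thetaFive_ne_zero (q := -X) (by simp)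
  have n3 := coe_thetaFive_ne_zero (q := X ^ 2) (by simp)
  refine eq_neg_of_add_eq_zero_left ?_
  rw [div_mul_div_comm, div_add_div _ _ (mul_ne_zero n1 n2) n3, div_eq_zero_iff]
  left
  rw [map_neg, map_pow]
  linear_combination (-((X : ℂ⟦X⟧) : LaurentSeries ℂ) ^ 2) * h

/-- `h(q) h(c q) h(c² q) = h(q³)` for a primitive cube root of unity `c`. -/
theorem slaterRatio_mul_cube_roots {c : ℂˣ} (hc : (1 + c + c ^ 2 : ℂ) = 0) :
    slaterRatio * twist c slaterRatio * twist (c ^ 2) slaterRatio = expand 3 slaterRatio := by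
  have hC : (1 + C (c : ℂ) + C (c : ℂ) ^ 2 : ℂ⟦X⟧) = 0 := by
    rw [← map_one (C (R := ℂ)), ← map_pow, ← map_add, ← map_add, hc, map_zero]
  have hC3 : (C (c : ℂ) ^ 3 : ℂ⟦X⟧) = 1 := by linear_combination (C (c : ℂ) - 1) * hC
  have h := congrArg (fun f : ℂ⟦X⟧ => (f : LaurentSeries ℂ))
    (thetaOne_mul_cube_roots constantCoeff_X hC)
  simp only [map_mul] at h
  have h1 (d : ℂˣ) : twist d slaterRatio =
      ((C (d : ℂ) * X : ℂ⟦X⟧) : LaurentSeries ℂ) * thetaOne (C (d : ℂ) * X) /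
        thetaFive (C (d : ℂ) * X) := by
    rw [← expand_twist_slaterRatio d 1 (q := C (d : ℂ) * X) (by simp)]
    ext n
    simpa using (coeff_expand_mul 1 (twist d slaterRatio) n).symm
  have h2 := expand_twist_slaterRatio 1 3 (q := X ^ 3) (by simp)
  rw [twist_one] at h2
  rw [h1, h1, h2, slaterRatio_eq, Units.val_pow_eq_pow_val, map_pow]
  have n1 := coe_thetaFive_ne_zero (q := X) (by simp)
  have n2 := coe_thetaFive_ne_zero (q := C (c : ℂ) * X) (by simp)
  have n3 := coe_thetaFive_ne_zero (q := C (c : ℂ) ^ 2 * X) (by simp)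
  have n4 := coe_thetaFive_ne_zero (q := X ^ 3) (by simp)
  have hX : ((X : ℂ⟦X⟧) : LaurentSeries ℂ) * (C (c : ℂ) * X : ℂ⟦X⟧) * (C (c : ℂ) ^ 2 * X : ℂ⟦X⟧) =
      (X ^ 3 : ℂ⟦X⟧) := by
    rw [← map_mul, ← map_mul]
    congr 1
    linear_combination X ^ 3 * hC3
  rw [div_mul_div_comm, div_mul_div_comm,
    div_eq_div_iff (mul_ne_zero (mul_ne_zero n1 n2) n3) n4, ← hX]
  linear_combination ((X : ℂ⟦X⟧) : LaurentSeries ℂ) * (C (c : ℂ) * X : ℂ⟦X⟧) *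
    (C (c : ℂ) ^ 2 * X : ℂ⟦X⟧) * h

theorem phi_mul_twist_neg : phi * twist (-1) phi = expand 2 (twist (-1) phi) ^ 2 := by
  have h := congrArg (fun f : ℂ⟦X⟧ => (f : LaurentSeries ℂ))
    (thetaPhi_mul_thetaPhi_neg constantCoeff_X)
  have h1 := coe_thetaPhi (-1) 1
  have h2 := coe_thetaPhi (-1) 2
  have h3 : expand 1 (twist (-1) phi) = twist (-1) phi := by
    ext n
    simpa using (coeff_expand_mul 1 (twist (-1) phi) n)
  simp only [Units.val_neg, Units.val_one, map_neg, map_one, neg_mul, one_mul, pow_one] at h1 h2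
  rw [h3] at h1
  rw [← h2, ← h1, phi, ← map_mul, ← map_pow]
  exact h

/-! ### Quadratic and cubic modular equations -/

theorem thetaRatio_mul_twist_neg :
    thetaRatio * twist (-1) thetaRatio = expand 2 (twist (-1) thetaRatio) ^ 2 := by
  have h := phi_mul_twist_neg
  have h3 := congrArg (expand 3) h
  have e : ((-1 : ℂˣ)) ^ 3 = -1 := by norm_num
  rw [map_mul, map_pow, expand_comm 3 2] at h3
  have ht : twist (-1) (expand 3 phi) = expand 3 (twist (-1) phi) := by rw [twist_expand, e]
  rw [thetaRatio, map_div₀, map_div₀, ht, div_mul_div_comm, h, h3, div_pow]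

/-- This is h(q)h(-q) = -h(q²) with h = (r - 1)/(r + 1) substituted and denominators cleared. -/
theorem thetaRatio_add_twist_neg :
    thetaRatio + twist (-1) thetaRatio =
      expand 2 thetaRatio * (1 + thetaRatio * twist (-1) thetaRatio) := by
  have h := slaterRatio_mul_twist_neg
  have n1 := thetaRatio_add_one_ne_zero
  have n2 : twist (-1) thetaRatio + 1 ≠ 0 :=
    ((hasValue_thetaRatio.twist _).add hasValue_one).ne_zero (by norm_num)
  have n3 : expand 2 thetaRatio + 1 ≠ 0 :=
    ((hasValue_thetaRatio.expand _).add hasValue_one).ne_zero (by norm_num)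
  simp only [slaterRatio, map_div₀, map_sub, map_add, map_one] at h
  generalize thetaRatio = r at *
  generalize twist (-1) r = r' at *
  generalize expand 2 r = y at *
  rw [div_mul_div_comm, eq_neg_iff_add_eq_zero, div_add_div _ _ (mul_ne_zero n1 n2) n3,
    div_eq_zero_iff] at h
  have h' := h.resolve_right (mul_ne_zero (mul_ne_zero n1 n2) n3)
  have h2 : (2 : LaurentSeries ℂ) ≠ 0 := (hasValue_ofNat 2).ne_zero two_ne_zero
  refine mul_left_cancel₀ h2 ?_
  linear_combination -h'

theorem twist_neg_one_twist_neg_one (f : LaurentSeries ℂ) : twist (-1) (twist (-1) f) = f := by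
  rw [twist_twist, neg_one_mul, neg_neg, twist_one]

theorem twist_neg_one_expand_two (f : LaurentSeries ℂ) : twist (-1) (expand 2 f) = expand 2 f := by
  rw [twist_expand, neg_one_sq, twist_one]

/-- The modular equation relating `φ(q) / φ(q³)` and `φ(-q) / φ(-q³)`. -/
theorem one_add_thetaRatio_sq_mul :
    (1 + thetaRatio ^ 2) * (1 + twist (-1) thetaRatio ^ 2) = 4 := by
  have h1 := thetaRatio_mul_twist_neg
  have h2 := thetaRatio_add_twist_neg
  have hv := hasValue_thetaRatio
  have hv' := hv.twist (-1)
  have hU : HasValue ((1 + thetaRatio ^ 2) * (1 + twist (-1) thetaRatio ^ 2) - 4) 0 := by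
    have := ((hasValue_one.add (hv.pow 2)).mul (hasValue_one.add (hv'.pow 2))).sub (hasValue_ofNat 4)
    norm_num at this
    exact this
  have hu : HasValue (1 + expand 2 (twist (-1) thetaRatio) ^ 2) 2 := by
    have := hasValue_one.add ((hv'.expand 2).pow 2)
    norm_num at this
    exact this
  -- The defect U(q) of the identity has constant term 0 and satisfies U(q) = (1 + r(-q²)²) U(q²),
  -- where the factor has constant term 2; hence U = 0.
  refine sub_eq_zero.mp (eq_zero_of_eq_mul_expand hU hu two_ne_zero ?_)
  simp only [map_sub, map_mul, map_add, map_pow, map_one, map_ofNat]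
  generalize expand 2 thetaRatio = y at *
  generalize expand 2 (twist (-1) thetaRatio) = y' at *
  generalize twist (-1) thetaRatio = r' at *
  generalize thetaRatio = r at *
  rw [h1] at h2
  linear_combination (r + r' + y * (1 + y' ^ 2)) * h2 + (r * r' - 2 + y' ^ 2) * h1

/-- The sum of r(q) and r(-q) in terms of y = r(q²). With their product (3 - y²)/(1 + y²), it makes
them the two roots of a quadratic over series in q². -/
theorem one_add_sq_mul_add :
    (1 + expand 2 thetaRatio ^ 2) * (thetaRatio + twist (-1) thetaRatio) =
      4 * expand 2 thetaRatio := by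
  have h := congrArg (expand 2) one_add_thetaRatio_sq_mul
  simp only [map_mul, map_add, map_one, map_pow, map_ofNat] at h
  rw [thetaRatio_add_twist_neg, thetaRatio_mul_twist_neg]
  linear_combination expand 2 thetaRatio * h

/-- The modular equation relating `φ(q) / φ(q³)` and `φ(q²) / φ(q⁶)`. -/
theorem thetaRatio_quadratic :
    (1 + expand 2 thetaRatio ^ 2) * thetaRatio ^ 2 - 4 * expand 2 thetaRatio * thetaRatio +
      3 - expand 2 thetaRatio ^ 2 = 0 := by
  have h := congrArg (expand 2) one_add_thetaRatio_sq_mul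
  simp only [map_mul, map_add, map_one, map_pow, map_ofNat] at h
  have h1 := one_add_sq_mul_add
  have h2 := thetaRatio_mul_twist_neg
  linear_combination thetaRatio * h1 - (1 + expand 2 thetaRatio ^ 2) * h2 - h

/-! ### Gradings -/

/-- All exponents occurring in `f` are congruent to `a` modulo `M`. -/
def Graded (M a : ℤ) (f : LaurentSeries ℂ) : Prop := ∀ n, f.coeff n ≠ 0 → n ≡ a [ZMOD M]

theorem Graded.coeff_eq_zero {M a : ℤ} {f : LaurentSeries ℂ} (h : Graded M a f) {n : ℤ}
    (hn : n % M ≠ a % M) : f.coeff n = 0 :=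
  not_not.mp fun h' => hn (h n h')

theorem Graded.congr {M a b : ℤ} {f : LaurentSeries ℂ} (h : Graded M a f) (hab : a % M = b % M) :
    Graded M b f := fun n hn => (h n hn).trans hab

theorem Graded.of_dvd {M N a : ℤ} {f : LaurentSeries ℂ} (h : Graded M a f) (hN : N ∣ M) :
    Graded N a f := fun n hn => (h n hn).of_dvd hN

theorem Graded.add {M a : ℤ} {f g : LaurentSeries ℂ} (hf : Graded M a f) (hg : Graded M a g) :
    Graded M a (f + g) := fun n hn => by
  by_contra h
  exact hn (by rw [HahnSeries.coeff_add, hf.coeff_eq_zero h, hg.coeff_eq_zero h, add_zero])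

theorem Graded.neg {M a : ℤ} {f : LaurentSeries ℂ} (hf : Graded M a f) : Graded M a (-f) :=
  fun n hn => hf n (by simpa using hn)

theorem Graded.sub {M a : ℤ} {f g : LaurentSeries ℂ} (hf : Graded M a f) (hg : Graded M a g) :
    Graded M a (f - g) := by
  rw [sub_eq_add_neg]
  exact hf.add hg.neg

theorem Graded.mul {M a b : ℤ} {f g : LaurentSeries ℂ} (hf : Graded M a f) (hg : Graded M b g) :
    Graded M (a + b) (f * g) := fun n hn => by
  obtain ⟨i, hi, j, hj, rfl⟩ := HahnSeries.support_mul_subset hn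
  exact (hf i hi).add (hg j hj)

theorem graded_one (M : ℤ) : Graded M 0 1 := fun n hn => by
  rw [HahnSeries.coeff_one] at hn
  rw [of_not_not fun h => hn (if_neg h)]

theorem Graded.pow {M a : ℤ} {f : LaurentSeries ℂ} (hf : Graded M a f) (n : ℕ) :
    Graded M (n * a) (f ^ n) := by
  induction n with
  | zero => simpa using graded_one M
  | succ n ih =>
    rw [pow_succ]
    convert ih.mul hf using 1
    push_cast
    ring

theorem graded_natCast (M : ℤ) (n : ℕ) : Graded M 0 (n : LaurentSeries ℂ) := by
  induction n with
  | zero => exact fun n hn => (hn (by simp)).elim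
  | succ n ih =>
    rw [Nat.cast_succ]
    exact ih.add (graded_one M)

theorem graded_ofNat (M : ℤ) (n : ℕ) [n.AtLeastTwo] :
    Graded M 0 (OfNat.ofNat n : LaurentSeries ℂ) :=
  graded_natCast M n

theorem Graded.twist {M a : ℤ} {f : LaurentSeries ℂ} (hf : Graded M a f) (c : ℂˣ) :
    Graded M a (twist c f) := fun n hn => hf n fun h => hn (by simp [h])

/-- A residue class of exponents is an eigenspace of q ↦ cq. Since the substitution is a ring
homomorphism, this form handles inverses and square roots, where supports are awkward. -/
theorem graded_iff_twist {M : ℕ} {c : ℂˣ} (hc : IsPrimitiveRoot c M) (a : ℤ)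
    (f : LaurentSeries ℂ) :
    Graded M a f ↔ Slater.twist c f = HahnSeries.C ((c ^ a : ℂˣ) : ℂ) * f := by
  constructor
  · intro h
    ext n
    rw [coeff_twist, HahnSeries.C_mul_eq_smul, HahnSeries.coeff_smul, smul_eq_mul]
    by_cases hn : f.coeff n = 0
    · simp [hn]
    · have : c ^ (n - a) = 1 := (hc.zpow_eq_one_iff_dvd _).mpr (h n hn).symm.dvd
      rw [zpow_sub, mul_inv_eq_one] at this
      rw [this]
  · intro h n hn
    have h' := congrArg (fun f : LaurentSeries ℂ => f.coeff n) h
    simp only [coeff_twist, HahnSeries.C_mul_eq_smul, HahnSeries.coeff_smul, smul_eq_mul] at h'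
    have h'' := Units.ext (mul_right_cancel₀ hn h')
    have : c ^ (n - a) = 1 := by rw [zpow_sub, h'', mul_inv_cancel]
    exact ((Int.modEq_iff_dvd.mpr ((hc.zpow_eq_one_iff_dvd _).mp this))).symm

theorem exists_isPrimitiveRoot_units (M : ℕ) [NeZero M] : ∃ c : ℂˣ, IsPrimitiveRoot c M := by
  have h := Complex.isPrimitiveRoot_exp M (NeZero.ne M)
  refine ⟨Units.mk0 _ (h.ne_zero (NeZero.ne M)), ?_⟩
  exact IsPrimitiveRoot.coe_units_iff.mp h

theorem Graded.inv {M : ℕ} [NeZero M] {a : ℤ} {f : LaurentSeries ℂ} (hf : Graded M a f) :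
    Graded M (-a) f⁻¹ := by
  obtain ⟨c, hc⟩ := exists_isPrimitiveRoot_units M
  rw [graded_iff_twist hc] at hf ⊢
  rw [map_inv₀, hf, mul_inv, zpow_neg, Units.val_inv_eq_inv_val, map_inv₀]

theorem Graded.expand {M a : ℤ} {f : LaurentSeries ℂ} (hf : Graded M a f) (k : ℕ) [NeZero k] :
    Graded (k * M) (k * a) (expand k f) := fun n hn => by
  by_cases h : (k : ℤ) ∣ n
  · obtain ⟨n, rfl⟩ := h
    rw [coeff_expand_mul] at hn
    exact (hf n hn).mul_left'
  · exact (hn (coeff_expand_of_not_dvd k f h)).elim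

theorem graded_expand (k : ℕ) [NeZero k] (f : LaurentSeries ℂ) : Graded k 0 (expand k f) := by
  have h : Graded 1 0 f := fun n _ => Int.modEq_one
  simpa using h.expand k

theorem graded_two_iff (f : LaurentSeries ℂ) : Graded 2 1 f ↔ twist (-1) f = -f := by
  have hc : IsPrimitiveRoot (-1 : ℂˣ) 2 := by
    refine IsPrimitiveRoot.coe_units_iff.mp ?_
    simpa using IsPrimitiveRoot.neg_one (R := ℂ) 0 (by norm_num)
  have := graded_iff_twist hc 1 f
  simpa using this

/-- The decomposition of a Laurent series by the residues of its exponents modulo `3` is unique. -/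
theorem Graded.eq_zero_of_add_eq_zero {f g h : LaurentSeries ℂ} (hf : Graded 3 0 f)
    (hg : Graded 3 1 g) (hh : Graded 3 2 h) (hs : f + g + h = 0) : f = 0 ∧ g = 0 ∧ h = 0 := by
  have hc (n : ℤ) : f.coeff n + g.coeff n + h.coeff n = 0 := by
    simpa using congrArg (fun f : LaurentSeries ℂ => f.coeff n) hs
  refine ⟨?_, ?_, ?_⟩ <;> ext n <;> have hn := hc n <;> rw [HahnSeries.coeff_zero]
  · by_contra h'
    have := hf n h'
    rw [hg.coeff_eq_zero (n := n) (by rw [this]; norm_num),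
      hh.coeff_eq_zero (n := n) (by rw [this]; norm_num)] at hn
    exact h' (by simpa using hn)
  · by_contra h'
    have := hg n h'
    rw [hf.coeff_eq_zero (n := n) (by rw [this]; norm_num),
      hh.coeff_eq_zero (n := n) (by rw [this]; norm_num)] at hn
    exact h' (by simpa using hn)
  · by_contra h'
    have := hh n h'
    rw [hf.coeff_eq_zero (n := n) (by rw [this]; norm_num),
      hg.coeff_eq_zero (n := n) (by rw [this]; norm_num)] at hn
    exact h' (by simpa using hn)

/-! ### The cubic modular equation -/

theorem coeff_thetaPhi_nine_mul (n : ℕ) : coeff (9 * n) (thetaPhi X) = coeff n (thetaPhi X) := by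
  refine HasSum.unique (f := fun j : ℤ => if n = j.natAbs ^ 2 then (1 : ℂ) else 0) ?_
    (hasSum_coeff_thetaPhi n)
  have hi : Function.Injective fun j : ℤ => 3 * j := mul_right_injective₀ three_ne_zero
  have h := (hi.hasSum_iff fun j hj => if_neg fun h => hj ?_).mpr (hasSum_coeff_thetaPhi (9 * n))
  · convert h using 2 with j
    simp only [Function.comp_apply, Int.natAbs_mul, mul_pow]
    norm_num
  · have h3 : 3 ∣ j.natAbs := Nat.prime_three.dvd_of_dvd_pow (n := 2) (h ▸ ⟨3 * n, by ring⟩)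
    obtain ⟨i, hi⟩ := Int.natCast_dvd.mpr h3
    exact ⟨i, hi.symm⟩

theorem coeff_thetaPhi_eq_zero {n : ℕ} (h : ∀ j : ℕ, n ≠ j ^ 2) : coeff n (thetaPhi X) = 0 := by
  refine (hasSum_coeff_thetaPhi n).unique ?_
  simp only [h, if_false]
  exact hasSum_zero

/-- The 3-dissection of `φ`. -/
theorem graded_phi_sub_expand : Graded 3 1 (phi - expand 9 phi) := by
  intro n hn
  by_contra hn1
  refine hn ?_
  have h1 (n : ℕ) : phi.coeff n = coeff n (thetaPhi X) :=
    LaurentSeries.coeff_coe_powerSeries _ n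
  rw [HahnSeries.coeff_sub, sub_eq_zero]
  rcases lt_or_ge n 0 with h0 | h0
  · rw [hasValue_phi.1 n h0, (hasValue_phi.expand 9).1 n h0]
  lift n to ℕ using h0
  rw [coeff_expand]
  split_ifs with h9
  · obtain ⟨m, rfl⟩ : 9 ∣ n := by exact_mod_cast h9
    rw [h1, coeff_thetaPhi_nine_mul]
    push_cast
    rw [Int.mul_ediv_cancel_left _ (by norm_num), h1]
  · rw [h1]
    refine coeff_thetaPhi_eq_zero fun j hj => ?_
    have h9' : ¬ 9 ∣ n := fun h => h9 (by exact_mod_cast h)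
    have hn1' : n % 3 ≠ 1 := fun h => hn1 (by rw [Int.ModEq]; omega)
    rw [hj] at h9' hn1'
    have hj3 : j % 3 = 0 ∨ j % 3 = 1 ∨ j % 3 = 2 := by omega
    rcases hj3 with h | h | h
    · obtain ⟨i, rfl⟩ := Nat.dvd_of_mod_eq_zero h
      exact h9' ⟨i ^ 2, by ring⟩
    · exact hn1' (by rw [Nat.pow_mod, h])
    · exact hn1' (by rw [Nat.pow_mod, h])

/-- The function `φ(q) / φ(q⁹) - 1`. -/
def thetaCubic : LaurentSeries ℂ := thetaRatio * expand 3 thetaRatio - 1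

/-- Here w = (φ(q) - φ(q⁹))/φ(q⁹): the numerator collects the squares prime to 3, and the
denominator is a series in q³. -/
theorem graded_thetaCubic : Graded 3 1 thetaCubic := by
  have h : thetaCubic = (phi - expand 9 phi) * (expand 9 phi)⁻¹ := by
    have h3 : expand 3 thetaRatio = expand 3 phi / expand 9 phi := by
      rw [thetaRatio, map_div₀, expand_expand 3 3 9 rfl]
    rw [thetaCubic, h3, thetaRatio, div_mul_div_cancel₀ (expand_phi_ne_zero 3), sub_mul,
      mul_inv_cancel₀ (expand_phi_ne_zero 9), div_eq_mul_inv]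
  rw [h]
  have h9 : Graded 3 0 (expand 9 phi) := (graded_expand 9 phi).of_dvd ⟨3, by norm_num⟩
  exact graded_phi_sub_expand.mul (Graded.inv (M := 3) h9)

theorem expand_thetaRatio_ne_zero (k : ℕ) [NeZero k] : expand k thetaRatio ≠ 0 :=
  (hasValue_thetaRatio.expand k).ne_zero one_ne_zero

theorem thetaRatio_eq : thetaRatio = (1 + thetaCubic) / expand 3 thetaRatio := by
  rw [eq_div_iff (expand_thetaRatio_ne_zero 3), thetaCubic]
  ring

/-- The cubic modular equation. -/
theorem thetaCubic_pow_three : thetaCubic ^ 3 = expand 3 thetaRatio ^ 4 - 1 := by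
  obtain ⟨c, hc⟩ := exists_isPrimitiveRoot_units 3
  have hc' : IsPrimitiveRoot (c : ℂ) 3 := IsPrimitiveRoot.coe_units_iff.mpr hc
  have hsum : (1 + c + c ^ 2 : ℂ) = 0 := by
    have := hc'.geom_sum_eq_zero (by norm_num)
    simpa [Finset.sum_range_succ] using this
  have h := slaterRatio_mul_cube_roots hsum
  have hw := (graded_iff_twist hc 1 _).mp graded_thetaCubic
  have hc3 : c ^ 3 = 1 := hc.pow_eq_one
  have hx : twist c (expand 3 thetaRatio) = expand 3 thetaRatio := by
    rw [twist_expand, hc3, twist_one]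
  have hw2 : twist (c ^ 2) thetaCubic = HahnSeries.C (c : ℂ) ^ 2 * thetaCubic := by
    rw [pow_two, ← twist_twist, hw, map_mul, hw, zpow_one]
    have : twist c (HahnSeries.C (c : ℂ)) = HahnSeries.C (c : ℂ) := by
      ext n
      by_cases hn : n = 0 <;> simp [HahnSeries.C_apply, hn]
    rw [this]
    ring
  rw [zpow_one] at hw
  have hx2 : twist (c ^ 2) (expand 3 thetaRatio) = expand 3 thetaRatio := by
    rw [pow_two, ← twist_twist, hx, hx]
  have hx0 := expand_thetaRatio_ne_zero 3
  have hC : 1 + HahnSeries.C (c : ℂ) + HahnSeries.C (c : ℂ) ^ 2 = (0 : LaurentSeries ℂ) := by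
    simpa using congrArg (HahnSeries.C (Γ := ℤ)) hsum
  have hne (d : ℂˣ) : twist d thetaRatio + 1 ≠ 0 :=
    ((hasValue_thetaRatio.twist d).add hasValue_one).ne_zero (by norm_num)
  have n0 := thetaRatio_add_one_ne_zero
  have n1 := hne c
  have n2 := hne (c ^ 2)
  have n3 : expand 3 thetaRatio + 1 ≠ 0 :=
    ((hasValue_thetaRatio.expand 3).add hasValue_one).ne_zero (by norm_num)
  simp only [slaterRatio, map_div₀, map_sub, map_add, map_one] at h
  have e0 := thetaRatio_eq
  have e1 := congrArg (twist c) e0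
  have e2 := congrArg (twist (c ^ 2)) e0
  simp only [map_div₀, map_add, map_one, hw, hw2, hx, hx2] at e1 e2
  rw [eq_div_iff hx0] at e0 e1 e2
  rw [div_mul_div_comm, div_mul_div_comm, div_eq_div_iff (mul_ne_zero (mul_ne_zero n0 n1) n2) n3] at h
  generalize thetaCubic = w at *
  generalize expand 3 thetaRatio = x at *
  generalize twist (c ^ 2) thetaRatio = r2 at *
  generalize twist c thetaRatio = r1 at *
  generalize thetaRatio = r at *
  generalize (HahnSeries.C (c : ℂ) : LaurentSeries ℂ) = C at *
  -- The twists multiply w by 1, C, C² and fix x, so each r(c^i q) x is 1 + C^i w and the triple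
  -- product for h collapses to sums of two cubes, with t = x and t = -x.
  have hs (t : LaurentSeries ℂ) :
      (1 + w + t) * (1 + C * w + t) * (1 + C ^ 2 * w + t) = (1 + t) ^ 3 + w ^ 3 := by
    linear_combination ((1 + t) ^ 2 * w + C * (1 + t) * w ^ 2 + (C - 1) * w ^ 3) * hC
  have hx3 : (r - 1) * x * ((r1 - 1) * x) * ((r2 - 1) * x) * (x + 1) =
      (x - 1) * ((r + 1) * x * ((r1 + 1) * x) * ((r2 + 1) * x)) := by
    linear_combination x ^ 3 * h
  have m0 : (r - 1) * x = 1 + w + -x := by linear_combination e0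
  have m1 : (r1 - 1) * x = 1 + C * w + -x := by linear_combination e1
  have m2 : (r2 - 1) * x = 1 + C ^ 2 * w + -x := by linear_combination e2
  have p0 : (r + 1) * x = 1 + w + x := by linear_combination e0
  have p1 : (r1 + 1) * x = 1 + C * w + x := by linear_combination e1
  have p2 : (r2 + 1) * x = 1 + C ^ 2 * w + x := by linear_combination e2
  rw [m0, m1, m2, p0, p1, p2, hs, hs] at hx3
  have h2 : (2 : LaurentSeries ℂ) ≠ 0 := (hasValue_ofNat 2).ne_zero two_ne_zero
  refine mul_left_cancel₀ h2 ?_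
  linear_combination hx3

/-! ### Algebra of the parametrization -/

section Algebra

variable {F : Type*} [Field F]

/-- In this and the following `param_` lemmas with h1 and h2, those two hypotheses say that e and y
are the roots of (r² - 1)T² - 4rT + r² + 3. Here the left side is (ey + 1)² - (e + y)². -/
theorem param_sq {r y e : F} (hr : r ^ 2 - 1 ≠ 0) (h1 : (e + y) * (r ^ 2 - 1) = 4 * r)
    (h2 : e * y * (r ^ 2 - 1) = r ^ 2 + 3) : (e ^ 2 - 1) * (y ^ 2 - 1) = 4 := by
  refine mul_right_cancel₀ (pow_ne_zero 2 hr) ?_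
  linear_combination (e * y * (r ^ 2 - 1) + (r ^ 2 + 3) + 2 * (r ^ 2 - 1)) * h2 -
    ((e + y) * (r ^ 2 - 1) + 4 * r) * h1

theorem param_linear {r y e : F} (hr : r ^ 2 - 1 ≠ 0) (h1 : (e + y) * (r ^ 2 - 1) = 4 * r)
    (h2 : e * y * (r ^ 2 - 1) = r ^ 2 + 3) : e * (y ^ 2 - 1) = (1 + y ^ 2) * r - 2 * y := by
  refine mul_right_cancel₀ hr ?_
  linear_combination (y + r) * h2 - (1 + r * y) * h1

theorem param_dual {r y e : F} (hr : r ^ 2 - 1 ≠ 0) (he : e ≠ 0) (hy : y ≠ 0)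
    (h1 : (e + y) * (r ^ 2 - 1) = 4 * r) (h2 : e * y * (r ^ 2 - 1) = r ^ 2 + 3) :
    4 * r / (r ^ 2 + 3) = e⁻¹ + y⁻¹ := by
  rw [← h1, ← h2]
  field_simp
  ring

theorem param_inv_ratio {r y e : F} (hr : r ^ 2 - 1 ≠ 0) (hr1 : r - 1 ≠ 0) (h0 : (2 : F) ≠ 0)
    (h1 : (e + y) * (r ^ 2 - 1) = 4 * r) (h2 : e * y * (r ^ 2 - 1) = r ^ 2 + 3) :
    (r + 1) / (r - 1) = (1 + e) * (1 + y) / 2 := by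
  rw [div_eq_div_iff hr1 h0]
  refine mul_right_cancel₀ hr ?_
  linear_combination (1 - r) * h1 + (1 - r) * h2

theorem param_ratio {r y e : F} (hr : r ^ 2 - 1 ≠ 0) (hr1 : r + 1 ≠ 0) (h0 : (2 : F) ≠ 0)
    (h1 : (e + y) * (r ^ 2 - 1) = 4 * r) (h2 : e * y * (r ^ 2 - 1) = r ^ 2 + 3) :
    (r - 1) / (r + 1) = (1 - e) * (1 - y) / 2 := by
  rw [div_eq_div_iff hr1 h0]
  refine mul_right_cancel₀ hr ?_
  linear_combination (1 + r) * h1 - (1 + r) * h2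

/-- The ratio is (1 + w - x)/(1 + w + x). Rationalizing uses (1 + x)³ + w³ = x(x + 1)(x² + 3), the
source of the denominator x² + 3. The result separates the powers w⁻¹, 1, w and hence the residues
mod 3. -/
theorem ratio_eq_cubic {r x w : F} (hw : w ^ 3 = x ^ 4 - 1) (hr : r * x = 1 + w) (hx : x ≠ 0)
    (hw0 : w ≠ 0) (hd : x ^ 2 + 3 ≠ 0) (hr1 : r + 1 ≠ 0) :
    (r - 1) / (r + 1) =
      (-2 * (x - 1) * (x ^ 2 + 1) / w + (x - 1) ^ 2 + 2 * w) / (x ^ 2 + 3) := by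
  rw [div_eq_div_iff hr1 hd]
  refine mul_right_cancel₀ (mul_ne_zero hw0 hx) ?_
  have e : (-2 * (x - 1) * (x ^ 2 + 1) / w + (x - 1) ^ 2 + 2 * w) * w =
      -2 * (x - 1) * (x ^ 2 + 1) + (x - 1) ^ 2 * w + 2 * w ^ 2 := by field_simp
  linear_combination (-(r + 1) * x) * e - 2 * hw + ((x ^ 2 + 3) * w -
    (-2 * (x - 1) * (x ^ 2 + 1) + (x - 1) ^ 2 * w + 2 * w ^ 2)) * hr

theorem inv_ratio_eq_cubic {r x w : F} (hw : w ^ 3 = x ^ 4 - 1) (hr : r * x = 1 + w) (hx : x ≠ 0)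
    (hw0 : w ≠ 0) (hd : x ^ 2 + 3 ≠ 0) (hr1 : r - 1 ≠ 0) :
    (r + 1) / (r - 1) =
      (2 * (x + 1) * (x ^ 2 + 1) / w + (x + 1) ^ 2 + 2 * w) / (x ^ 2 + 3) := by
  rw [div_eq_div_iff hr1 hd]
  refine mul_right_cancel₀ (mul_ne_zero hw0 hx) ?_
  have e : (2 * (x + 1) * (x ^ 2 + 1) / w + (x + 1) ^ 2 + 2 * w) * w =
      2 * (x + 1) * (x ^ 2 + 1) + (x + 1) ^ 2 * w + 2 * w ^ 2 := by field_simp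
  linear_combination (-(r - 1) * x) * e - 2 * hw + ((x ^ 2 + 3) * w -
    (2 * (x + 1) * (x ^ 2 + 1) + (x + 1) ^ 2 * w + 2 * w ^ 2)) * hr

/-- The summands are the cubes of the two components of E in `thetaOdd_eq_add`, with w(q²)³ replaced
by its value and q³ written as q. -/
theorem param_cube {y e : F} (he : e ≠ 0) (hy : y ^ 2 + 3 ≠ 0)
    (h : (e ^ 2 - 1) * (y ^ 2 - 1) = 4) :
    e⁻¹ ^ 3 + 8 * (y ^ 4 - 1) * (e / (y ^ 2 + 3)) ^ 3 = e := by
  have h' : e ^ 2 * (y ^ 2 - 1) = y ^ 2 + 3 := by linear_combination h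
  have hy1 : y ^ 2 - 1 ≠ 0 := fun h0 => hy (by rw [← h', h0, mul_zero])
  have e1 : e / (y ^ 2 + 3) = (e * (y ^ 2 - 1))⁻¹ := by
    rw [← h']
    field_simp
  rw [e1, show y ^ 4 - 1 = (y ^ 2 - 1) * (y ^ 2 + 1) by ring]
  field_simp
  linear_combination (-(e ^ 2 * (y ^ 2 - 1)) - (y ^ 2 + 3)) * h'

/-- The coefficient identity behind `level_six`. It follows from r = (e + y)/(ey - 1), which removes
r, and the relation `param_sq` between e and y. -/
theorem param_level_six {r y e : F} (hr : r ^ 2 - 1 ≠ 0) (he : e ≠ 0)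
    (hy : y ≠ 0) (hy3 : y ^ 2 + 3 ≠ 0) (h0 : (2 : F) ≠ 0)
    (h1 : (e + y) * (r ^ 2 - 1) = 4 * r) (h2 : e * y * (r ^ 2 - 1) = r ^ 2 + 3) :
    4 * r * (r ^ 2 + 1) / (r ^ 2 + 3) * (2 * (e + 3 * e⁻¹)) / (r ^ 2 + 3) =
      4 * y * (y ^ 2 + 1) / (y ^ 2 + 3) * (2 * (e / (y ^ 2 + 3)) + y⁻¹) := by
  have h := param_sq hr h1 h2
  have h3 : e ^ 2 * (y ^ 2 - 1) = y ^ 2 + 3 := by linear_combination h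
  have hy1 : y ^ 2 - 1 ≠ 0 := fun h => hy3 (by rw [← h3, h, mul_zero])
  have h4 : (e * y - 1) * (r ^ 2 - 1) = 2 * 2 := by linear_combination h2
  have hm : e * y - 1 ≠ 0 := fun h => mul_ne_zero h0 h0 (by rw [← h4, h, zero_mul])
  have hr' : r = (e + y) / (e * y - 1) := by
    rw [eq_div_iff hm]
    refine mul_right_cancel₀ hr ?_
    linear_combination r * h4 - h1
  have hr1' : r ^ 2 - 1 = 4 / (e * y - 1) := by
    rw [eq_div_iff hm]
    linear_combination h4
  have e1 : r ^ 2 + 1 = 2 * (e * y + 1) / (e * y - 1) := by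
    rw [show r ^ 2 + 1 = r ^ 2 - 1 + 2 by ring, hr1']
    field_simp
    ring
  have e3 : r ^ 2 + 3 = 2 * 2 * (e * y) / (e * y - 1) := by
    rw [show r ^ 2 + 3 = r ^ 2 - 1 + 4 by ring, hr1']
    field_simp
    ring
  have h5 : e ^ 2 + 3 = y ^ 2 * (e ^ 2 - 1) := by linear_combination -h
  have h6 : e ^ 2 - 1 = 4 / (y ^ 2 - 1) := by rw [eq_div_iff hy1, h]
  have h7 : (e + y) * (e * y + 1) * (y ^ 2 - 1) = (1 + y ^ 2) * (2 * y + e * (y ^ 2 - 1)) := by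
    linear_combination y * h3
  have l : 2 * (e + 3 * e⁻¹) = 2 * (y ^ 2 * (4 / (y ^ 2 - 1))) / e := by
    rw [← h6, ← h5]
    field_simp
  rw [l, e1, e3, ← h3, hr']
  field_simp
  linear_combination 4 * h7 + 12 * y * h3

/-- A partial fraction split: 4r/(r² - 1) = e + y and 4r/(r² + 3) = 1/e + 1/y. It rewrites a
dissection coefficient in terms of series whose exponents are known; `param_three_sum` does the
same. -/
theorem param_sum {r y e : F} (hr : r ^ 2 - 1 ≠ 0) (hr3 : r ^ 2 + 3 ≠ 0) (he : e ≠ 0)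
    (hy : y ≠ 0) (h1 : (e + y) * (r ^ 2 - 1) = 4 * r) (h2 : e * y * (r ^ 2 - 1) = r ^ 2 + 3) :
    -16 * r * (r ^ 2 + 1) / ((r ^ 2 - 1) * (r ^ 2 + 3)) = -2 * (e + y + e⁻¹ + y⁻¹) := by
  have h := param_dual hr he hy h1 h2
  have h' : 4 * r / (r ^ 2 - 1) = e + y := by rw [div_eq_iff hr, h1]
  rw [add_assoc, ← h, ← h']
  field_simp
  ring

theorem param_three_sum {r y e : F} (hr : r ^ 2 - 1 ≠ 0) (hr3 : r ^ 2 + 3 ≠ 0) (he : e ≠ 0)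
    (hy : y ≠ 0) (h1 : (e + y) * (r ^ 2 - 1) = 4 * r) (h2 : e * y * (r ^ 2 - 1) = r ^ 2 + 3) :
    32 * r ^ 3 / ((r ^ 2 - 1) * (r ^ 2 + 3)) = 2 * (e + 3 * e⁻¹) + 2 * (y + 3 * y⁻¹) := by
  have h := param_dual hr he hy h1 h2
  have h' : 4 * r / (r ^ 2 - 1) = e + y := by rw [div_eq_iff hr, h1]
  rw [show 2 * (e + 3 * e⁻¹) + 2 * (y + 3 * y⁻¹) = 2 * (e + y) + 6 * (e⁻¹ + y⁻¹) by ring, ← h, ← h']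
  field_simp
  ring

end Algebra

/-! ### The odd part of `1 / h - h` -/

/-- The function `1 / h(q) - h(q) - r(q²)` for `r(q) = φ(q) / φ(q³)`. -/
def thetaOdd : LaurentSeries ℂ := slaterRatio⁻¹ - slaterRatio - expand 2 thetaRatio

theorem thetaRatio_sq_sub_one_ne_zero : thetaRatio ^ 2 - 1 ≠ 0 := by
  have := mul_ne_zero thetaRatio_sub_one_ne_zero thetaRatio_add_one_ne_zero
  rwa [show (thetaRatio - 1) * (thetaRatio + 1) = thetaRatio ^ 2 - 1 by ring] at this

theorem thetaRatio_sq_add_one_ne_zero : thetaRatio ^ 2 + 1 ≠ 0 :=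
  ((hasValue_thetaRatio.pow 2).add hasValue_one).ne_zero (by norm_num)

theorem thetaRatio_sq_add_three_ne_zero : thetaRatio ^ 2 + 3 ≠ 0 :=
  ((hasValue_thetaRatio.pow 2).add (hasValue_ofNat 3)).ne_zero (by norm_num)

theorem thetaRatio_ne_zero : thetaRatio ≠ 0 := hasValue_thetaRatio.ne_zero one_ne_zero

theorem two_ne_zero_laurent : (2 : LaurentSeries ℂ) ≠ 0 := (hasValue_ofNat 2).ne_zero two_ne_zero

theorem thetaOdd_add_mul :
    (thetaOdd + expand 2 thetaRatio) * (thetaRatio ^ 2 - 1) = 4 * thetaRatio := by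
  have h1 := thetaRatio_sub_one_ne_zero
  have h2 := thetaRatio_add_one_ne_zero
  rw [thetaOdd, sub_add_cancel, slaterRatio, inv_div]
  generalize thetaRatio = r at *
  field_simp
  ring

/-- The quadratic modular equation says that y is a root of (r² - 1)T² - 4rT + r² + 3; since E + y
is the sum of the roots, E is the other one. -/
theorem thetaOdd_mul_mul :
    thetaOdd * expand 2 thetaRatio * (thetaRatio ^ 2 - 1) = thetaRatio ^ 2 + 3 := by
  linear_combination expand 2 thetaRatio * thetaOdd_add_mul - thetaRatio_quadratic

theorem thetaOdd_ne_zero : thetaOdd ≠ 0 := fun h =>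
  thetaRatio_sq_add_three_ne_zero (by rw [← thetaOdd_mul_mul, h, zero_mul, zero_mul])

theorem thetaOdd_sq : (thetaOdd ^ 2 - 1) * (expand 2 thetaRatio ^ 2 - 1) = 4 :=
  param_sq thetaRatio_sq_sub_one_ne_zero thetaOdd_add_mul thetaOdd_mul_mul

theorem inv_slaterRatio : slaterRatio⁻¹ = (1 + thetaOdd) * (1 + expand 2 thetaRatio) / 2 := by
  rw [slaterRatio, inv_div]
  exact param_inv_ratio thetaRatio_sq_sub_one_ne_zero thetaRatio_sub_one_ne_zero
    two_ne_zero_laurent thetaOdd_add_mul thetaOdd_mul_mul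

theorem slaterRatio_eq_mul : slaterRatio = (1 - thetaOdd) * (1 - expand 2 thetaRatio) / 2 :=
  param_ratio thetaRatio_sq_sub_one_ne_zero thetaRatio_add_one_ne_zero
    two_ne_zero_laurent thetaOdd_add_mul thetaOdd_mul_mul

/-- From (E² - 1)(y² - 1) = 4, E² = (y² + 3)/(y² - 1), and this is the product of the roots E y
taken at q². -/
theorem thetaOdd_sq_eq : thetaOdd ^ 2 = expand 2 (thetaOdd * expand 2 thetaRatio) := by
  have h := congrArg (expand 2) thetaOdd_mul_mul
  have hne : expand 2 (thetaRatio ^ 2 - 1) ≠ 0 :=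
    (_root_.map_ne_zero _).mpr thetaRatio_sq_sub_one_ne_zero
  refine mul_right_cancel₀ hne ?_
  rw [map_mul] at h
  rw [h]
  simp only [map_sub, map_add, map_pow, map_one, map_ofNat]
  linear_combination thetaOdd_sq

theorem thetaOdd_mul_sq_sub_one : thetaOdd * (expand 2 thetaRatio ^ 2 - 1) =
    (1 + expand 2 thetaRatio ^ 2) * thetaRatio - 2 * expand 2 thetaRatio :=
  param_linear thetaRatio_sq_sub_one_ne_zero thetaOdd_add_mul thetaOdd_mul_mul

/-- By `param_linear`, E(y² - 1) = (1 + y²) r - 2y, where only r changes under q ↦ -q; the value of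
r(q) + r(-q) makes the right side odd. -/
theorem twist_neg_one_thetaOdd : twist (-1) thetaOdd = -thetaOdd := by
  have h1 := thetaOdd_add_mul
  have h2 := congrArg (twist (-1)) thetaOdd_add_mul
  have h3 := thetaOdd_mul_mul
  have h4 := congrArg (twist (-1)) thetaOdd_mul_mul
  have h5 := one_add_sq_mul_add
  simp only [map_mul, map_add, map_sub, map_pow, map_one, map_ofNat, twist_neg_one_expand_two]
    at h2 h4
  have hy : expand 2 thetaRatio ^ 2 - 1 ≠ 0 := by
    simpa using (_root_.map_ne_zero (expand 2)).mpr thetaRatio_sq_sub_one_ne_zero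
  have k1 := param_linear thetaRatio_sq_sub_one_ne_zero h1 h3
  have hne : twist (-1) thetaRatio ^ 2 - 1 ≠ 0 := by
    simpa using (_root_.map_ne_zero (twist (-1))).mpr thetaRatio_sq_sub_one_ne_zero
  have k2 := param_linear hne h2 h4
  refine mul_right_cancel₀ hy ?_
  linear_combination k1 + k2 + h5

theorem coeff_neg_one_thetaOdd : thetaOdd.coeff (-1) = 1 := by
  have hX : ((X : ℂ⟦X⟧) : LaurentSeries ℂ) = HahnSeries.single 1 1 := PowerSeries.coe_X
  have h0 : ((expand 2 thetaRatio).coeff (-1)) = 0 := (hasValue_thetaRatio.expand 2).1 _ (by norm_num)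
  have hone := hasValue_coe (thetaOne X)
  have hfive := hasValue_coe (thetaFive X)
  rw [constantCoeff_thetaOne constantCoeff_X] at hone
  rw [constantCoeff_thetaFive constantCoeff_X] at hfive
  have h1 := (hone.mul (hfive.inv one_ne_zero)).1 (-2) (by norm_num)
  have h2 := (hfive.mul (hone.inv one_ne_zero)).2
  rw [thetaOdd, HahnSeries.coeff_sub, HahnSeries.coeff_sub, h0, slaterRatio_eq, hX, inv_div,
    mul_div_assoc, div_mul_eq_div_div_swap, div_eq_mul_inv, div_eq_mul_inv, div_eq_mul_inv,
    HahnSeries.inv_single, mul_comm _ (HahnSeries.single _ _)]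
  have s1 := HahnSeries.coeff_single_mul_add (R := ℂ) (Γ := ℤ) (r := 1⁻¹)
    (x := (thetaFive X : LaurentSeries ℂ) * (thetaOne X : LaurentSeries ℂ)⁻¹) (a := 0) (b := -1)
  have s2 := HahnSeries.coeff_single_mul_add (R := ℂ) (Γ := ℤ) (r := 1)
    (x := (thetaOne X : LaurentSeries ℂ) * (thetaFive X : LaurentSeries ℂ)⁻¹) (a := -2) (b := 1)
  norm_num at s1 s2 ⊢
  rw [s1, s2, h1, h2]
  norm_num

/-- For i² = -1, the squared relation and the oddness of E give E(iq)² = -E(q)², so E(iq) = ±i E(q).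
The leading term q⁻¹ selects the minus sign, as i⁻¹ = -i. -/
theorem graded_thetaOdd : Graded 4 3 thetaOdd := by
  obtain ⟨c, hc⟩ := exists_isPrimitiveRoot_units 4
  have hc2 : c ^ 2 = -1 := by
    have h2 : IsPrimitiveRoot (c ^ 2) 2 := hc.pow (by norm_num) (by norm_num)
    have := (IsPrimitiveRoot.coe_units_iff.mpr h2).eq_neg_one_of_two_right
    exact Units.ext (by simpa using this)
  have h : twist c thetaOdd ^ 2 = (HahnSeries.C (c : ℂ) * thetaOdd) ^ 2 := by
    rw [← map_pow, mul_pow, ← map_pow, ← Units.val_pow_eq_pow_val, hc2, thetaOdd_sq_eq,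
      twist_expand, hc2, map_mul, twist_neg_one_thetaOdd, twist_neg_one_expand_two]
    simp only [Units.val_neg, Units.val_one, map_neg, map_one, map_mul]
    ring
  refine (graded_iff_twist hc 3 _).mpr ?_
  have hc3 : c ^ (3 : ℤ) = -c := by
    rw [show (3 : ℤ) = ((2 + 1 : ℕ) : ℤ) by norm_num, zpow_natCast, pow_succ, hc2]
    simp
  rw [hc3]
  rcases sq_eq_sq_iff_eq_or_eq_neg.mp h with h | h
  · have := congrArg (fun f : LaurentSeries ℂ => f.coeff (-1)) h
    simp only [coeff_twist, HahnSeries.C_mul_eq_smul, HahnSeries.coeff_smul, smul_eq_mul,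
      coeff_neg_one_thetaOdd, mul_one] at this
    have h' : c ^ (-1 : ℤ) = c := Units.ext this
    rw [zpow_neg_one, _root_.inv_eq_iff_mul_eq_one, ← pow_two, hc2] at h'
    exact absurd h' (by rw [Units.ext_iff]; norm_num)
  · rw [h]
    simp

theorem graded_thetaOdd_two : Graded 2 1 thetaOdd :=
  (graded_thetaOdd.of_dvd ⟨2, by norm_num⟩).congr (by norm_num)

/-! ### Vanishing coefficients -/

/-- The coefficients of `f` vanish at all exponents congruent to `a` modulo `M`. -/
def Vanishes (M a : ℤ) (f : LaurentSeries ℂ) : Prop := ∀ n, n ≡ a [ZMOD M] → f.coeff n = 0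

theorem Graded.vanishes {M b : ℤ} {f : LaurentSeries ℂ} (h : Graded M b f) (a : ℤ)
    (hab : a % M ≠ b % M) : Vanishes M a f := fun _ hn =>
  h.coeff_eq_zero (ne_of_eq_of_ne hn hab)

namespace Vanishes

variable {M a : ℤ} {f g : LaurentSeries ℂ}

theorem add (hf : Vanishes M a f) (hg : Vanishes M a g) : Vanishes M a (f + g) := fun n hn => by
  rw [HahnSeries.coeff_add, hf n hn, hg n hn, add_zero]

theorem neg (hf : Vanishes M a f) : Vanishes M a (-f) := fun n hn => by
  rw [HahnSeries.coeff_neg, hf n hn, neg_zero]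

theorem sub (hf : Vanishes M a f) (hg : Vanishes M a g) : Vanishes M a (f - g) := fun n hn => by
  rw [HahnSeries.coeff_sub, hf n hn, hg n hn, sub_zero]

theorem restrict (hf : Vanishes M a f) {N b : ℤ} (hN : M ∣ N) (hb : b % M = a % M) :
    Vanishes N b f := fun n hn => hf n ((hn.of_dvd hN).trans hb)

theorem mul_graded (hf : Vanishes M a f) {b : ℤ} (hg : Graded M b g) :
    Vanishes M (a + b) (f * g) := fun n hn => by
  by_contra h
  obtain ⟨i, hi, j, hj, rfl⟩ := HahnSeries.support_mul_subset h
  exact hi (hf i (Int.ModEq.add_right_cancel (hg j hj) hn))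

theorem ofNat_mul (hf : Vanishes M a f) (n : ℕ) [n.AtLeastTwo] :
    Vanishes M a (OfNat.ofNat n * f) := by
  have := hf.mul_graded (graded_ofNat M n)
  rwa [add_zero, mul_comm] at this

theorem of_two_mul (hf : Vanishes M a (2 * f)) : Vanishes M a f := fun n hn => by
  have h := hf n hn
  rw [two_mul, HahnSeries.coeff_add, ← two_mul] at h
  exact (mul_eq_zero.mp h).resolve_left two_ne_zero

theorem expand (hf : Vanishes M a f) (k : ℕ) [NeZero k] :
    Vanishes (k * M) (k * a) (expand k f) := fun n hn => by
  have hk : (k : ℤ) ≠ 0 := by exact_mod_cast NeZero.ne k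
  by_cases h : (k : ℤ) ∣ n
  · obtain ⟨n, rfl⟩ := h
    rw [coeff_expand_mul]
    exact hf n (Int.ModEq.mul_left_cancel' hk hn)
  · exact coeff_expand_of_not_dvd k f h

end Vanishes

theorem vanishes_expand_two (f : LaurentSeries ℂ) : Vanishes 2 1 (expand 2 f) :=
  (graded_expand 2 f).vanishes 1 (by norm_num)

/-! ### Three-dissections -/

section Algebra

variable {F : Type*} [Field F]

/-- The terms linear in w cancel in the difference. As w⁻¹ has exponents 2 mod 3, this is why 1/h -
h has no exponent 1 mod 3. -/
theorem cubic_sub {r x w : F} (hw : w ^ 3 = x ^ 4 - 1) (hr : r * x = 1 + w) (hx : x ≠ 0)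
    (hw0 : w ≠ 0) (hd : x ^ 2 + 3 ≠ 0) (hr1 : r - 1 ≠ 0) (hr2 : r + 1 ≠ 0) :
    (r + 1) / (r - 1) - (r - 1) / (r + 1) =
      4 * x / (x ^ 2 + 3) + 4 * x * (x ^ 2 + 1) / (x ^ 2 + 3) * w⁻¹ := by
  rw [ratio_eq_cubic hw hr hx hw0 hd hr2, inv_ratio_eq_cubic hw hr hx hw0 hd hr1]
  field_simp
  ring

theorem cubic_inv {x w : F} (hw : w ^ 3 = x ^ 4 - 1) (hw0 : w ≠ 0) (he : x ^ 2 - 1 ≠ 0) :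
    (x ^ 2 + 1) / w = w ^ 2 / (x ^ 2 - 1) := by
  rw [div_eq_div_iff hw0 he]
  linear_combination -hw

theorem cubic_add {r x w : F} (hw : w ^ 3 = x ^ 4 - 1) (hr : r * x = 1 + w) (hx : x ≠ 0)
    (hw0 : w ≠ 0) (hd : x ^ 2 + 3 ≠ 0) (he : x ^ 2 - 1 ≠ 0) (hr1 : r - 1 ≠ 0) (hr2 : r + 1 ≠ 0) :
    (r + 1) / (r - 1) + (r - 1) / (r + 1) - 1 =
      (x ^ 2 - 1) / (x ^ 2 + 3) + 4 / (x ^ 2 + 3) * w +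
        4 / ((x ^ 2 - 1) * (x ^ 2 + 3)) * w ^ 2 := by
  have h := cubic_inv hw hw0 he
  rw [ratio_eq_cubic hw hr hx hw0 hd hr2, inv_ratio_eq_cubic hw hr hx hw0 hd hr1,
    mul_div_assoc, mul_div_assoc, h]
  field_simp
  ring

theorem cubic_quotient {r x w : F} (hw : w ^ 3 = x ^ 4 - 1) (hr : r * x = 1 + w) (hx : x ≠ 0)
    (hw0 : w ≠ 0) (hd : x ^ 2 + 3 ≠ 0) (he : x ^ 2 - 1 ≠ 0) (hr2 : r + 1 ≠ 0) (hx1 : x - 1 ≠ 0)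
    (hx2 : x + 1 ≠ 0) :
    (r - 1) / (r + 1) / ((x - 1) / (x + 1)) =
      (x ^ 2 - 1 + 2 * (x + 1) ^ 2 / (x ^ 2 - 1) * w - 2 * (x + 1) / (x ^ 2 - 1) * w ^ 2) /
        (x ^ 2 + 3) := by
  have h := cubic_inv hw hw0 he
  rw [ratio_eq_cubic hw hr hx hw0 hd hr2, mul_div_assoc, h,
    show x ^ 2 - 1 = (x - 1) * (x + 1) by ring]
  field_simp
  ring

theorem cubic_inv_quotient {r x w : F} (hw : w ^ 3 = x ^ 4 - 1) (hr : r * x = 1 + w) (hx : x ≠ 0)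
    (hw0 : w ≠ 0) (hd : x ^ 2 + 3 ≠ 0) (he : x ^ 2 - 1 ≠ 0) (hr1 : r - 1 ≠ 0) (hx1 : x - 1 ≠ 0)
    (hx2 : x + 1 ≠ 0) :
    (r + 1) / (r - 1) / ((x + 1) / (x - 1)) =
      (x ^ 2 - 1 + 2 * (x - 1) ^ 2 / (x ^ 2 - 1) * w + 2 * (x - 1) / (x ^ 2 - 1) * w ^ 2) /
        (x ^ 2 + 3) := by
  have h := cubic_inv hw hw0 he
  rw [inv_ratio_eq_cubic hw hr hx hw0 hd hr1, mul_div_assoc, h,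
    show x ^ 2 - 1 = (x - 1) * (x + 1) by ring]
  field_simp
  ring

theorem cubic_sq_sub {x w : F} (hw : w ^ 3 = x ^ 4 - 1) (hd : x ^ 2 + 3 ≠ 0)
    (he : x ^ 2 - 1 ≠ 0) :
    4 * x / ((x ^ 2 - 1) * (x ^ 2 + 3)) * (2 * w - w ^ 2) *
      (2 * ((x ^ 2 - 1) / (x ^ 2 + 3)) +
        4 * (x ^ 2 + 1) / ((x ^ 2 - 1) * (x ^ 2 + 3)) * w -
        4 / ((x ^ 2 - 1) * (x ^ 2 + 3)) * w ^ 2) =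
      -16 * x * (x ^ 2 + 1) / ((x ^ 2 - 1) * (x ^ 2 + 3)) +
        32 * x ^ 3 / ((x ^ 2 - 1) * (x ^ 2 + 3)) / (x ^ 2 + 3) * w +
        8 * x * (4 * (x ^ 2 + 1) - (x ^ 2 - 1) ^ 2) / ((x ^ 2 - 1) * (x ^ 2 + 3)) ^ 2 * w ^ 2 := by
  field_simp
  linear_combination (-32 - 16 * (x ^ 2 + 1) + 16 * w) * x * hw

end Algebra

theorem expand_thetaRatio_sq_add_three_ne_zero (k : ℕ) [NeZero k] :
    expand k thetaRatio ^ 2 + 3 ≠ 0 := by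
  simpa only [map_add, map_pow, map_ofNat] using
    (_root_.map_ne_zero (expand k)).mpr thetaRatio_sq_add_three_ne_zero

theorem expand_thetaRatio_sq_add_one_ne_zero (k : ℕ) [NeZero k] :
    expand k thetaRatio ^ 2 + 1 ≠ 0 := by
  simpa using (_root_.map_ne_zero (expand k)).mpr thetaRatio_sq_add_one_ne_zero

theorem expand_thetaRatio_sq_sub_one_ne_zero (k : ℕ) [NeZero k] :
    expand k thetaRatio ^ 2 - 1 ≠ 0 := by
  simpa using (_root_.map_ne_zero (expand k)).mpr thetaRatio_sq_sub_one_ne_zero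

theorem expand_thetaRatio_sub_one_ne_zero (k : ℕ) [NeZero k] : expand k thetaRatio - 1 ≠ 0 := by
  simpa using (_root_.map_ne_zero (expand k)).mpr thetaRatio_sub_one_ne_zero

theorem expand_thetaRatio_add_one_ne_zero (k : ℕ) [NeZero k] : expand k thetaRatio + 1 ≠ 0 := by
  simpa using (_root_.map_ne_zero (expand k)).mpr thetaRatio_add_one_ne_zero

theorem thetaCubic_ne_zero : thetaCubic ≠ 0 := fun h => by
  have := mul_ne_zero (expand_thetaRatio_sq_sub_one_ne_zero 3)
    (expand_thetaRatio_sq_add_one_ne_zero 3)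
  refine this ?_
  have h3 := thetaCubic_pow_three
  rw [h] at h3
  linear_combination -h3

theorem thetaRatio_mul_expand : thetaRatio * expand 3 thetaRatio = 1 + thetaCubic := by
  rw [thetaCubic]
  ring

theorem inv_slaterRatio_sub : slaterRatio⁻¹ - slaterRatio = thetaOdd + expand 2 thetaRatio := by
  rw [thetaOdd, sub_add_cancel]

theorem inv_slaterRatio_add :
    slaterRatio⁻¹ + slaterRatio = 1 + thetaOdd * expand 2 thetaRatio := by
  rw [inv_slaterRatio, slaterRatio_eq_mul]
  have h := two_ne_zero_laurent
  field_simp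
  ring

theorem thetaOdd_add_eq : thetaOdd + expand 2 thetaRatio =
    expand 3 (4 * thetaRatio / (thetaRatio ^ 2 + 3)) +
      expand 3 (4 * thetaRatio * (thetaRatio ^ 2 + 1) / (thetaRatio ^ 2 + 3)) * thetaCubic⁻¹ := by
  rw [← inv_slaterRatio_sub, slaterRatio, inv_div,
    cubic_sub thetaCubic_pow_three thetaRatio_mul_expand (expand_thetaRatio_ne_zero 3)
      thetaCubic_ne_zero (expand_thetaRatio_sq_add_three_ne_zero 3) thetaRatio_sub_one_ne_zero
      thetaRatio_add_one_ne_zero]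
  simp only [map_div₀, map_mul, map_add, map_pow, map_ofNat, map_one]

theorem thetaOdd_mul_eq : thetaOdd * expand 2 thetaRatio =
    expand 3 ((thetaRatio ^ 2 - 1) / (thetaRatio ^ 2 + 3)) +
      expand 3 (4 / (thetaRatio ^ 2 + 3)) * thetaCubic +
      expand 3 (4 / ((thetaRatio ^ 2 - 1) * (thetaRatio ^ 2 + 3))) * thetaCubic ^ 2 := by
  rw [← add_sub_cancel_left 1 (thetaOdd * expand 2 thetaRatio), ← inv_slaterRatio_add, slaterRatio,
    inv_div, cubic_add thetaCubic_pow_three thetaRatio_mul_expand (expand_thetaRatio_ne_zero 3)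
      thetaCubic_ne_zero (expand_thetaRatio_sq_add_three_ne_zero 3)
      (expand_thetaRatio_sq_sub_one_ne_zero 3) thetaRatio_sub_one_ne_zero
      thetaRatio_add_one_ne_zero]
  simp only [map_div₀, map_mul, map_add, map_sub, map_pow, map_ofNat, map_one]

theorem graded_expand_three_mul {a : ℤ} {g : LaurentSeries ℂ} (f : LaurentSeries ℂ)
    (hg : Graded 3 a g) : Graded 3 a (expand 3 f * g) := by
  simpa using Graded.mul (graded_expand 3 f) hg

theorem graded_thetaCubic_sq : Graded 3 2 (thetaCubic ^ 2) := by
  simpa using graded_thetaCubic.pow 2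

theorem graded_thetaCubic_inv : Graded 3 2 thetaCubic⁻¹ :=
  (Graded.inv (M := 3) graded_thetaCubic).congr (by norm_num)

theorem graded_expand_two_thetaCubic : Graded 3 2 (expand 2 thetaCubic) := by
  have := graded_thetaCubic.expand 2
  exact this.of_dvd ⟨2, by norm_num⟩

theorem thetaRatio_eq_add : thetaRatio =
    expand 3 thetaRatio⁻¹ + expand 3 thetaRatio⁻¹ * thetaCubic := by
  rw [map_inv₀]
  conv_lhs => rw [thetaRatio_eq]
  rw [div_eq_mul_inv]
  ring

theorem expand_two_thetaRatio_eq_add : expand 2 thetaRatio =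
    expand 3 (expand 2 thetaRatio)⁻¹ + expand 3 (expand 2 thetaRatio)⁻¹ * expand 2 thetaCubic := by
  have h := congrArg (expand 2) thetaRatio_eq_add
  rwa [map_add, map_mul, expand_comm 2 3, map_inv₀ (expand 2)] at h

theorem vanishes_thetaRatio : Vanishes 3 2 thetaRatio := by
  rw [thetaRatio_eq_add]
  exact ((graded_expand 3 _).vanishes 2 (by norm_num)).add
    ((graded_expand_three_mul _ graded_thetaCubic).vanishes 2 (by norm_num))

theorem vanishes_expand_two_thetaRatio : Vanishes 3 1 (expand 2 thetaRatio) := by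
  rw [expand_two_thetaRatio_eq_add]
  exact ((graded_expand 3 _).vanishes 1 (by norm_num)).add
    ((graded_expand_three_mul _ graded_expand_two_thetaCubic).vanishes 1 (by norm_num))

theorem vanishes_thetaOdd_add : Vanishes 3 1 (thetaOdd + expand 2 thetaRatio) := by
  rw [thetaOdd_add_eq]
  exact ((graded_expand 3 _).vanishes 1 (by norm_num)).add
    ((graded_expand_three_mul _ graded_thetaCubic_inv).vanishes 1 (by norm_num))

theorem vanishes_thetaOdd : Vanishes 3 1 thetaOdd := by
  rw [← add_sub_cancel_right thetaOdd (expand 2 thetaRatio)]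
  exact vanishes_thetaOdd_add.sub vanishes_expand_two_thetaRatio

theorem vanishes_thetaOdd_add_four : Vanishes 4 1 (thetaOdd + expand 2 thetaRatio) :=
  (graded_thetaOdd.vanishes 1 (by norm_num)).add
    ((vanishes_expand_two _).restrict ⟨2, by norm_num⟩ (by norm_num))

theorem graded_thetaOdd_mul : Graded 2 1 (thetaOdd * expand 2 thetaRatio) :=
  graded_thetaOdd_two.mul (graded_expand 2 _)

/-- The component of `thetaOdd` with exponents congruent to `2` modulo `3`. -/
theorem thetaOdd_eq_add : thetaOdd = expand 3 thetaOdd⁻¹ +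
    expand 3 (2 * (thetaOdd / (expand 2 thetaRatio ^ 2 + 3))) * expand 2 thetaCubic := by
  have hy := expand_thetaRatio_ne_zero 2
  have h1 := thetaOdd_add_eq
  rw [param_dual thetaRatio_sq_sub_one_ne_zero thetaOdd_ne_zero hy thetaOdd_add_mul
    thetaOdd_mul_mul, map_add] at h1
  -- The class 0 parts of E + y and of y are 1/E + 1/y and 1/y, both at q³. Their difference is the
  -- class 0 part of E, and b is what remains, all of class 2.
  set b := expand 3 (4 * thetaRatio * (thetaRatio ^ 2 + 1) / (thetaRatio ^ 2 + 3)) * thetaCubic⁻¹ -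
    expand 3 (expand 2 thetaRatio)⁻¹ * expand 2 thetaCubic with hb
  have gb : Graded 3 2 b := (graded_expand_three_mul _ graded_thetaCubic_inv).sub
    (graded_expand_three_mul _ graded_expand_two_thetaCubic)
  have hE : thetaOdd = expand 3 thetaOdd⁻¹ + b := by
    linear_combination h1 - expand_two_thetaRatio_eq_add
  have h2 := thetaOdd_sq_eq
  rw [thetaOdd_mul_eq] at h2
  simp only [map_add, map_mul (expand 2), expand_comm 2 3] at h2
  have gc := graded_expand_three_mul (expand 2 (4 / (thetaRatio ^ 2 + 3)))
    graded_expand_two_thetaCubic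
  have gsq : Graded 3 1 (expand 2 (thetaCubic ^ 2)) :=
    ((graded_thetaCubic_sq.expand 2).of_dvd ⟨2, by norm_num⟩).congr (by norm_num)
  have ga : Graded 3 0 (expand 3 thetaOdd⁻¹) := graded_expand 3 _
  have ga2 : Graded 3 0 (expand 3 thetaOdd⁻¹ ^ 2) := by simpa using ga.pow 2
  have gb2 : Graded 3 1 (b ^ 2) := (gb.pow 2).congr (by norm_num)
  have gab : Graded 3 2 (2 * (expand 3 thetaOdd⁻¹ * b)) := by
    simpa using Graded.mul (graded_ofNat 3 2) (graded_expand_three_mul thetaOdd⁻¹ gb)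
  -- Compare class 2 in E(q)² = (E y)(q²). On the left it is the cross term 2b/E(q³), on the right
  -- the term with w(q²); this determines b.
  have key := (Graded.eq_zero_of_add_eq_zero (ga2.sub (graded_expand 3
    (expand 2 ((thetaRatio ^ 2 - 1) / (thetaRatio ^ 2 + 3)))))
    (gb2.sub (graded_expand_three_mul
      (expand 2 (4 / ((thetaRatio ^ 2 - 1) * (thetaRatio ^ 2 + 3)))) gsq))
    (gab.sub gc) (by
      have h3 : (expand 3 thetaOdd⁻¹ + b) ^ 2 = _ := hE ▸ h2
      linear_combination h3)).2.2
  refine hE.trans (congrArg (expand 3 thetaOdd⁻¹ + ·) ?_)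
  refine mul_left_cancel₀ two_ne_zero_laurent ?_
  have hEE : expand 3 thetaOdd * expand 3 thetaOdd⁻¹ = 1 := by
    rw [← map_mul, mul_inv_cancel₀ thetaOdd_ne_zero, map_one]
  have hs : 2 * expand 3 (2 * (thetaOdd / (expand 2 thetaRatio ^ 2 + 3))) =
      expand 3 thetaOdd * expand 3 (expand 2 (4 / (thetaRatio ^ 2 + 3))) := by
    simp only [map_mul, map_div₀, map_add, map_pow, map_ofNat]
    ring
  linear_combination expand 3 thetaOdd * key - 2 * b * hEE - expand 2 thetaCubic * hs

/-! ### The first function -/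

/-- The conjugate of E(1 + y²) under q² ↦ -q² in y becomes linear in E and r: replace 1 + r(-q²)² by
4/(1 + y²), then use E(y² - 1) = (1 + y²) r - 2y. -/
theorem thetaOdd_mul_one_add_sq_eq :
    thetaOdd * (1 + expand 2 (twist (-1) thetaRatio) ^ 2) =
      2 * thetaOdd + 4 * expand 2 thetaRatio / (1 + expand 2 thetaRatio ^ 2) - 2 * thetaRatio := by
  have h := congrArg (expand 2) one_add_thetaRatio_sq_mul
  simp only [map_mul, map_add, map_one, map_pow, map_ofNat] at h
  have h1 := thetaOdd_mul_sq_sub_one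
  have hy : 1 + expand 2 thetaRatio ^ 2 ≠ 0 := by
    rw [add_comm]
    exact expand_thetaRatio_sq_add_one_ne_zero 2
  refine mul_left_cancel₀ hy ?_
  have h2 : (1 + expand 2 thetaRatio ^ 2) *
      (4 * expand 2 thetaRatio / (1 + expand 2 thetaRatio ^ 2)) = 4 * expand 2 thetaRatio :=
    mul_div_cancel₀ _ hy
  linear_combination thetaOdd * h - h2 - 2 * h1

theorem graded_thetaOdd_mul_add :
    Graded 4 3 (thetaOdd * (1 + expand 2 thetaRatio ^ 2) +
      thetaOdd * (1 + expand 2 (twist (-1) thetaRatio) ^ 2)) := by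
  have h : Graded 2 0 (thetaRatio ^ 2 + twist (-1) thetaRatio ^ 2) := by
    obtain ⟨c, hc⟩ := exists_isPrimitiveRoot_units 2
    have hc1 : c = -1 := Units.ext (by
      simpa using (IsPrimitiveRoot.coe_units_iff.mpr hc).eq_neg_one_of_two_right)
    refine (graded_iff_twist hc 0 _).mpr ?_
    rw [hc1, map_add, map_pow, map_pow, twist_neg_one_twist_neg_one, zpow_zero, Units.val_one,
      map_one, one_mul, add_comm]
  have h4 : Graded 4 0 (expand 2 (thetaRatio ^ 2 + twist (-1) thetaRatio ^ 2)) := by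
    simpa using h.expand 2
  have := graded_thetaOdd.mul ((graded_ofNat 4 2).add h4)
  rw [add_zero] at this
  rw [map_add, map_pow, map_pow] at this
  rwa [← mul_add, show 1 + expand 2 thetaRatio ^ 2 + (1 + expand 2 (twist (-1) thetaRatio) ^ 2) =
    2 + (expand 2 thetaRatio ^ 2 + expand 2 (twist (-1) thetaRatio) ^ 2) by ring]

theorem vanishes_thetaOdd_twelve : Vanishes 12 5 thetaOdd :=
  (graded_thetaOdd.vanishes 1 (by norm_num)).restrict ⟨3, by norm_num⟩ (by norm_num)

theorem vanishes_thetaRatio_twelve : Vanishes 12 5 thetaRatio :=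
  vanishes_thetaRatio.restrict ⟨4, by norm_num⟩ (by norm_num)

theorem vanishes_thetaOdd_add_twelve : Vanishes 12 5 (thetaOdd + expand 2 thetaRatio) :=
  vanishes_thetaOdd_add_four.restrict ⟨3, by norm_num⟩ (by norm_num)

/-- Added to its conjugate, it is E times a series in q⁴, absent at 5 ≡ 1 mod 4. The conjugate
itself vanishes at 5 mod 12: E by its class mod 4, r because 5 ≡ 2 mod 3, the rest because it is
even. -/
theorem vanishes_thetaOdd_mul_one_add_sq :
    Vanishes 12 5 (thetaOdd * (1 + expand 2 thetaRatio ^ 2)) := by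
  have h := (graded_thetaOdd_mul_add.vanishes 1 (by norm_num)).restrict (N := 12) (b := 5)
    ⟨3, by norm_num⟩ (by norm_num)
  have h' : Vanishes 12 5 (thetaOdd * (1 + expand 2 (twist (-1) thetaRatio) ^ 2)) := by
    rw [thetaOdd_mul_one_add_sq_eq]
    refine ((vanishes_thetaOdd_twelve.ofNat_mul 2).add ?_).sub
      (vanishes_thetaRatio_twelve.ofNat_mul 2)
    have := vanishes_expand_two (4 * thetaRatio / (1 + thetaRatio ^ 2))
    simp only [map_div₀, map_mul, map_add, map_one, map_pow, map_ofNat] at this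
    exact this.restrict ⟨6, by norm_num⟩ (by norm_num)
  simpa using h.sub h'

theorem thetaOdd_mul_mul_sub_one :
    thetaRatio * (thetaOdd * expand 2 thetaRatio - 1) = thetaOdd + expand 2 thetaRatio := by
  refine mul_right_cancel₀ thetaRatio_sq_sub_one_ne_zero ?_
  linear_combination thetaRatio * thetaOdd_mul_mul - thetaOdd_add_mul

/-- The function `r(q²) E(q)²` is a function of `q²`. -/
theorem expand_mul_thetaOdd_sq : expand 2 thetaRatio * thetaOdd ^ 2 =
    expand 2 (thetaRatio + (thetaOdd + expand 2 thetaRatio)) := by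
  rw [thetaOdd_sq_eq, ← map_mul, ← thetaOdd_mul_mul_sub_one]
  congr 1
  ring

theorem graded_thetaOdd_mul_one_add_sq :
    Graded 2 1 (thetaOdd * (1 + expand 2 thetaRatio ^ 2)) := by
  have h := graded_thetaOdd_two.mul (graded_expand 2 (1 + thetaRatio ^ 2))
  rwa [map_add, map_one, map_pow] at h

theorem vanishes_ratio_add : Vanishes 12 5 (thetaRatio + (thetaOdd + expand 2 thetaRatio)) :=
  vanishes_thetaRatio_twelve.add vanishes_thetaOdd_add_twelve

theorem expand_add_mul_thetaOdd_sq : expand 2 thetaRatio * (1 + thetaOdd ^ 2) =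
    expand 2 (thetaRatio + (thetaRatio + (thetaOdd + expand 2 thetaRatio))) := by
  rw [map_add, ← expand_mul_thetaOdd_sq]
  ring

theorem vanishes_expand_mul_thetaOdd_sq_of_even :
    Vanishes 24 10 (expand 2 thetaRatio * thetaOdd ^ 2) := by
  rw [expand_mul_thetaOdd_sq]
  exact vanishes_ratio_add.expand 2

theorem vanishes_expand_mul_thetaOdd_sq_of_odd :
    Vanishes 2 1 (expand 2 thetaRatio * thetaOdd ^ 2) := by
  rw [expand_mul_thetaOdd_sq]
  exact vanishes_expand_two _

theorem vanishes_add_mul_of_even :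
    Vanishes 24 10 (expand 2 thetaRatio * (1 + thetaOdd ^ 2)) := by
  rw [expand_add_mul_thetaOdd_sq]
  exact (vanishes_thetaRatio_twelve.add vanishes_ratio_add).expand 2

theorem vanishes_add_mul_of_odd :
    Vanishes 2 1 (expand 2 thetaRatio * (1 + thetaOdd ^ 2)) := by
  rw [expand_add_mul_thetaOdd_sq]
  exact vanishes_expand_two _

theorem sq_sub_inv_sq {F : Type*} [Field F] (g : F) :
    g ^ 2 - (g ^ 2)⁻¹ = (g - g⁻¹) * (g + g⁻¹) := by
  ring

theorem vanishes_inv_add :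
    Vanishes 2 0 (slaterRatio⁻¹ + slaterRatio⁻¹⁻¹ - 1) := by
  rw [inv_inv, inv_slaterRatio_add, add_sub_cancel_left]
  exact graded_thetaOdd_mul.vanishes 0 (by norm_num)

theorem vanishes_inv_sub_four : Vanishes 4 1 (slaterRatio⁻¹ - slaterRatio⁻¹⁻¹) := by
  rw [inv_inv, inv_slaterRatio_sub]
  exact vanishes_thetaOdd_add_four

theorem vanishes_inv_sub_three : Vanishes 3 1 (slaterRatio⁻¹ - slaterRatio⁻¹⁻¹) := by
  rw [inv_inv, inv_slaterRatio_sub]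
  exact vanishes_thetaOdd_add

/-- Expanding (E + y)(1 + E y) separates the odd part E(1 + y²) from the even part y(1 + E²); each
of the two progressions sees only one of them. -/
theorem inv_sq_sub : slaterRatio⁻¹ ^ 2 - (slaterRatio⁻¹ ^ 2)⁻¹ =
    thetaOdd * (1 + expand 2 thetaRatio ^ 2) + expand 2 thetaRatio * (1 + thetaOdd ^ 2) := by
  rw [sq_sub_inv_sq, inv_inv, inv_slaterRatio_sub, inv_slaterRatio_add]
  ring

theorem vanishes_inv_sq_sub_of_odd :
    Vanishes 12 5 (slaterRatio⁻¹ ^ 2 - (slaterRatio⁻¹ ^ 2)⁻¹) := by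
  rw [inv_sq_sub]
  exact vanishes_thetaOdd_mul_one_add_sq.add
    (vanishes_add_mul_of_odd.restrict ⟨6, by norm_num⟩ (by norm_num))

theorem vanishes_inv_sq_sub_of_even :
    Vanishes 24 10 (slaterRatio⁻¹ ^ 2 - (slaterRatio⁻¹ ^ 2)⁻¹) := by
  rw [inv_sq_sub]
  exact ((graded_thetaOdd_mul_one_add_sq.vanishes 0 (by norm_num)).restrict
    ⟨12, by norm_num⟩ (by norm_num)).add vanishes_add_mul_of_even

/-! ### The functions of level two -/

section Algebra

variable {F : Type*} [Field F] {y e : F}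

theorem param_two_div (h0 : (2 : F) ≠ 0) (hy1 : y - 1 ≠ 0) (hy2 : y + 1 ≠ 0) :
    (1 - e) * (1 - y) / 2 / ((y - 1) / (y + 1)) = (e - 1) * (y + 1) / 2 := by
  field_simp
  ring

theorem param_two_inv (h0 : (2 : F) ≠ 0) (hy1 : y - 1 ≠ 0) (hy2 : y + 1 ≠ 0) :
    (1 + e) * (1 + y) / 2 * ((y - 1) / (y + 1)) = (e + 1) * (y - 1) / 2 := by
  field_simp
  ring

theorem param_two_add (h0 : (2 : F) ≠ 0) (hy1 : y - 1 ≠ 0) (hy2 : y + 1 ≠ 0)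
    (h : (e ^ 2 - 1) * (y ^ 2 - 1) = 4) :
    (1 + e) * (1 + y) / 2 / ((y - 1) / (y + 1)) + (1 - e) * (1 - y) / 2 * ((y - 1) / (y + 1)) =
      e ^ 3 * y + 2 + e ^ 2 := by
  have hy : y ^ 2 - 1 ≠ 0 := by
    rw [show y ^ 2 - 1 = (y - 1) * (y + 1) by ring]
    exact mul_ne_zero hy1 hy2
  field_simp
  linear_combination -2 * (1 + e * y) * h

theorem param_two_sub (h0 : (2 : F) ≠ 0) (hy1 : y - 1 ≠ 0) (hy2 : y + 1 ≠ 0)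
    (h : (e ^ 2 - 1) * (y ^ 2 - 1) = 4) :
    (1 + e) * (1 + y) / 2 / ((y - 1) / (y + 1)) - (1 - e) * (1 - y) / 2 * ((y - 1) / (y + 1)) =
      2 * e + e ^ 3 + y * e ^ 2 := by
  field_simp
  linear_combination -2 * (e + y) * h

end Algebra

theorem expand_slaterRatio (k : ℕ) [NeZero k] :
    expand k slaterRatio = (expand k thetaRatio - 1) / (expand k thetaRatio + 1) := by
  rw [slaterRatio, map_div₀, map_sub, map_add, map_one]

theorem slaterRatio_div_expand_two : slaterRatio / expand 2 slaterRatio =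
    (thetaOdd - 1) * (expand 2 thetaRatio + 1) / 2 := by
  rw [expand_slaterRatio, slaterRatio_eq_mul]
  exact param_two_div two_ne_zero_laurent (expand_thetaRatio_sub_one_ne_zero 2)
    (expand_thetaRatio_add_one_ne_zero 2)

theorem inv_slaterRatio_div_expand_two : (slaterRatio / expand 2 slaterRatio)⁻¹ =
    (thetaOdd + 1) * (expand 2 thetaRatio - 1) / 2 := by
  rw [inv_div, div_eq_mul_inv, mul_comm, inv_slaterRatio, expand_slaterRatio]
  exact param_two_inv two_ne_zero_laurent (expand_thetaRatio_sub_one_ne_zero 2)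
    (expand_thetaRatio_add_one_ne_zero 2)

theorem level_two_add : slaterRatio / expand 2 slaterRatio +
    (slaterRatio / expand 2 slaterRatio)⁻¹ = thetaOdd * expand 2 thetaRatio - 1 := by
  rw [inv_slaterRatio_div_expand_two, slaterRatio_div_expand_two, ← add_div,
    div_eq_iff two_ne_zero_laurent]
  ring

/-- Up to sign, the sum and difference here are those of level one with y replaced by -y, so the
same vanishing facts settle both levels. -/
theorem level_two_sub : slaterRatio / expand 2 slaterRatio -
    (slaterRatio / expand 2 slaterRatio)⁻¹ = thetaOdd - expand 2 thetaRatio := by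
  rw [inv_slaterRatio_div_expand_two, slaterRatio_div_expand_two, ← sub_div,
    div_eq_iff two_ne_zero_laurent]
  ring

theorem level_two_sq_sub : (slaterRatio / expand 2 slaterRatio) ^ 2 -
    ((slaterRatio / expand 2 slaterRatio) ^ 2)⁻¹ =
      expand 2 thetaRatio * (1 + thetaOdd ^ 2) - thetaOdd * (1 + expand 2 thetaRatio ^ 2) := by
  rw [sq_sub_inv_sq, level_two_add, level_two_sub]
  ring

theorem vanishes_level_two_add : Vanishes 2 0 (slaterRatio / expand 2 slaterRatio +
    (slaterRatio / expand 2 slaterRatio)⁻¹ + 1) := by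
  rw [level_two_add, sub_add_cancel]
  exact graded_thetaOdd_mul.vanishes 0 (by norm_num)

theorem vanishes_level_two_sub_four : Vanishes 4 1 (slaterRatio / expand 2 slaterRatio -
    (slaterRatio / expand 2 slaterRatio)⁻¹) := by
  rw [level_two_sub]
  exact (graded_thetaOdd.vanishes 1 (by norm_num)).sub
    ((vanishes_expand_two _).restrict ⟨2, by norm_num⟩ (by norm_num))

theorem vanishes_level_two_sub_three : Vanishes 3 1 (slaterRatio / expand 2 slaterRatio -
    (slaterRatio / expand 2 slaterRatio)⁻¹) := by
  rw [level_two_sub]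
  exact vanishes_thetaOdd.sub vanishes_expand_two_thetaRatio

theorem vanishes_level_two_sq_sub_of_odd : Vanishes 12 5
    ((slaterRatio / expand 2 slaterRatio) ^ 2 -
      ((slaterRatio / expand 2 slaterRatio) ^ 2)⁻¹) := by
  rw [level_two_sq_sub]
  exact (vanishes_add_mul_of_odd.restrict ⟨6, by norm_num⟩ (by norm_num)).sub
    vanishes_thetaOdd_mul_one_add_sq

theorem vanishes_level_two_sq_sub_of_even : Vanishes 24 10
    ((slaterRatio / expand 2 slaterRatio) ^ 2 -
      ((slaterRatio / expand 2 slaterRatio) ^ 2)⁻¹) := by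
  rw [level_two_sq_sub]
  exact vanishes_add_mul_of_even.sub ((graded_thetaOdd_mul_one_add_sq.vanishes 0
    (by norm_num)).restrict ⟨12, by norm_num⟩ (by norm_num))

/-! ### The product h(q)h(q²), for ξ_4 -/

theorem product_add : (slaterRatio * expand 2 slaterRatio)⁻¹ +
    (slaterRatio * expand 2 slaterRatio)⁻¹⁻¹ =
      thetaOdd ^ 3 * expand 2 thetaRatio + 2 + thetaOdd ^ 2 := by
  have h := param_two_add two_ne_zero_laurent (expand_thetaRatio_sub_one_ne_zero 2)
    (expand_thetaRatio_add_one_ne_zero 2) thetaOdd_sq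
  rwa [← inv_slaterRatio, ← slaterRatio_eq_mul, ← expand_slaterRatio, div_eq_mul_inv,
    ← mul_inv, ← inv_inv (slaterRatio * expand 2 slaterRatio), inv_inv _⁻¹] at h

theorem product_sub : (slaterRatio * expand 2 slaterRatio)⁻¹ -
    (slaterRatio * expand 2 slaterRatio)⁻¹⁻¹ =
      2 * thetaOdd + thetaOdd ^ 3 + expand 2 thetaRatio * thetaOdd ^ 2 := by
  have h := param_two_sub two_ne_zero_laurent (expand_thetaRatio_sub_one_ne_zero 2)
    (expand_thetaRatio_add_one_ne_zero 2) thetaOdd_sq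
  rwa [← inv_slaterRatio, ← slaterRatio_eq_mul, ← expand_slaterRatio, div_eq_mul_inv,
    ← mul_inv, ← inv_inv (slaterRatio * expand 2 slaterRatio), inv_inv _⁻¹] at h

theorem graded_thetaOdd_pow_three : Graded 4 1 (thetaOdd ^ 3) :=
  (graded_thetaOdd.pow 3).congr (by norm_num)

theorem vanishes_product_add : Vanishes 4 0 ((slaterRatio * expand 2 slaterRatio)⁻¹ +
    (slaterRatio * expand 2 slaterRatio)⁻¹⁻¹ - 2) := by
  rw [product_add, show thetaOdd ^ 3 * expand 2 thetaRatio + 2 + thetaOdd ^ 2 - 2 =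
    thetaOdd ^ 3 * expand 2 thetaRatio + thetaOdd ^ 2 by ring]
  have h := ((graded_thetaOdd_two.pow 3).mul (graded_expand 2 thetaRatio)).vanishes 0 (by norm_num)
  exact (h.restrict ⟨2, by norm_num⟩ (by norm_num)).add
    ((graded_thetaOdd.pow 2).vanishes 0 (by norm_num))

theorem vanishes_product_sub_of_even : Vanishes 24 10 ((slaterRatio * expand 2 slaterRatio)⁻¹ -
    (slaterRatio * expand 2 slaterRatio)⁻¹⁻¹) := by
  rw [product_sub]
  have h1 : Vanishes 24 10 thetaOdd :=
    (graded_thetaOdd.vanishes 2 (by norm_num)).restrict ⟨6, by norm_num⟩ (by norm_num)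
  have h2 : Vanishes 24 10 (thetaOdd ^ 3) :=
    (graded_thetaOdd_pow_three.vanishes 2 (by norm_num)).restrict ⟨6, by norm_num⟩ (by norm_num)
  exact ((h1.ofNat_mul 2).add h2).add vanishes_expand_mul_thetaOdd_sq_of_even

theorem vanishes_product_sub_twelve : Vanishes 12 7 ((slaterRatio * expand 2 slaterRatio)⁻¹ -
    (slaterRatio * expand 2 slaterRatio)⁻¹⁻¹) := by
  rw [product_sub]
  have h1 : Vanishes 12 7 thetaOdd :=
    vanishes_thetaOdd.restrict ⟨4, by norm_num⟩ (by norm_num)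
  have h2 : Vanishes 12 7 (thetaOdd ^ 3) :=
    (graded_thetaOdd_pow_three.vanishes 3 (by norm_num)).restrict ⟨3, by norm_num⟩ (by norm_num)
  exact ((h1.ofNat_mul 2).add h2).add
    (vanishes_expand_mul_thetaOdd_sq_of_odd.restrict ⟨6, by norm_num⟩ (by norm_num))

/-- Cubing the dissection E = a + b, the class 0 part is a³ + b³, which `param_cube` identifies with
E(q³). -/
theorem vanishes_thetaOdd_pow_three_sub : Vanishes 3 0 (thetaOdd ^ 3 - expand 3 thetaOdd) := by
  have h := thetaOdd_eq_add
  set b := expand 3 (2 * (thetaOdd / (expand 2 thetaRatio ^ 2 + 3))) * expand 2 thetaCubic with hb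
  have gb : Graded 3 2 b := graded_expand_three_mul _ graded_expand_two_thetaCubic
  have hw := congrArg (expand 2) thetaCubic_pow_three
  rw [map_sub, map_one, map_pow, map_pow, expand_comm 2 3] at hw
  have hc := congrArg (expand 3) (param_cube thetaOdd_ne_zero
    (expand_thetaRatio_sq_add_three_ne_zero 2) thetaOdd_sq)
  have hb3 : expand 3 thetaOdd⁻¹ ^ 3 + b ^ 3 = expand 3 thetaOdd := by
    rw [← hc, hb, mul_pow, hw]
    simp only [map_add, map_mul, map_sub, map_pow, map_one, map_ofNat]
    ring
  have e : thetaOdd ^ 3 - expand 3 thetaOdd =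
      expand 3 (3 * thetaOdd⁻¹ ^ 2) * b + expand 3 (3 * thetaOdd⁻¹) * b ^ 2 := by
    rw [← hb3]
    have h3 : thetaOdd ^ 3 = (expand 3 thetaOdd⁻¹ + b) ^ 3 := congrArg (· ^ 3) h
    simp only [map_mul, map_pow, map_ofNat]
    linear_combination h3
  rw [e]
  exact ((graded_expand_three_mul _ gb).vanishes 0 (by norm_num)).add
    ((graded_expand_three_mul _ (gb.pow 2)).vanishes 0 (by norm_num))

/-- At 21 mod 36: E is absent since 21 ≡ 1 mod 4, y E² since 21 is odd, and E³ reduces to E(q³),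
where 21 = 3·7 and E has no exponent 7 ≡ 1 mod 3. -/
theorem vanishes_product_sub_thirtysix : Vanishes 36 21 ((slaterRatio * expand 2 slaterRatio)⁻¹ -
    (slaterRatio * expand 2 slaterRatio)⁻¹⁻¹) := by
  rw [product_sub]
  have h1 : Vanishes 36 21 thetaOdd :=
    (graded_thetaOdd.vanishes 1 (by norm_num)).restrict ⟨9, by norm_num⟩ (by norm_num)
  have h2 : Vanishes 36 21 (thetaOdd ^ 3) := by
    rw [← sub_add_cancel (thetaOdd ^ 3) (expand 3 thetaOdd)]
    exact (vanishes_thetaOdd_pow_three_sub.restrict ⟨12, by norm_num⟩ (by norm_num)).add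
      ((vanishes_thetaOdd.expand 3).restrict ⟨4, by norm_num⟩ (by norm_num))
  exact ((h1.ofNat_mul 2).add h2).add
    (vanishes_expand_mul_thetaOdd_sq_of_odd.restrict ⟨18, by norm_num⟩ (by norm_num))

/-! ### The function of level three -/

theorem slaterRatio_div_expand_three : slaterRatio / expand 3 slaterRatio =
    (expand 3 thetaRatio ^ 2 - 1 +
      2 * (expand 3 thetaRatio + 1) ^ 2 / (expand 3 thetaRatio ^ 2 - 1) * thetaCubic -
      2 * (expand 3 thetaRatio + 1) / (expand 3 thetaRatio ^ 2 - 1) * thetaCubic ^ 2) /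
        (expand 3 thetaRatio ^ 2 + 3) := by
  rw [expand_slaterRatio, slaterRatio]
  exact cubic_quotient thetaCubic_pow_three thetaRatio_mul_expand (expand_thetaRatio_ne_zero 3)
    thetaCubic_ne_zero (expand_thetaRatio_sq_add_three_ne_zero 3)
    (expand_thetaRatio_sq_sub_one_ne_zero 3) thetaRatio_add_one_ne_zero
    (expand_thetaRatio_sub_one_ne_zero 3) (expand_thetaRatio_add_one_ne_zero 3)

theorem inv_slaterRatio_div_expand_three : (slaterRatio / expand 3 slaterRatio)⁻¹ =
    (expand 3 thetaRatio ^ 2 - 1 +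
      2 * (expand 3 thetaRatio - 1) ^ 2 / (expand 3 thetaRatio ^ 2 - 1) * thetaCubic +
      2 * (expand 3 thetaRatio - 1) / (expand 3 thetaRatio ^ 2 - 1) * thetaCubic ^ 2) /
        (expand 3 thetaRatio ^ 2 + 3) := by
  have h := cubic_inv_quotient thetaCubic_pow_three thetaRatio_mul_expand
    (expand_thetaRatio_ne_zero 3) thetaCubic_ne_zero (expand_thetaRatio_sq_add_three_ne_zero 3)
    (expand_thetaRatio_sq_sub_one_ne_zero 3) thetaRatio_sub_one_ne_zero
    (expand_thetaRatio_sub_one_ne_zero 3) (expand_thetaRatio_add_one_ne_zero 3)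
  rw [← h, expand_slaterRatio, slaterRatio, inv_div, ← inv_div_inv, inv_div, inv_div]

theorem level_three_sub_eq : slaterRatio / expand 3 slaterRatio -
    (slaterRatio / expand 3 slaterRatio)⁻¹ =
      4 * expand 3 thetaRatio / ((expand 3 thetaRatio ^ 2 - 1) * (expand 3 thetaRatio ^ 2 + 3)) *
        (2 * thetaCubic - thetaCubic ^ 2) := by
  have he := expand_thetaRatio_sq_sub_one_ne_zero 3
  have hd := expand_thetaRatio_sq_add_three_ne_zero 3
  rw [inv_slaterRatio_div_expand_three, slaterRatio_div_expand_three]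
  generalize expand 3 thetaRatio = x at *
  generalize thetaCubic = w at *
  field_simp
  ring

theorem level_three_add_eq : slaterRatio / expand 3 slaterRatio +
    (slaterRatio / expand 3 slaterRatio)⁻¹ =
      2 * ((expand 3 thetaRatio ^ 2 - 1) / (expand 3 thetaRatio ^ 2 + 3)) +
        4 * (expand 3 thetaRatio ^ 2 + 1) /
          ((expand 3 thetaRatio ^ 2 - 1) * (expand 3 thetaRatio ^ 2 + 3)) * thetaCubic -
        4 / ((expand 3 thetaRatio ^ 2 - 1) * (expand 3 thetaRatio ^ 2 + 3)) * thetaCubic ^ 2 := by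
  have he := expand_thetaRatio_sq_sub_one_ne_zero 3
  have hd := expand_thetaRatio_sq_add_three_ne_zero 3
  rw [inv_slaterRatio_div_expand_three, slaterRatio_div_expand_three]
  generalize expand 3 thetaRatio = x at *
  generalize thetaCubic = w at *
  field_simp
  ring

/-- The components modulo `3` of an odd function are odd. -/
theorem Graded.of_components {f g h : LaurentSeries ℂ} (hf : Graded 3 0 f) (hg : Graded 3 1 g)
    (hh : Graded 3 2 h) (hs : Graded 2 1 (f + g + h)) :
    Graded 2 1 f ∧ Graded 2 1 g ∧ Graded 2 1 h := by
  simp only [graded_two_iff, map_add] at hs ⊢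
  have := Graded.eq_zero_of_add_eq_zero ((hf.twist (-1)).add hf) ((hg.twist (-1)).add hg)
    ((hh.twist (-1)).add hh) (by linear_combination hs)
  exact ⟨eq_neg_of_add_eq_zero_left this.1, eq_neg_of_add_eq_zero_left this.2.1,
    eq_neg_of_add_eq_zero_left this.2.2⟩

/-- E y is odd, and q ↦ -q preserves residues mod 3, so every term of its 3-dissection is odd
separately. -/
theorem graded_components :
    Graded 2 1 (expand 3 ((thetaRatio ^ 2 - 1) / (thetaRatio ^ 2 + 3))) ∧
    Graded 2 1 (expand 3 (4 / (thetaRatio ^ 2 + 3)) * thetaCubic) ∧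
    Graded 2 1 (expand 3 (4 / ((thetaRatio ^ 2 - 1) * (thetaRatio ^ 2 + 3))) * thetaCubic ^ 2) :=
  Graded.of_components (graded_expand 3 _) (graded_expand_three_mul _ graded_thetaCubic)
    (graded_expand_three_mul _ graded_thetaCubic_sq) (thetaOdd_mul_eq ▸ graded_thetaOdd_mul)

theorem level_three_sub : slaterRatio / expand 3 slaterRatio -
    (slaterRatio / expand 3 slaterRatio)⁻¹ =
      expand 3 (8 * thetaRatio / ((thetaRatio ^ 2 - 1) * (thetaRatio ^ 2 + 3))) * thetaCubic -
      expand 3 (4 * thetaRatio / ((thetaRatio ^ 2 - 1) * (thetaRatio ^ 2 + 3))) *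
        thetaCubic ^ 2 := by
  rw [level_three_sub_eq]
  simp only [map_div₀, map_mul, map_add, map_sub, map_pow, map_ofNat, map_one]
  ring

theorem level_three_add : slaterRatio / expand 3 slaterRatio +
    (slaterRatio / expand 3 slaterRatio)⁻¹ =
      2 * expand 3 ((thetaRatio ^ 2 - 1) / (thetaRatio ^ 2 + 3)) +
      expand 3 (4 * (thetaRatio ^ 2 + 1) / ((thetaRatio ^ 2 - 1) * (thetaRatio ^ 2 + 3))) *
        thetaCubic -
      expand 3 (4 / ((thetaRatio ^ 2 - 1) * (thetaRatio ^ 2 + 3))) * thetaCubic ^ 2 := by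
  rw [level_three_add_eq]
  simp only [map_div₀, map_mul, map_add, map_sub, map_pow, map_ofNat, map_one]

theorem level_three_sq_sub : (slaterRatio / expand 3 slaterRatio) ^ 2 -
    ((slaterRatio / expand 3 slaterRatio) ^ 2)⁻¹ =
      expand 3 (-2 * (thetaOdd + expand 2 thetaRatio + thetaOdd⁻¹ + (expand 2 thetaRatio)⁻¹)) +
      expand 3 ((2 * (thetaOdd + 3 * thetaOdd⁻¹) +
        2 * (expand 2 thetaRatio + 3 * (expand 2 thetaRatio)⁻¹)) / (thetaRatio ^ 2 + 3)) *
          thetaCubic +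
      expand 3 (8 * thetaRatio * (4 * (thetaRatio ^ 2 + 1) - (thetaRatio ^ 2 - 1) ^ 2) /
        ((thetaRatio ^ 2 - 1) * (thetaRatio ^ 2 + 3)) ^ 2) * thetaCubic ^ 2 := by
  rw [sq_sub_inv_sq, level_three_sub_eq, level_three_add_eq,
    cubic_sq_sub thetaCubic_pow_three (expand_thetaRatio_sq_add_three_ne_zero 3)
      (expand_thetaRatio_sq_sub_one_ne_zero 3),
    ← param_sum thetaRatio_sq_sub_one_ne_zero thetaRatio_sq_add_three_ne_zero thetaOdd_ne_zero
      (expand_thetaRatio_ne_zero 2) thetaOdd_add_mul thetaOdd_mul_mul,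
    ← param_three_sum thetaRatio_sq_sub_one_ne_zero thetaRatio_sq_add_three_ne_zero
      thetaOdd_ne_zero (expand_thetaRatio_ne_zero 2) thetaOdd_add_mul thetaOdd_mul_mul]
  simp only [map_div₀, map_mul, map_add, map_sub, map_neg, map_pow, map_ofNat, map_one]

theorem vanishes_level_three_sub : Vanishes 3 0 (slaterRatio / expand 3 slaterRatio -
    (slaterRatio / expand 3 slaterRatio)⁻¹) := by
  rw [level_three_sub]
  exact ((graded_expand_three_mul _ graded_thetaCubic).vanishes 0 (by norm_num)).sub
    ((graded_expand_three_mul _ graded_thetaCubic_sq).vanishes 0 (by norm_num))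

/-- Adding E + y cancels the w² terms once w⁻¹ is rewritten by `cubic_inv`, leaving no exponent 2
mod 3; and E + y itself vanishes at 5 ≡ 1 mod 4. -/
theorem vanishes_level_three_sub_twelve : Vanishes 12 5 (slaterRatio / expand 3 slaterRatio -
    (slaterRatio / expand 3 slaterRatio)⁻¹) := by
  have h : (thetaOdd + expand 2 thetaRatio) + (slaterRatio / expand 3 slaterRatio -
      (slaterRatio / expand 3 slaterRatio)⁻¹) =
      expand 3 (4 * thetaRatio / (thetaRatio ^ 2 + 3)) +
      expand 3 (8 * thetaRatio / ((thetaRatio ^ 2 - 1) * (thetaRatio ^ 2 + 3))) * thetaCubic := by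
    have hi := cubic_inv thetaCubic_pow_three thetaCubic_ne_zero
      (expand_thetaRatio_sq_sub_one_ne_zero 3)
    have he := expand_thetaRatio_sq_sub_one_ne_zero 3
    have hd := expand_thetaRatio_sq_add_three_ne_zero 3
    rw [thetaOdd_add_eq, level_three_sub]
    simp only [map_div₀, map_mul, map_add, map_sub, map_pow, map_ofNat, map_one]
    have e : 4 * expand 3 thetaRatio * (expand 3 thetaRatio ^ 2 + 1) /
        (expand 3 thetaRatio ^ 2 + 3) * thetaCubic⁻¹ = 4 * expand 3 thetaRatio /
        (expand 3 thetaRatio ^ 2 + 3) * ((expand 3 thetaRatio ^ 2 + 1) / thetaCubic) := by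
      ring
    rw [e, hi]
    generalize expand 3 thetaRatio = x at *
    generalize thetaCubic = w at *
    field_simp
    ring
  rw [← add_sub_cancel_left (thetaOdd + expand 2 thetaRatio) (slaterRatio / _ - _), h]
  have h3 : Vanishes 3 2 (expand 3 (4 * thetaRatio / (thetaRatio ^ 2 + 3)) +
      expand 3 (8 * thetaRatio / ((thetaRatio ^ 2 - 1) * (thetaRatio ^ 2 + 3))) * thetaCubic) :=
    ((graded_expand 3 _).vanishes 2 (by norm_num)).add
      ((graded_expand_three_mul _ graded_thetaCubic).vanishes 2 (by norm_num))
  exact (h3.restrict ⟨4, by norm_num⟩ (by norm_num)).sub vanishes_thetaOdd_add_twelve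

theorem vanishes_level_three_add_zero : Vanishes 6 0 (slaterRatio / expand 3 slaterRatio +
    (slaterRatio / expand 3 slaterRatio)⁻¹) := by
  rw [level_three_add]
  refine Vanishes.sub (Vanishes.add (Vanishes.ofNat_mul ?_ 2) ?_) ?_
  · exact (graded_components.1.vanishes 0 (by norm_num)).restrict ⟨3, by norm_num⟩ (by norm_num)
  · exact ((graded_expand_three_mul _ graded_thetaCubic).vanishes 0 (by norm_num)).restrict
      ⟨2, by norm_num⟩ (by norm_num)
  · exact ((graded_expand_three_mul _ graded_thetaCubic_sq).vanishes 0 (by norm_num)).restrict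
      ⟨2, by norm_num⟩ (by norm_num)

theorem vanishes_level_three_add_two : Vanishes 6 2 (slaterRatio / expand 3 slaterRatio +
    (slaterRatio / expand 3 slaterRatio)⁻¹) := by
  rw [level_three_add]
  refine Vanishes.sub (Vanishes.add (Vanishes.ofNat_mul ?_ 2) ?_) ?_
  · exact ((graded_expand 3 _).vanishes 2 (by norm_num)).restrict ⟨2, by norm_num⟩ (by norm_num)
  · exact ((graded_expand_three_mul _ graded_thetaCubic).vanishes 2 (by norm_num)).restrict
      ⟨2, by norm_num⟩ (by norm_num)
  · exact (graded_components.2.2.vanishes 0 (by norm_num)).restrict ⟨3, by norm_num⟩ (by norm_num)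

/-- Only the class 0 component matters. Since 21 = 3·7, it suffices that E, y, 1/E and 1/y vanish at
7 mod 12: E by its class mod 3, 1/E by its class mod 4, the other two by parity. -/
theorem vanishes_level_three_sq_sub_of_odd : Vanishes 36 21
    ((slaterRatio / expand 3 slaterRatio) ^ 2 -
      ((slaterRatio / expand 3 slaterRatio) ^ 2)⁻¹) := by
  rw [level_three_sq_sub]
  refine Vanishes.add (Vanishes.add ?_ ?_) ?_
  · have h1 : Vanishes 12 7 thetaOdd :=
      vanishes_thetaOdd.restrict ⟨4, by norm_num⟩ (by norm_num)
    have h2 : Vanishes 12 7 (expand 2 thetaRatio) :=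
      (vanishes_expand_two _).restrict ⟨6, by norm_num⟩ (by norm_num)
    have h3 : Vanishes 12 7 thetaOdd⁻¹ :=
      ((Graded.inv (M := 4) graded_thetaOdd).vanishes 3 (by norm_num)).restrict
        ⟨3, by norm_num⟩ (by norm_num)
    have h4 : Vanishes 12 7 (expand 2 thetaRatio)⁻¹ := by
      rw [← map_inv₀]
      exact (vanishes_expand_two _).restrict ⟨6, by norm_num⟩ (by norm_num)
    rw [show -2 * (thetaOdd + expand 2 thetaRatio + thetaOdd⁻¹ + (expand 2 thetaRatio)⁻¹) =
      -(2 * (thetaOdd + expand 2 thetaRatio + thetaOdd⁻¹ + (expand 2 thetaRatio)⁻¹)) by ring]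
    exact ((((h1.add h2).add h3).add h4).ofNat_mul 2).neg.expand 3
  · exact ((graded_expand_three_mul _ graded_thetaCubic).vanishes 0 (by norm_num)).restrict
      ⟨12, by norm_num⟩ (by norm_num)
  · exact ((graded_expand_three_mul _ graded_thetaCubic_sq).vanishes 0 (by norm_num)).restrict
      ⟨12, by norm_num⟩ (by norm_num)

/-- Half of the class 1 component of the squared level-three difference is the class 2 component of
E + y at q². The proof computes that component also from the dissections of E and y, then compares
coefficients by `param_level_six`. -/
theorem level_six : expand 3 (2 * (thetaOdd + 3 * thetaOdd⁻¹) / (thetaRatio ^ 2 + 3)) * thetaCubic =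
    expand 2 (expand 3 (4 * thetaRatio * (thetaRatio ^ 2 + 1) / (thetaRatio ^ 2 + 3)) *
      thetaCubic⁻¹) := by
  have hy := expand_thetaRatio_ne_zero 2
  have hw := thetaCubic_ne_zero
  have h := congrArg (expand 3) (param_level_six thetaRatio_sq_sub_one_ne_zero thetaOdd_ne_zero hy
    (expand_thetaRatio_sq_add_three_ne_zero 2) two_ne_zero_laurent thetaOdd_add_mul
    thetaOdd_mul_mul)
  have h1 := thetaOdd_add_eq
  rw [param_dual thetaRatio_sq_sub_one_ne_zero thetaOdd_ne_zero hy thetaOdd_add_mul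
    thetaOdd_mul_mul, map_add] at h1
  have hb : expand 3 (4 * thetaRatio * (thetaRatio ^ 2 + 1) / (thetaRatio ^ 2 + 3)) * thetaCubic⁻¹ =
      expand 2 thetaCubic *
        expand 3 (2 * (thetaOdd / (expand 2 thetaRatio ^ 2 + 3)) + (expand 2 thetaRatio)⁻¹) := by
    rw [map_add]
    linear_combination thetaOdd_eq_add + expand_two_thetaRatio_eq_add - h1
  have hβ : expand 2 (4 * thetaRatio * (thetaRatio ^ 2 + 1) / (thetaRatio ^ 2 + 3)) =
      4 * expand 2 thetaRatio * (expand 2 thetaRatio ^ 2 + 1) / (expand 2 thetaRatio ^ 2 + 3) := by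
    simp only [map_div₀, map_mul, map_add, map_pow, map_ofNat, map_one]
  rw [mul_div_assoc, map_mul, map_mul (expand 3) _
    (2 * (thetaOdd / (expand 2 thetaRatio ^ 2 + 3)) + (expand 2 thetaRatio)⁻¹), ← hβ, expand_comm 3 2] at h
  have hw2 : expand 2 thetaCubic ≠ 0 := (_root_.map_ne_zero _).mpr hw
  have hβ0 : expand 3 (4 * thetaRatio * (thetaRatio ^ 2 + 1) / (thetaRatio ^ 2 + 3)) ≠ 0 :=
    (_root_.map_ne_zero _).mpr (div_ne_zero (mul_ne_zero (mul_ne_zero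
      ((hasValue_ofNat 4).ne_zero (by norm_num)) thetaRatio_ne_zero) thetaRatio_sq_add_one_ne_zero)
      thetaRatio_sq_add_three_ne_zero)
  have hZ : expand 2 thetaCubic *
      expand 3 (2 * (thetaOdd / (expand 2 thetaRatio ^ 2 + 3)) + (expand 2 thetaRatio)⁻¹) ≠ 0 :=
    hb ▸ mul_ne_zero hβ0 (inv_ne_zero hw)
  rw [map_mul (expand 2), map_inv₀]
  have key {W w w2 B B2 Z : LaurentSeries ℂ} (hw : w ≠ 0) (hw2 : w2 ≠ 0) (hZ : w2 * Z ≠ 0)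
      (h : B * W = B2 * Z) (hb : B * w⁻¹ = w2 * Z) : W * w = B2 * w2⁻¹ := by
    refine mul_right_cancel₀ hZ ?_
    rw [mul_assoc B2, inv_mul_cancel_left₀ hw2, ← h, ← hb]
    field_simp
  exact key hw hw2 hZ h hb

/-- As 10 ≡ 1 mod 3, only the w term counts. Its E half descends through `level_six` to E + y at 5
mod 12; its y half is odd. -/
theorem vanishes_level_three_sq_sub_of_even : Vanishes 24 10
    ((slaterRatio / expand 3 slaterRatio) ^ 2 -
      ((slaterRatio / expand 3 slaterRatio) ^ 2)⁻¹) := by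
  rw [level_three_sq_sub]
  refine Vanishes.add (Vanishes.add ?_ ?_) ?_
  · exact ((graded_expand 3 _).vanishes 1 (by norm_num)).restrict ⟨8, by norm_num⟩ (by norm_num)
  · rw [add_div, map_add, add_mul, level_six]
    refine Vanishes.add (Vanishes.expand (M := 12) (a := 5) ?_ 2) ?_
    · rw [← add_sub_cancel_left (expand 3 (4 * thetaRatio / (thetaRatio ^ 2 + 3)))
        (expand 3 _ * _), ← thetaOdd_add_eq]
      exact vanishes_thetaOdd_add_twelve.sub
        (((graded_expand 3 _).vanishes 2 (by norm_num)).restrict ⟨4, by norm_num⟩ (by norm_num))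
    -- Twice this half is the odd series 4w/(x² + 3) from the dissection of E y, times a series in
    -- q².
    · have h := graded_components.2.1.mul (graded_expand 2
        (expand 3 (thetaRatio + 3 * thetaRatio⁻¹)))
      refine Vanishes.of_two_mul ?_
      have e : 2 * (expand 3 (2 * (expand 2 thetaRatio + 3 * (expand 2 thetaRatio)⁻¹) /
          (thetaRatio ^ 2 + 3)) * thetaCubic) =
          expand 3 (4 / (thetaRatio ^ 2 + 3)) * thetaCubic *
            expand 2 (expand 3 (thetaRatio + 3 * thetaRatio⁻¹)) := by
        rw [expand_comm 2 3]
        simp only [map_div₀, map_mul, map_add, map_pow, map_ofNat, map_inv₀]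
        ring
      rw [e]
      exact (h.vanishes 0 (by norm_num)).restrict ⟨12, by norm_num⟩ (by norm_num)
  · exact ((graded_expand_three_mul _ graded_thetaCubic_sq).vanishes 1 (by norm_num)).restrict
      ⟨8, by norm_num⟩ (by norm_num)

/-! ### The generating series as Laurent series -/

theorem coe_inv {p : ℂ⟦X⟧} (hp : constantCoeff p ≠ 0) :
    ((p⁻¹ : ℂ⟦X⟧) : LaurentSeries ℂ) = (p : LaurentSeries ℂ)⁻¹ := by
  refine eq_inv_of_mul_eq_one_left ?_
  rw [← map_mul, PowerSeries.inv_mul_cancel p hp, map_one]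

theorem expand_slaterRatio_eq (k : ℕ) [NeZero k] :
    expand k slaterRatio = ((X : ℂ⟦X⟧) : LaurentSeries ℂ) ^ k *
      ((slaterX (X ^ k) : LaurentSeries ℂ) / (slaterY (X ^ k) : LaurentSeries ℂ)) := by
  have h := expand_twist_slaterRatio 1 k (q := X ^ k) (by simp)
  have hk : constantCoeff ((X : ℂ⟦X⟧) ^ k) = 0 := by simp [NeZero.ne k]
  have hq : (((qPoch (X ^ k) (X ^ k))⁻¹ : ℂ⟦X⟧) : LaurentSeries ℂ) ≠ 0 :=
    (hasValue_coe _).ne_zero (by simp [constantCoeff_qPoch, NeZero.ne k])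
  have e1 : slaterX (X ^ k) = thetaOne (X ^ k) * (qPoch (X ^ k) (X ^ k))⁻¹ := rfl
  have e2 : slaterY (X ^ k) = thetaFive (X ^ k) * (qPoch (X ^ k) (X ^ k))⁻¹ := rfl
  rw [twist_one] at h
  rw [h, e1, e2, map_mul, map_mul, mul_div_mul_right _ _ hq, map_pow, mul_div_assoc]

theorem slaterRatio_eq_div : slaterRatio = ((X : ℂ⟦X⟧) : LaurentSeries ℂ) *
    ((slaterX X : LaurentSeries ℂ) / (slaterY X : LaurentSeries ℂ)) := by
  have hq : (((qPoch X X)⁻¹ : ℂ⟦X⟧) : LaurentSeries ℂ) ≠ 0 :=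
    (hasValue_coe _).ne_zero (by simp [constantCoeff_qPoch])
  have e1 : slaterX X = thetaOne X * (qPoch X X)⁻¹ := rfl
  have e2 : slaterY X = thetaFive X * (qPoch X X)⁻¹ := rfl
  rw [slaterRatio_eq, e1, e2, map_mul, map_mul, mul_div_mul_right _ _ hq, mul_div_assoc]

theorem coe_X_ne_zero : ((X : ℂ⟦X⟧) : LaurentSeries ℂ) ≠ 0 := by
  rw [PowerSeries.coe_X]
  exact HahnSeries.single_ne_zero one_ne_zero

theorem coe_slaterX_ne_zero {q : ℂ⟦X⟧} (hq : constantCoeff q = 0) :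
    (slaterX q : LaurentSeries ℂ) ≠ 0 :=
  (hasValue_coe _).ne_zero (by simp [constantCoeff_slaterX q hq])

theorem coe_slaterY_ne_zero {q : ℂ⟦X⟧} (hq : constantCoeff q = 0) :
    (slaterY q : LaurentSeries ℂ) ≠ 0 :=
  (hasValue_coe _).ne_zero (by simp [constantCoeff_slaterY q hq])

theorem coe_xiSeries_one (k : ℕ) : (xiSeries 1 k : LaurentSeries ℂ) =
    ((X : ℂ⟦X⟧) : LaurentSeries ℂ) ^ k * slaterRatio⁻¹ ^ k := by
  have h1 := coe_X_ne_zero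
  have h2 := coe_slaterX_ne_zero constantCoeff_X
  have h3 := coe_slaterY_ne_zero constantCoeff_X
  rw [xiSeries, if_pos rfl, map_mul, coe_inv (by simp [constantCoeff_slaterX]), map_pow, map_pow,
    slaterRatio_eq_div, ← mul_pow, ← inv_pow, ← mul_pow]
  congr 1
  field_simp

theorem coe_xiSeries (m k : ℕ) (hm : m + 1 ≠ 1) :
    (xiSeries (m + 1) k : LaurentSeries ℂ) = ((X : ℂ⟦X⟧) : LaurentSeries ℂ) ^ (m * k) *
      (slaterRatio / expand (m + 1) slaterRatio) ^ k := by
  have hX : constantCoeff ((X : ℂ⟦X⟧) ^ (m + 1)) = 0 := by simp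
  have h1 := coe_X_ne_zero
  have h2 := coe_slaterX_ne_zero constantCoeff_X
  have h3 := coe_slaterY_ne_zero constantCoeff_X
  have h4 := coe_slaterX_ne_zero hX
  have h5 := coe_slaterY_ne_zero hX
  rw [xiSeries, if_neg hm, map_mul, coe_inv (by simp [constantCoeff_slaterX, constantCoeff_slaterY]),
    map_mul, map_mul, map_pow, map_pow, map_pow, map_pow, expand_slaterRatio_eq,
    slaterRatio_eq_div, pow_mul, ← mul_pow, ← mul_pow, ← inv_pow, ← mul_pow, ← mul_pow]
  congr 1
  field_simp
  rw [pow_succ]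

theorem coe_xi4Series : (xi4Series : LaurentSeries ℂ) =
    ((X : ℂ⟦X⟧) : LaurentSeries ℂ) ^ 3 * (slaterRatio * expand 2 slaterRatio)⁻¹ := by
  have hX : constantCoeff ((X : ℂ⟦X⟧) ^ 2) = 0 := by simp
  have h1 := coe_X_ne_zero
  have h2 := coe_slaterX_ne_zero constantCoeff_X
  have h3 := coe_slaterY_ne_zero constantCoeff_X
  have h4 := coe_slaterX_ne_zero hX
  have h5 := coe_slaterY_ne_zero hX
  rw [xi4Series, map_mul, coe_inv (by simp [constantCoeff_slaterX]), map_mul, map_mul,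
    expand_slaterRatio_eq, slaterRatio_eq_div]
  field_simp

theorem coeff_coe_X_pow_mul (d : ℕ) (G : LaurentSeries ℂ) (n : ℤ) :
    (((X : ℂ⟦X⟧) : LaurentSeries ℂ) ^ d * G).coeff n = G.coeff (n - d) := by
  rw [PowerSeries.coe_X, HahnSeries.single_pow, HahnSeries.coeff_single_mul]
  simp

section Coefficients

variable {F : ℂ⟦X⟧} {G : LaurentSeries ℂ} {d : ℕ}

theorem coeff_eq_of_coe_eq (h : (F : LaurentSeries ℂ) = ((X : ℂ⟦X⟧) : LaurentSeries ℂ) ^ d * G)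
    (n : ℕ) : coeff n F = G.coeff (n - d) := by
  rw [← coeff_coe_X_pow_mul, ← h, LaurentSeries.coeff_coe_powerSeries]

theorem coeff_inv_eq_of_coe_eq (hF : constantCoeff F = 1)
    (h : (F : LaurentSeries ℂ) = ((X : ℂ⟦X⟧) : LaurentSeries ℂ) ^ d * G) (n : ℕ) :
    coeff n F⁻¹ = G⁻¹.coeff (n + d) := by
  have h' : (((X : ℂ⟦X⟧) : LaurentSeries ℂ) ^ d * ((F⁻¹ : ℂ⟦X⟧) : LaurentSeries ℂ)) = G⁻¹ := by
    have hX := pow_ne_zero d coe_X_ne_zero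
    rw [coe_inv (by rw [hF]; exact one_ne_zero), h, mul_inv, mul_inv_cancel_left₀ hX]
  rw [← h', coeff_coe_X_pow_mul, add_sub_cancel_right, LaurentSeries.coeff_coe_powerSeries]

/-- With F = q^d G and 1/F = q^(-d)/G, the coefficients of F at m + 2d and of 1/F at m both sit at
exponent m + d, in G and 1/G. -/
theorem coeff_eq_coeff_inv (hF : constantCoeff F = 1)
    (h : (F : LaurentSeries ℂ) = ((X : ℂ⟦X⟧) : LaurentSeries ℂ) ^ d * G) {M a : ℤ}
    (hv : Vanishes M a (G - G⁻¹)) {n m : ℕ} (hn : n = m + 2 * d)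
    (hm : ((m : ℤ) + d) % M = a % M) : coeff n F = coeff m F⁻¹ := by
  have h0 := hv (m + d) hm
  rw [coeff_eq_of_coe_eq h, coeff_inv_eq_of_coe_eq hF h, hn]
  rw [HahnSeries.coeff_sub, sub_eq_zero] at h0
  rw [← h0]
  congr 1
  push_cast
  ring

theorem coeff_eq_neg_coeff_inv (hF : constantCoeff F = 1)
    (h : (F : LaurentSeries ℂ) = ((X : ℂ⟦X⟧) : LaurentSeries ℂ) ^ d * G) {M a c : ℤ}
    (hv : Vanishes M a (G + G⁻¹ - c)) (hd : d ≠ 0) {n m : ℕ} (hn : n = m + 2 * d)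
    (hm : ((m : ℤ) + d) % M = a % M) : coeff n F = -coeff m F⁻¹ := by
  have h0 := hv (m + d) hm
  -- The constant c is harmless because d ≠ 0 makes the exponent m + d positive.
  have hc : (c : LaurentSeries ℂ).coeff (m + d) = 0 := by
    rw [← map_intCast (HahnSeries.C (Γ := ℤ) (R := ℂ)), HahnSeries.C_apply,
      HahnSeries.coeff_single_of_ne (by omega)]
  rw [coeff_eq_of_coe_eq h, coeff_inv_eq_of_coe_eq hF h, hn]
  rw [HahnSeries.coeff_sub, hc, sub_zero, HahnSeries.coeff_add] at h0
  rw [← eq_neg_of_add_eq_zero_left h0]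
  congr 1
  push_cast
  ring

end Coefficients

theorem coe_xiSeries_one_one : (xiSeries 1 1 : LaurentSeries ℂ) =
    ((X : ℂ⟦X⟧) : LaurentSeries ℂ) ^ 1 * slaterRatio⁻¹ := by
  rw [coe_xiSeries_one, pow_one slaterRatio⁻¹]

theorem coe_xiSeries_two_one : (xiSeries 2 1 : LaurentSeries ℂ) =
    ((X : ℂ⟦X⟧) : LaurentSeries ℂ) ^ 1 * (slaterRatio / expand 2 slaterRatio) := by
  rw [coe_xiSeries 1 1 (by norm_num), pow_one (_ / _)]

theorem coe_xiSeries_three_one : (xiSeries 3 1 : LaurentSeries ℂ) =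
    ((X : ℂ⟦X⟧) : LaurentSeries ℂ) ^ 2 * (slaterRatio / expand 3 slaterRatio) := by
  rw [coe_xiSeries 2 1 (by norm_num), pow_one (_ / _)]

end Slater

end

theorem theorem1p6 (n : ℕ) :
    Slater.xi 1 1 (2 * n + 3) = -Slater.xi' 1 1 (2 * n + 1) ∧
    Slater.xi 1 1 (4 * n + 2) = Slater.xi' 1 1 (4 * n) ∧
    Slater.xi 1 1 (6 * n + 2) = Slater.xi' 1 1 (6 * n) ∧
    Slater.xi 1 2 (12 * n + 7) = Slater.xi' 1 2 (12 * n + 3) ∧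
    Slater.xi 1 2 (24 * n + 12) = Slater.xi' 1 2 (24 * n + 8) ∧
    Slater.xi 2 1 (2 * n + 3) = -Slater.xi' 2 1 (2 * n + 1) ∧
    Slater.xi 2 1 (4 * n + 2) = Slater.xi' 2 1 (4 * n) ∧
    Slater.xi 2 1 (12 * n + 8) = Slater.xi' 2 1 (12 * n + 6) ∧
    Slater.xi 2 2 (12 * n + 7) = Slater.xi' 2 2 (12 * n + 3) ∧
    Slater.xi 2 2 (24 * n + 12) = Slater.xi' 2 2 (24 * n + 8) ∧
    Slater.xi 3 1 (3 * n + 5) = Slater.xi' 3 1 (3 * n + 1) ∧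
    Slater.xi 3 1 (6 * n + 8) = -Slater.xi' 3 1 (6 * n + 4) ∧
    Slater.xi 3 1 (6 * n + 4) = -Slater.xi' 3 1 (6 * n) ∧
    Slater.xi 3 1 (12 * n + 7) = Slater.xi' 3 1 (12 * n + 3) ∧
    Slater.xi 3 2 (24 * n + 14) = Slater.xi' 3 2 (24 * n + 6) ∧
    Slater.xi 3 2 (36 * n + 25) = Slater.xi' 3 2 (36 * n + 17) ∧
    Slater.xi4 (12 * n + 15) = -Slater.xi4' (12 * n + 9) ∧
    Slater.xi4 (12 * n + 7) = -Slater.xi4' (12 * n + 1) ∧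
    Slater.xi4 (12 * n + 10) = Slater.xi4' (12 * n + 4) ∧
    Slater.xi4 (12 * n + 11) = -Slater.xi4' (12 * n + 5) ∧
    Slater.xi4 (24 * n + 13) = Slater.xi4' (24 * n + 7) ∧
    Slater.xi4 (36 * n + 24) = Slater.xi4' (36 * n + 18) := by
  have c11 := Slater.constantCoeff_xiSeries 1 1 le_rfl
  have c12 := Slater.constantCoeff_xiSeries 1 2 le_rfl
  have c21 := Slater.constantCoeff_xiSeries 2 1 (by norm_num)
  have c22 := Slater.constantCoeff_xiSeries 2 2 (by norm_num)
  have c31 := Slater.constantCoeff_xiSeries 3 1 (by norm_num)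
  have c32 := Slater.constantCoeff_xiSeries 3 2 (by norm_num)
  have c4 := Slater.constantCoeff_xi4Series
  have h11 := Slater.coe_xiSeries_one_one
  have h12 := Slater.coe_xiSeries_one 2
  have h21 := Slater.coe_xiSeries_two_one
  have h22 := Slater.coe_xiSeries 1 2 (by norm_num)
  have h31 := Slater.coe_xiSeries_three_one
  have h32 := Slater.coe_xiSeries 2 2 (by norm_num)
  have h4 := Slater.coe_xi4Series
  have v1 : Slater.Vanishes 2 0 (Slater.slaterRatio⁻¹ + Slater.slaterRatio⁻¹⁻¹ - (1 : ℤ)) := by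
    simpa using Slater.vanishes_inv_add
  have v6 : Slater.Vanishes 2 0 (Slater.slaterRatio / Slater.expand 2 Slater.slaterRatio +
      (Slater.slaterRatio / Slater.expand 2 Slater.slaterRatio)⁻¹ - (-1 : ℤ)) := by
    simpa only [Int.cast_neg, Int.cast_one, sub_neg_eq_add] using Slater.vanishes_level_two_add
  have v12 : Slater.Vanishes 6 0 (Slater.slaterRatio / Slater.expand 3 Slater.slaterRatio +
      (Slater.slaterRatio / Slater.expand 3 Slater.slaterRatio)⁻¹ - (0 : ℤ)) := by
    simpa only [Int.cast_zero, sub_zero] using Slater.vanishes_level_three_add_zero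
  have v13 : Slater.Vanishes 6 2 (Slater.slaterRatio / Slater.expand 3 Slater.slaterRatio +
      (Slater.slaterRatio / Slater.expand 3 Slater.slaterRatio)⁻¹ - (0 : ℤ)) := by
    simpa only [Int.cast_zero, sub_zero] using Slater.vanishes_level_three_add_two
  have v17 : Slater.Vanishes 4 0 ((Slater.slaterRatio * Slater.expand 2 Slater.slaterRatio)⁻¹ +
      (Slater.slaterRatio * Slater.expand 2 Slater.slaterRatio)⁻¹⁻¹ - (2 : ℤ)) := by
    simpa only [Int.cast_ofNat] using Slater.vanishes_product_add
  refine ⟨?_, ?_, ?_, ?_, ?_, ?_, ?_, ?_, ?_, ?_, ?_, ?_, ?_, ?_, ?_, ?_, ?_, ?_, ?_, ?_, ?_, ?_⟩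
  · exact Slater.coeff_eq_neg_coeff_inv c11 h11 v1 one_ne_zero (by omega) (by omega)
  · exact Slater.coeff_eq_coeff_inv c11 h11 Slater.vanishes_inv_sub_four (by omega) (by omega)
  · exact Slater.coeff_eq_coeff_inv c11 h11 Slater.vanishes_inv_sub_three (by omega) (by omega)
  · exact Slater.coeff_eq_coeff_inv c12 h12 Slater.vanishes_inv_sq_sub_of_odd (by omega) (by omega)
  · exact Slater.coeff_eq_coeff_inv c12 h12 Slater.vanishes_inv_sq_sub_of_even (by omega) (by omega)
  · exact Slater.coeff_eq_neg_coeff_inv c21 h21 v6 one_ne_zero (by omega) (by omega)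
  · exact Slater.coeff_eq_coeff_inv c21 h21 Slater.vanishes_level_two_sub_four (by omega) (by omega)
  · exact Slater.coeff_eq_coeff_inv c21 h21 Slater.vanishes_level_two_sub_three (by omega)
      (by omega)
  · exact Slater.coeff_eq_coeff_inv c22 h22 Slater.vanishes_level_two_sq_sub_of_odd (by omega)
      (by omega)
  · exact Slater.coeff_eq_coeff_inv c22 h22 Slater.vanishes_level_two_sq_sub_of_even (by omega)
      (by omega)
  · exact Slater.coeff_eq_coeff_inv c31 h31 Slater.vanishes_level_three_sub (by omega) (by omega)
  · exact Slater.coeff_eq_neg_coeff_inv c31 h31 v12 two_ne_zero (by omega) (by omega)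
  · exact Slater.coeff_eq_neg_coeff_inv c31 h31 v13 two_ne_zero (by omega) (by omega)
  · exact Slater.coeff_eq_coeff_inv c31 h31 Slater.vanishes_level_three_sub_twelve (by omega)
      (by omega)
  · exact Slater.coeff_eq_coeff_inv c32 h32 Slater.vanishes_level_three_sq_sub_of_even (by omega)
      (by omega)
  · exact Slater.coeff_eq_coeff_inv c32 h32 Slater.vanishes_level_three_sq_sub_of_odd (by omega)
      (by omega)
  -- Three of the ξ_4 claims are the classes mod 12 of a single one: m = 12n + 9, 12n + 1 and 12n +
  -- 5 all have m + 3 ≡ 0 mod 4.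
  · exact Slater.coeff_eq_neg_coeff_inv c4 h4 v17 three_ne_zero (by omega) (by omega)
  · exact Slater.coeff_eq_neg_coeff_inv c4 h4 v17 three_ne_zero (by omega) (by omega)
  · exact Slater.coeff_eq_coeff_inv c4 h4 Slater.vanishes_product_sub_twelve (by omega) (by omega)
  · exact Slater.coeff_eq_neg_coeff_inv c4 h4 v17 three_ne_zero (by omega) (by omega)
  · exact Slater.coeff_eq_coeff_inv c4 h4 Slater.vanishes_product_sub_of_even (by omega) (by omega)
  · exact Slater.coeff_eq_coeff_inv c4 h4 Slater.vanishes_product_sub_thirtysix (by omega)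
      (by omega)
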